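/- Let $n\ge 1$ and let $O_n$ be the orthogonal group of Euclidean space $\mathbb R^n$. A reflection (respectively, a rotation) is an element of $O_n$ whose fixed point subspace has codimension one (respectively, two). A reflection group (respectively, a rotation group) in $O_n$ is a finite subgroup of $O_n$ generated by reflections (respectively, by rotations); for a subgroup $G<O_n$ put $G^+=G\cap SO_n$, its orientation preserving subgroup. Let $W<O_n$ be a reflection group acting irreducibly on $\mathbb R^n$. Then the following are equivalent: (a) there exists a rotation $h\in SO_n\setminus W$ that normalizes $W$ and $W^+$ and is such that $W^*=\langle W^+,h\rangle$ is a rotation group which is not the orientation preserving subgroup of any reflection group in $O_n$; (b) $W$ has type $A_4$, $D_4$, $F_4$, $A_5$ or $E_6$. Moreover, in this case the group $W^*$ is unique, that is, the subgroup $\langle W^+,h\rangle$ of $O_n$ is the same for all $h$ as in (a). Here $W$ is said to have the type given by a Coxeter matrix $(m_{ij})$ if $W$ is generated by the reflections in the hyperplanes $\alpha_i^{\perp}$ for a basis $(\alpha_i)$ of $\mathbb R^n$ consisting of unit vectors with $\langle\alpha_i,\alpha_j\rangle=-\cos(\pi/m_{ij})$ for all $i,j$. -/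

import Mathlib

/-- The orthogonal group `O_n`, as the group of linear isometries of Euclidean `n`-space. -/
abbrev OrthGroup (n : ℕ) : Type :=
  EuclideanSpace ℝ (Fin n) ≃ₗᵢ[ℝ] EuclideanSpace ℝ (Fin n)

/-- The special orthogonal group `SO_n`: the orthogonal transformations of determinant one. -/
noncomputable def SOGroup (n : ℕ) : Subgroup (OrthGroup n) where
  carrier := {g | LinearMap.det
    (g.toLinearEquiv : EuclideanSpace ℝ (Fin n) →ₗ[ℝ] EuclideanSpace ℝ (Fin n)) = 1}
  one_mem' := LinearMap.det_id
  mul_mem' := by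
    intro a b ha hb
    change LinearMap.det ((a.toLinearEquiv : EuclideanSpace ℝ (Fin n) →ₗ[ℝ] _) ∘ₗ
      (b.toLinearEquiv : EuclideanSpace ℝ (Fin n) →ₗ[ℝ] _)) = 1
    rw [LinearMap.det_comp]
    rw [Set.mem_ofPred_eq] at ha hb
    rw [ha, hb, one_mul]
  inv_mem' := by
    intro a ha
    rw [Set.mem_ofPred_eq] at ha
    have h : LinearMap.det (a.toLinearEquiv.symm : EuclideanSpace ℝ (Fin n) →ₗ[ℝ] _) *
        LinearMap.det (a.toLinearEquiv : EuclideanSpace ℝ (Fin n) →ₗ[ℝ] _) = 1 :=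
      LinearEquiv.det_symm_mul_det a.toLinearEquiv
    rw [ha, mul_one] at h
    exact h

/-- The fixed point subspace of an orthogonal transformation. -/
noncomputable def fixedSpace {n : ℕ} (g : OrthGroup n) : Submodule ℝ (EuclideanSpace ℝ (Fin n)) :=
  LinearMap.eqLocus
    (g.toLinearEquiv : EuclideanSpace ℝ (Fin n) →ₗ[ℝ] EuclideanSpace ℝ (Fin n)) LinearMap.id

/-- A reflection: an orthogonal transformation whose fixed point subspace has codimension one. -/
def IsReflection {n : ℕ} (g : OrthGroup n) : Prop :=
  Module.finrank ℝ (fixedSpace g) + 1 = n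

/-- A rotation: an orthogonal transformation whose fixed point subspace has codimension two. -/
def IsRotation {n : ℕ} (g : OrthGroup n) : Prop :=
  Module.finrank ℝ (fixedSpace g) + 2 = n

/-- A (real) reflection group: a finite group generated by reflections. -/
def IsReflectionGroup {n : ℕ} (W : Subgroup (OrthGroup n)) : Prop :=
  Finite W ∧ ∃ S : Set (OrthGroup n), (∀ s ∈ S, IsReflection s) ∧ W = Subgroup.closure S

/-- A rotation group: a finite group generated by rotations. -/
def IsRotationGroup {n : ℕ} (G : Subgroup (OrthGroup n)) : Prop :=
  Finite G ∧ ∃ S : Set (OrthGroup n), (∀ s ∈ S, IsRotation s) ∧ G = Subgroup.closure S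

/-- `G` acts irreducibly on `ℝⁿ`: the space is nonzero, and `0` and `ℝⁿ` are the only
`G`-invariant linear subspaces. -/
def ActsIrreducibly {n : ℕ} (G : Subgroup (OrthGroup n)) : Prop :=
  0 < n ∧ ∀ U : Submodule ℝ (EuclideanSpace ℝ (Fin n)),
    (∀ g ∈ G, ∀ v ∈ U, g v ∈ U) → U = ⊥ ∨ U = ⊤

/-- The orientation preserving subgroup `G⁺ = G ∩ SO_n`. -/
noncomputable def orientationPreserving {n : ℕ} (G : Subgroup (OrthGroup n)) : Subgroup (OrthGroup n) :=
  G ⊓ SOGroup n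

/-- `W` has the type given by the Coxeter matrix `M`: it is generated by the reflections in the
hyperplanes orthogonal to the vectors `α i` of some basis of `ℝⁿ` consisting of unit vectors with
`⟪α i, α j⟫ = -cos (π / M i j)`. Equivalently, `W` has a chamber whose walls have unit normals
`α i`, and the Coxeter diagram read off from this chamber is the one of `M`. -/
def HasCoxeterType {n : ℕ} {ι : Type} (W : Subgroup (OrthGroup n)) (M : CoxeterMatrix ι) : Prop :=
  ∃ α : Module.Basis ι ℝ (EuclideanSpace ℝ (Fin n)),
    (∀ i j, inner ℝ (α i) (α j) = -Real.cos (Real.pi / (M i j : ℝ))) ∧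
    W = Subgroup.closure (Set.range fun i => (Submodule.span ℝ {α i})ᗮ.reflection)

/-- The Coxeter matrix of type `D₄`: the node `1` is joined to each of the nodes `0`, `2` and `3` by
a bond labelled three, and there are no other bonds. (Mathlib's `CoxeterMatrix.D 4` is not used: it
has an additional bond between `2` and `3`, so its diagram contains a triangle.) -/
def coxeterMatrixD4 : CoxeterMatrix (Fin 4) where
  M := !![1, 3, 2, 2;
          3, 1, 3, 3;
          2, 3, 1, 2;
          2, 3, 2, 1]
  isSymm := by decide
  diagonal := by decide
  off_diagonal := by
    intro i j hij
    fin_cases i <;> fin_cases j <;> simp at hij ⊢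

/-- `W` has type `A₄`, `D₄`, `F₄`, `A₅` or `E₆`. -/
def HasExtendableType {n : ℕ} (W : Subgroup (OrthGroup n)) : Prop :=
  HasCoxeterType W (CoxeterMatrix.A 4) ∨ HasCoxeterType W coxeterMatrixD4 ∨
  HasCoxeterType W CoxeterMatrix.F₄ ∨ HasCoxeterType W (CoxeterMatrix.A 5) ∨
  HasCoxeterType W CoxeterMatrix.E₆

/-- The group `⟨W⁺, h⟩` generated by the orientation preserving subgroup of `W` and `h`. -/
noncomputable def extendedGroup {n : ℕ} (W : Subgroup (OrthGroup n)) (h : OrthGroup n) :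
    Subgroup (OrthGroup n) :=
  Subgroup.closure ((orientationPreserving W : Set (OrthGroup n)) ∪ {h})

/-- `h ∈ SO_n \ W` is a rotation that normalizes `W` and `W⁺` such that `⟨W⁺, h⟩` is a rotation
group which is not the orientation preserving subgroup of any reflection group. -/
structure IsExtendingRotation {n : ℕ} (W : Subgroup (OrthGroup n)) (h : OrthGroup n) : Prop where
  isRotation : IsRotation h
  mem_SO : h ∈ SOGroup n
  notMem : h ∉ W
  normalizes : ∀ g, g ∈ W ↔ h * g * h⁻¹ ∈ W
  normalizes_orientationPreserving :
    ∀ g, g ∈ orientationPreserving W ↔ h * g * h⁻¹ ∈ orientationPreserving W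
  isRotationGroup : IsRotationGroup (extendedGroup W h)
  not_orientationPreserving :
    ¬ ∃ W' : Subgroup (OrthGroup n), IsReflectionGroup W' ∧
      extendedGroup W h = orientationPreserving W'

/-! Fix a simple system of `W`. The chamber is a fundamental domain whose point stabilizers are
generated by simple reflections, so an element `h` normalizing `W` is `w * a` with `w ∈ W` and `a` a
permutation `σ` of the simple roots. Choosing the chamber through a generic point of the fixed space
of `h` makes the fixed space of `a` at least as large as that of `h`. For a rotation `h` the
codimension is thus at most two, so `σ` is trivial, a transposition, a three-cycle or a product of
two disjoint transpositions. If `σ` is trivial, then `h ∈ W`. If it is a transposition, then `a` is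
a reflection and `⟨W⁺, h⟩ = ⟨W, a⟩⁺`. Hence `σ` is a three-cycle or a double transposition. Positive
definiteness of the Gram matrix forbids the affine subdiagrams, and the only connected diagrams left
with such a symmetry are A₄, D₄, F₄, A₅ and E₆ (`realizes_of_threeCycle`, `realizes_of_doubleSwap`).

Conversely, let `a` realize such a `σ`. `W⁺` is generated by the products of two distinct simple
reflections, which are rotations, so `⟨W⁺, a⟩` is a rotation group. Suppose that it were `W'⁺` for a
reflection group `W'`. The main point is that `W` and `W'` share a reflection (`exists_refl_mem`).
Choose simple roots `α i`, `α j`, `α k` spanning a subsystem of type A₃ or B₃, with `c = s_i s_j` of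
order three. As `c` is a nontrivial element of `W'`, some reflection `s_ρ` of `W'` has `ρ` in the
plane of `c`. Conjugating `c` by `s_ρ` only inverts it, but `s_k c s_k` has another axis, and its
conjugate `g` by `s_ρ` lies in `W'⁺ = ⟨W⁺, a⟩`. It fixes a chamber point `x` orthogonal to exactly
these three simple roots. No nontrivial power of `σ` preserves that triple, so `g` lies in the
stabilizer of `x` in `W`, which acts by symmetries of a cube. The axis of `g` must then be a
diagonal of the cube, and a computation leaves for `ρ` only the three roots in the plane of `c`, so
`s_ρ ∈ W`. For any reflection `r` of `W'` now `r * s_ρ ∈ W'⁺`, so `r = w * a ^ t`; the fixed space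
bound gives `a ^ t = 1`. Hence `W' ≤ W`, contradicting `a ∉ W`.

Uniqueness holds because the only diagram automorphisms other than the identity and transpositions
are `σ` and `σ⁻¹`, and these give the same group. -/

open scoped RealInnerProductSpace
set_option linter.unusedSectionVars false

/-! ### Reflections, determinants and fixed spaces. -/

namespace ReflectionGroup

/-- Euclidean `n`-space. -/
abbrev Euc (n : ℕ) : Type := EuclideanSpace ℝ (Fin n)

variable {n : ℕ}

/-- The reflection in the hyperplane orthogonal to `v`. -/
noncomputable abbrev refl (v : Euc n) : OrthGroup n := (Submodule.span ℝ {v})ᗮ.reflection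

theorem mul_apply (g h : OrthGroup n) (x : Euc n) : (g * h) x = g (h x) := rfl

theorem one_apply (x : Euc n) : (1 : OrthGroup n) x = x := rfl

theorem inv_apply_self (g : OrthGroup n) (x : Euc n) : g⁻¹ (g x) = x := by
  rw [← mul_apply, inv_mul_cancel, one_apply]

theorem apply_inv_self (g : OrthGroup n) (x : Euc n) : g (g⁻¹ x) = x := by
  rw [← mul_apply, mul_inv_cancel, one_apply]

theorem inner_map (g : OrthGroup n) (x y : Euc n) : ⟪g x, g y⟫ = ⟪x, y⟫ :=
  g.inner_map_map x y

theorem inner_inv_right (g : OrthGroup n) (x y : Euc n) : ⟪x, g⁻¹ y⟫ = ⟪g x, y⟫ := by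
  rw [← inner_map g, apply_inv_self]

theorem inv_apply_eq {g : OrthGroup n} {x y : Euc n} : g⁻¹ x = y ↔ x = g y := by
  constructor
  · rintro rfl; rw [apply_inv_self]
  · rintro rfl; rw [inv_apply_self]

theorem inner_self_of_norm {v : Euc n} (hv : ‖v‖ = 1) : ⟪v, v⟫ = 1 := by
  rw [real_inner_self_eq_norm_sq, hv]; norm_num

theorem norm_of_inner_self {v : Euc n} (hv : ⟪v, v⟫ = 1) : ‖v‖ = 1 := by
  rw [real_inner_self_eq_norm_sq] at hv
  nlinarith [norm_nonneg v]

theorem refl_apply_of_norm {v : Euc n} (hv : ‖v‖ = 1) (x : Euc n) :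
    refl v x = x - (2 * ⟪v, x⟫) • v := by
  rw [refl, Submodule.reflection_orthogonal_apply, Submodule.reflection_singleton_apply, hv]
  simp only [RCLike.ofReal_real_eq_id, id]
  module

theorem refl_apply_self (v : Euc n) : refl v v = -v :=
  Submodule.reflection_orthogonalComplement_singleton_eq_neg v

theorem refl_refl (v x : Euc n) : refl v (refl v x) = x := Submodule.reflection_reflection _ _

theorem refl_mul_self (v : Euc n) : refl v * refl v = 1 := Submodule.reflection_mul_reflection _

theorem refl_inv (v : Euc n) : (refl v)⁻¹ = refl v := Submodule.reflection_inv

theorem refl_apply_eq_self_iff {v x : Euc n} : refl v x = x ↔ ⟪v, x⟫ = 0 := by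
  rw [refl, Submodule.reflection_eq_self_iff, Submodule.mem_orthogonal_singleton_iff_inner_right]

theorem refl_smul {c : ℝ} (hc : c ≠ 0) (v : Euc n) : refl (c • v) = refl v := by
  unfold refl
  congr 2
  exact Submodule.span_singleton_smul_eq (IsUnit.mk0 c hc) v

theorem refl_neg (v : Euc n) : refl (-v) = refl v := by
  rw [← refl_smul (c := -1) (by norm_num) v, neg_one_smul]

theorem exists_unit {v : Euc n} (hv : v ≠ 0) : ‖(‖v‖⁻¹ • v)‖ = 1 := by
  rw [norm_smul, norm_inv, norm_norm, inv_mul_cancel₀ (norm_ne_zero_iff.mpr hv)]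

theorem refl_apply {v : Euc n} (hv : v ≠ 0) (x : Euc n) :
    refl v x = x - (2 * ⟪v, x⟫ / ⟪v, v⟫) • v := by
  have hn : ‖v‖ ≠ 0 := norm_ne_zero_iff.mpr hv
  rw [← refl_smul (inv_ne_zero hn) v, refl_apply_of_norm (exists_unit hv), smul_smul,
    inner_smul_left, real_inner_self_eq_norm_sq]
  congr 2
  simp only [conj_trivial]
  field_simp

theorem conj_refl (g : OrthGroup n) (v : Euc n) : g * refl v * g⁻¹ = refl (g v) := by
  rcases eq_or_ne v 0 with rfl | hv
  · ext1 x
    have h0 (y : Euc n) : refl (0 : Euc n) y = y := refl_apply_eq_self_iff.mpr (by simp)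
    rw [map_zero, h0, mul_apply, mul_apply, h0, apply_inv_self]
  · ext1 x
    have hg : g v ≠ 0 := by rwa [Ne, map_eq_zero_iff g g.injective]
    rw [mul_apply, mul_apply, refl_apply hv, refl_apply hg, map_sub, map_smul, apply_inv_self,
      inner_inv_right, inner_map]

theorem eq_or_eq_neg_of_smul {v w : Euc n} (hv : ‖v‖ = 1) (hw : ‖w‖ = 1) {c : ℝ}
    (h : w = c • v) : w = v ∨ w = -v := by
  have : |c| = 1 := by rw [h, norm_smul, hv, mul_one] at hw; exact hw
  rcases eq_or_eq_neg_of_abs_eq this with rfl | rfl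
  · left; simpa using h
  · right; simpa using h

theorem eq_or_eq_neg_of_refl_neg {v w : Euc n} (hv : ‖v‖ = 1) (hw : ‖w‖ = 1)
    (h : refl v w = -w) : w = v ∨ w = -v := by
  rw [refl_apply_of_norm hv] at h
  refine eq_or_eq_neg_of_smul hv hw (c := ⟪v, w⟫) ?_
  have : (2 : ℝ) • w = (2 : ℝ) • (⟪v, w⟫ • v) := by
    rw [smul_smul, ← sub_eq_zero, two_smul]
    rw [← sub_eq_zero] at h
    rw [← h]; abel
  exact smul_right_injective _ two_ne_zero this

theorem eq_or_eq_neg_of_refl_eq {v w : Euc n} (hv : ‖v‖ = 1) (hw : ‖w‖ = 1)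
    (h : refl v = refl w) : w = v ∨ w = -v :=
  eq_or_eq_neg_of_refl_neg hv hw (by rw [h, refl_apply_self])

theorem refl_ne_one {v : Euc n} (hv : v ≠ 0) : refl v ≠ 1 := by
  intro h
  have h1 : refl v v = v := by rw [h, one_apply]
  rw [refl_apply_eq_self_iff, inner_self_eq_zero] at h1
  exact hv h1

theorem ne_zero_of_norm {v : Euc n} (hv : ‖v‖ = 1) : v ≠ 0 := by
  rintro rfl; simp at hv

/-- The determinant, as a homomorphism. -/
noncomputable def odet (n : ℕ) : OrthGroup n →* ℝ where
  toFun g := LinearMap.det (g.toLinearEquiv : Euc n →ₗ[ℝ] Euc n)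
  map_one' := LinearMap.det_id
  map_mul' a b := by
    rw [← LinearMap.det_comp]; rfl

theorem mem_SOGroup {g : OrthGroup n} : g ∈ SOGroup n ↔ odet n g = 1 := Iff.rfl

theorem odet_refl {v : Euc n} (hv : v ≠ 0) : odet n (refl v) = -1 := by
  have h := Submodule.det_reflection (Submodule.span ℝ {v})ᗮ
  rw [Submodule.orthogonal_orthogonal, finrank_span_singleton hv, pow_one] at h
  exact h

theorem mem_orientationPreserving {G : Subgroup (OrthGroup n)} {g : OrthGroup n} :
    g ∈ orientationPreserving G ↔ g ∈ G ∧ odet n g = 1 := Iff.rfl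

theorem mem_fixedSpace {g : OrthGroup n} {x : Euc n} : x ∈ fixedSpace g ↔ g x = x := Iff.rfl

theorem fixedSpace_refl (v : Euc n) : fixedSpace (refl v) = (Submodule.span ℝ {v})ᗮ := by
  ext x
  rw [mem_fixedSpace, refl_apply_eq_self_iff, Submodule.mem_orthogonal_singleton_iff_inner_right]

theorem finrank_span_orthogonal {v : Euc n} (hv : v ≠ 0) :
    Module.finrank ℝ (Submodule.span ℝ {v})ᗮ + 1 = n := by
  have := Submodule.finrank_add_finrank_orthogonal (Submodule.span ℝ {v})
  rw [finrank_span_singleton hv, finrank_euclideanSpace_fin] at this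
  omega

theorem isReflection_refl {v : Euc n} (hv : v ≠ 0) : IsReflection (refl v) := by
  rw [IsReflection, fixedSpace_refl]
  exact finrank_span_orthogonal hv

theorem isReflection_iff {g : OrthGroup n} :
    IsReflection g ↔ ∃ v : Euc n, ‖v‖ = 1 ∧ g = refl v := by
  constructor
  · intro h
    have h1 := Submodule.finrank_add_finrank_orthogonal (fixedSpace g)
    rw [finrank_euclideanSpace_fin] at h1
    have h2 : Module.finrank ℝ (fixedSpace g)ᗮ = 1 := by
      unfold IsReflection at h; omega
    obtain ⟨v, hv0, hv⟩ := finrank_eq_one_iff'.mp h2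
    have hv0' : (v : Euc n) ≠ 0 := by simpa using hv0
    have hspan : (Submodule.span ℝ {(v : Euc n)}) = (fixedSpace g)ᗮ := by
      apply le_antisymm
      · rw [Submodule.span_singleton_le_iff_mem]; exact v.2
      · intro w hw
        obtain ⟨c, hc⟩ := hv ⟨w, hw⟩
        rw [Submodule.mem_span_singleton]
        exact ⟨c, by simpa using congrArg Subtype.val hc⟩
    have hfix : fixedSpace g = (Submodule.span ℝ {(v : Euc n)})ᗮ := by
      rw [hspan, Submodule.orthogonal_orthogonal]
    have hgv : g v ∈ (fixedSpace g)ᗮ := by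
      intro u hu
      rw [← mem_fixedSpace.mp hu, inner_map]
      exact v.2 u hu
    obtain ⟨c, hc⟩ := Submodule.mem_span_singleton.mp (hspan.ge hgv)
    have hc1 : c * c = 1 := by
      have := inner_map g (v : Euc n) v
      rw [← hc, inner_smul_left, inner_smul_right] at this
      simp only [conj_trivial] at this
      have h3 : ⟪(v : Euc n), v⟫ ≠ 0 := by rwa [Ne, inner_self_eq_zero]
      rw [← mul_assoc] at this
      exact mul_right_cancel₀ h3 (by linarith)
    have hc2 : c = -1 := by
      rcases mul_self_eq_one_iff.mp hc1 with rfl | h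
      · exfalso
        rw [one_smul] at hc
        have h5 : (v : Euc n) ∈ fixedSpace g := mem_fixedSpace.mpr hc.symm
        have := v.2 _ h5
        rw [inner_self_eq_zero] at this
        exact hv0' this
      · exact h
    have hn : ‖(v : Euc n)‖⁻¹ ≠ 0 := inv_ne_zero (norm_ne_zero_iff.mpr hv0')
    refine ⟨‖(v : Euc n)‖⁻¹ • v, exists_unit hv0', ?_⟩
    rw [refl_smul hn]
    ext1 x
    obtain ⟨y, hy, z, hz, rfl⟩ := (Submodule.span ℝ {(v : Euc n)}).exists_add_mem_mem_orthogonal x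
    obtain ⟨b, rfl⟩ := Submodule.mem_span_singleton.mp hy
    have h1 : refl (v : Euc n) z = z := mem_fixedSpace.mp (by rwa [fixedSpace_refl])
    have h3 : g z = z := mem_fixedSpace.mp (hfix.ge hz)
    rw [map_add, map_add, map_smul, map_smul, refl_apply_self, ← hc, hc2, h1, h3, neg_one_smul]
  · rintro ⟨v, hv, rfl⟩
    exact isReflection_refl (ne_zero_of_norm hv)

end ReflectionGroup

/-! ### Simple systems, the chamber as a fundamental domain, and the normalizer. -/

namespace ReflectionGroup
variable {n : ℕ}

theorem apply_eq_self_of_mem_closure {S : Set (OrthGroup n)} {x : Euc n}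
    (hS : ∀ s ∈ S, s x = x) {g : OrthGroup n} (hg : g ∈ Subgroup.closure S) : g x = x := by
  induction hg using Subgroup.closure_induction with
  | mem s hs => exact hS s hs
  | one => rfl
  | mul g g' _ _ h1 h2 => rw [mul_apply, h2, h1]
  | inv g _ h1 => rw [inv_apply_eq, h1]

/-- A real vector space is not a finite union of proper subspaces: avoid the subspaces `U ∩ s⊥` that
differ from `U`. It is applied with `U` a fixed space and `S` the roots. -/
theorem exists_generic (U : Submodule ℝ (Euc n)) {S : Set (Euc n)} (hS : S.Finite) :
    ∃ u ∈ U, ∀ s ∈ S, ⟪u, s⟫ = 0 → ∀ x ∈ U, ⟪x, s⟫ = 0 := by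
  classical
  let K : Euc n → Submodule ℝ U := fun s =>
    LinearMap.ker ((innerₛₗ ℝ s : Euc n →ₗ[ℝ] ℝ) ∘ₗ U.subtype)
  have hK (s : Euc n) (x : U) : x ∈ K s ↔ ⟪(x : Euc n), s⟫ = 0 := by
    rw [real_inner_comm]; rfl
  let T : Finset (Subspace ℝ U) := (hS.toFinset.image K).filter (· ≠ ⊤)
  have hT : ⊤ ∉ T := by simp [T]
  have h := Subspace.biUnion_ne_univ_of_top_notMem hT
  rw [Set.ne_univ_iff_exists_notMem] at h
  obtain ⟨u, hu⟩ := h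
  refine ⟨u, u.2, fun s hs h0 x hx => ?_⟩
  by_contra hne
  apply hu
  rw [Set.mem_iUnion₂]
  refine ⟨K s, ?_, (hK s u).mpr h0⟩
  rw [Finset.mem_filter]
  refine ⟨Finset.mem_image_of_mem _ (by simpa using hs), fun htop => hne ?_⟩
  exact (hK s ⟨x, hx⟩).mp (by rw [htop]; trivial)

theorem eq_or_eq_neg_of_orthogonal {u v : Euc n} (hu : ‖u‖ = 1) (hv : ‖v‖ = 1)
    (h : ∀ x, ⟪x, v⟫ = 0 → ⟪x, u⟫ = 0) : u = v ∨ u = -v := by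
  refine eq_or_eq_neg_of_smul hv hu (c := ⟪v, u⟫) ?_
  have h1 : ⟪u - ⟪v, u⟫ • v, v⟫ = 0 := by
    rw [inner_sub_left, inner_smul_left, inner_self_of_norm hv, real_inner_comm]; simp
  have h2 := h _ h1
  rw [← sub_eq_zero, ← inner_self_eq_zero (𝕜 := ℝ)]
  rw [inner_sub_right, h2, inner_smul_right, h1]; simp

section Basis
variable {ι : Type*} [Fintype ι]

theorem inner_eq_sum (α : Module.Basis ι ℝ (Euc n)) (y v : Euc n) :
    ⟪y, v⟫ = ∑ j, α.repr v j * ⟪y, α j⟫ := by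
  conv_lhs => rw [← α.sum_repr v, inner_sum]
  simp only [inner_smul_right]

theorem exists_dual (α : Module.Basis ι ℝ (Euc n)) (f : ι → ℝ) :
    ∃ x : Euc n, ∀ i, ⟪x, α i⟫ = f i := by
  let L : Euc n →L[ℝ] ℝ := LinearMap.toContinuousLinearMap (α.constr ℝ f)
  refine ⟨(InnerProductSpace.toDual ℝ (Euc n)).symm L, fun i => ?_⟩
  rw [InnerProductSpace.toDual_symm_apply]
  exact α.constr_basis ℝ f i

theorem exists_isometry (α : Module.Basis ι ℝ (Euc n)) (σ : Equiv.Perm ι)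
    (h : ∀ i j, ⟪α (σ i), α (σ j)⟫ = ⟪α i, α j⟫) :
    ∃ a : OrthGroup n, ∀ i, a (α i) = α (σ i) := by
  let f : Euc n ≃ₗ[ℝ] Euc n := α.equiv α σ
  have hf (i : ι) : f (α i) = α (σ i) := by simp [f]
  have hin (x y : Euc n) : ⟪f x, f y⟫ = ⟪x, y⟫ := by
    have e (z : Euc n) : f z = ∑ i, α.repr z i • α (σ i) := by
      conv_lhs => rw [← α.sum_repr z, map_sum]
      simp only [map_smul, hf]
    rw [e x, e y]
    conv_rhs => rw [← α.sum_repr x, ← α.sum_repr y]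
    simp only [sum_inner, inner_sum, inner_smul_left, inner_smul_right, h]
  exact ⟨f.isometryOfInner hin, hf⟩

theorem ext_basis (α : Module.Basis ι ℝ (Euc n)) {g h : OrthGroup n}
    (H : ∀ i, g (α i) = h (α i)) : g = h := by
  have : (g.toLinearEquiv : Euc n →ₗ[ℝ] Euc n) = (h.toLinearEquiv : Euc n →ₗ[ℝ] Euc n) :=
    α.ext H
  ext1 x
  exact LinearMap.congr_fun this x

theorem odet_of_perm [DecidableEq ι] (α : Module.Basis ι ℝ (Euc n)) {a : OrthGroup n}
    {σ : Equiv.Perm ι} (h : ∀ i, a (α i) = α (σ i)) : odet n a = ((Equiv.Perm.sign σ : ℤ) : ℝ) := by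
  change LinearMap.det (a.toLinearEquiv : Euc n →ₗ[ℝ] Euc n) = _
  rw [← LinearMap.det_toMatrix α, ← Matrix.det_transpose]
  have : (LinearMap.toMatrix α α (a.toLinearEquiv : Euc n →ₗ[ℝ] Euc n)).transpose
      = σ.permMatrix ℝ := by
    ext i j
    rw [Matrix.transpose_apply, LinearMap.toMatrix_apply]
    change α.repr (a (α i)) j = _
    rw [h, α.repr_self, Finsupp.single_apply, Equiv.Perm.permMatrix, PEquiv.toMatrix_apply]
    simp [eq_comm]
  rw [this, Matrix.det_permutation]

theorem repr_refl {α : Module.Basis ι ℝ (Euc n)} {j : ι} (hj : ‖α j‖ = 1) (v : Euc n) {k : ι} (hk : k ≠ j) :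
    α.repr (refl (α j) v) k = α.repr v k := by
  rw [refl_apply_of_norm hj, map_sub, map_smul, α.repr_self, Finsupp.sub_apply,
    Finsupp.smul_apply, Finsupp.single_eq_of_ne hk]
  simp

/-- Reflecting in `α j` changes only the `j`-th coordinate, so every other coordinate of `v` is both
nonnegative and nonpositive. -/
theorem eq_simple_of_refl_nonpos {α : Module.Basis ι ℝ (Euc n)} {j : ι} (hj : ‖α j‖ = 1)
    {v : Euc n} (hv : ‖v‖ = 1)
    (h0 : ∀ k, 0 ≤ α.repr v k) (h1 : ∀ k, α.repr (refl (α j) v) k ≤ 0) : v = α j := by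
  classical
  have hz (k : ι) (hk : k ≠ j) : α.repr v k = 0 :=
    le_antisymm (by rw [← repr_refl hj v hk]; exact h1 k) (h0 k)
  have hv' : v = α.repr v j • α j := by
    apply α.repr.injective
    ext k
    rw [map_smul, α.repr_self, Finsupp.smul_apply]
    by_cases hk : k = j
    · subst hk; simp
    · rw [hz k hk, Finsupp.single_eq_of_ne hk]; simp
  rcases eq_or_eq_neg_of_smul hj hv hv' with h2 | h2
  · exact h2
  · have := h0 j
    rw [h2, map_neg, α.repr_self, Finsupp.neg_apply, Finsupp.single_eq_same] at this
    linarith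

end Basis

/-- `α` is a simple system for the finite reflection group `W`: the reflections in the unit vectors
`α i` generate `W`, and each image of some `α i` under `W` has coordinates of constant sign. -/
structure SimpleSystem {ι : Type*} (W : Subgroup (OrthGroup n))
    (α : Module.Basis ι ℝ (Euc n)) : Prop where
  norm : ∀ i, ‖α i‖ = 1
  eq_closure : W = Subgroup.closure (Set.range fun i => refl (α i))
  dichotomy : ∀ w ∈ W, ∀ i,
    (∀ j, 0 ≤ α.repr (w (α i)) j) ∨ (∀ j, α.repr (w (α i)) j ≤ 0)

/-- The closed chamber of a basis. -/
def Chamber {ι : Type*} (α : Module.Basis ι ℝ (Euc n)) (x : Euc n) : Prop := ∀ i, 0 ≤ ⟪x, α i⟫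

/-- The product of simple reflections given by a word. -/
noncomputable def word {ι : Type*} (α : Module.Basis ι ℝ (Euc n)) (l : List ι) : OrthGroup n :=
  (l.map fun i => refl (α i)).prod

namespace SimpleSystem
variable {ι : Type*} [Fintype ι] {W : Subgroup (OrthGroup n)} {α : Module.Basis ι ℝ (Euc n)}

theorem refl_mem (h : SimpleSystem W α) (i : ι) : refl (α i) ∈ W := by
  rw [h.eq_closure]; exact Subgroup.subset_closure ⟨i, rfl⟩

theorem word_mem (h : SimpleSystem W α) (l : List ι) : word α l ∈ W := by
  apply Subgroup.list_prod_mem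
  intro x hx
  obtain ⟨i, -, rfl⟩ := List.mem_map.mp hx
  exact h.refl_mem i

theorem exists_word (h : SimpleSystem W α) {w : OrthGroup n} (hw : w ∈ W) :
    ∃ l, word α l = w := by
  rw [h.eq_closure] at hw
  induction hw using Subgroup.closure_induction with
  | mem x hx => obtain ⟨i, rfl⟩ := hx; exact ⟨[i], by simp [word]⟩
  | one => exact ⟨[], rfl⟩
  | mul x y _ _ hx hy =>
    obtain ⟨l, rfl⟩ := hx
    obtain ⟨m, rfl⟩ := hy
    exact ⟨l ++ m, by simp [word]⟩
  | inv x _ hx =>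
    obtain ⟨l, rfl⟩ := hx
    refine ⟨l.reverse, ?_⟩
    rw [word, word, List.prod_inv_reverse, List.map_reverse, List.map_map]
    simp only [Function.comp_def, refl_inv]

theorem apply_norm (h : SimpleSystem W α) (w : OrthGroup n) (i : ι) : ‖w (α i)‖ = 1 := by
  rw [w.norm_map, h.norm]

theorem eq_simple_of_refl_nonpos (h : SimpleSystem W α) {v : Euc n} (hv : ‖v‖ = 1) {j : ι}
    (h0 : ∀ k, 0 ≤ α.repr v k) (h1 : ∀ k, α.repr (refl (α j) v) k ≤ 0) : v = α j :=
  ReflectionGroup.eq_simple_of_refl_nonpos (h.norm j) hv h0 h1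

/-- Read the word from its right end. At the letter `j` where the image of `α k` turns nonpositive,
that image was `α j`; so `s_j t = t s_k` for the suffix `t` to the right of `j`, and `j` cancels
against the appended `s_k`. -/
theorem deletion (h : SimpleSystem W α) (k : ι) (l : List ι)
    (hl : ∀ j, α.repr (word α l (α k)) j ≤ 0) :
    ∃ l' : List ι, l'.length < l.length ∧ word α l' = word α l * refl (α k) := by
  induction l with
  | nil =>
    exfalso
    have := hl k
    rw [word, List.map_nil, List.prod_nil, one_apply, α.repr_self,
      Finsupp.single_eq_same] at this
    linarith
  | cons j t ih =>
    have hw : word α (j :: t) = refl (α j) * word α t := by simp [word]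
    by_cases ht : ∀ j, α.repr (word α t (α k)) j ≤ 0
    · obtain ⟨l', hl', he⟩ := ih ht
      refine ⟨j :: l', by simpa using hl', ?_⟩
      rw [hw, mul_assoc, ← he]; simp [word]
    · have h0 := (h.dichotomy _ (h.word_mem t) k).resolve_right ht
      rw [hw, mul_apply] at hl
      have he := h.eq_simple_of_refl_nonpos (h.apply_norm _ k) h0 hl
      refine ⟨t, by simp, ?_⟩
      rw [hw, ← he, ← conj_refl]
      simp only [mul_assoc, inv_mul_cancel_left, refl_mul_self, mul_one]

/-- Induction on the length, looking at the last letter `k`. If the remaining word keeps `α k`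
positive, then `⟪x, α k⟫` is both nonnegative and nonpositive, so `s_k` fixes `x` and can be
dropped. Otherwise deletion yields a shorter word for the same element. -/
theorem chamber_word (h : SimpleSystem W α) (m : ℕ) :
    ∀ l : List ι, l.length ≤ m → ∀ x y, Chamber α x → Chamber α y → word α l x = y →
      x = y ∧ word α l ∈ Subgroup.closure {g | ∃ i, ⟪x, α i⟫ = 0 ∧ g = refl (α i)} := by
  induction m with
  | zero =>
    intro l hl x y hx hy hxy
    obtain rfl : l = [] := by simpa using hl
    exact ⟨hxy, Subgroup.one_mem _⟩
  | succ m ih =>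
    intro l hl x y hx hy hxy
    rcases List.eq_nil_or_concat' l with rfl | ⟨l', k, rfl⟩
    · exact ⟨hxy, Subgroup.one_mem _⟩
    have hlen : l'.length ≤ m := by simpa using hl
    have hw : word α (l' ++ [k]) = word α l' * refl (α k) := by simp [word]
    rw [hw] at hxy ⊢
    rcases h.dichotomy _ (h.word_mem l') k with hp | hn
    · have hk : ⟪x, α k⟫ = 0 := by
        refine le_antisymm ?_ (hx k)
        have h1 : ⟪x, α k⟫ = - ⟪y, word α l' (α k)⟫ := by
          rw [← inner_map (word α l' * refl (α k)), hxy, mul_apply, refl_apply_self, map_neg,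
            inner_neg_right]
        rw [h1, neg_nonpos, inner_eq_sum α]
        exact Finset.sum_nonneg fun j _ => mul_nonneg (hp j) (hy j)
      have hs : refl (α k) x = x := refl_apply_eq_self_iff.mpr (by rw [real_inner_comm]; exact hk)
      rw [mul_apply, hs] at hxy
      obtain ⟨h1, h2⟩ := ih l' hlen x y hx hy hxy
      exact ⟨h1, Subgroup.mul_mem _ h2 (Subgroup.subset_closure ⟨k, hk, rfl⟩)⟩
    · obtain ⟨l'', hl'', he⟩ := h.deletion k l' hn
      rw [← he] at hxy ⊢
      exact ih l'' (by omega) x y hx hy hxy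

/-- The closed chamber is a fundamental domain, with stabilizers generated by simple
reflections. -/
theorem chamber_eq (h : SimpleSystem W α) {w : OrthGroup n} (hw : w ∈ W) {x : Euc n}
    (hx : Chamber α x) (hy : Chamber α (w x)) :
    w x = x ∧ w ∈ Subgroup.closure {g | ∃ i, ⟪x, α i⟫ = 0 ∧ g = refl (α i)} := by
  obtain ⟨l, rfl⟩ := h.exists_word hw
  obtain ⟨h1, h2⟩ := h.chamber_word _ l le_rfl x _ hx hy rfl
  exact ⟨h1.symm, h2⟩

theorem exists_chamber [Finite W] (h : SimpleSystem W α) (x : Euc n) :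
    ∃ w ∈ W, Chamber α (w x) := by
  obtain ⟨ρ, hρ⟩ := exists_dual α fun _ => 1
  -- The simple reflection in `α i` changes the height `⟪w x, ρ⟫` by `-2 * ⟪w x, α i⟫`, which cannot
  -- be positive at a maximum.
  obtain ⟨w, hw⟩ := Finite.exists_max fun w : W => ⟪(w : OrthGroup n) x, ρ⟫
  refine ⟨w, w.2, fun i => ?_⟩
  have := hw ⟨refl (α i) * w, W.mul_mem (h.refl_mem i) w.2⟩
  simp only [mul_apply] at this
  rw [refl_apply_of_norm (h.norm i), inner_sub_left, inner_smul_left, real_inner_comm ρ (α i),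
    hρ i, real_inner_comm _ (α i)] at this
  simp only [conj_trivial] at this
  linarith

theorem finite_roots [Finite W] (α : Module.Basis ι ℝ (Euc n)) :
    {v : Euc n | ∃ w ∈ W, ∃ i, v = w (α i)}.Finite := by
  apply (Set.finite_range fun p : W × ι => (p.1 : OrthGroup n) (α p.2)).subset
  rintro v ⟨w, hw, i, rfl⟩
  exact ⟨(⟨w, hw⟩, i), rfl⟩

/-- Move a generic fixed vector of `g` into the chamber. Its stabilizer contains a nontrivial
conjugate of `g`, so some simple root is orthogonal to it; by genericity the corresponding root is
orthogonal to the whole fixed space. -/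
theorem exists_root_orthogonal_fixed [Finite W] (h : SimpleSystem W α) {g : OrthGroup n}
    (hg : g ∈ W) (hg1 : g ≠ 1) : ∃ w ∈ W, ∃ i, ∀ x, g x = x → ⟪x, w (α i)⟫ = 0 := by
  obtain ⟨u, hu, hgen⟩ := exists_generic (fixedSpace g) (finite_roots (W := W) α)
  obtain ⟨w, hw, hc⟩ := h.exists_chamber u
  have hfix : (w * g * w⁻¹) (w u) = w u := by
    simp only [mul_apply, inv_apply_self]; rw [mem_fixedSpace.mp hu]
  have hm : w * g * w⁻¹ ∈ W := W.mul_mem (W.mul_mem hw hg) (W.inv_mem hw)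
  have h2 := (h.chamber_eq hm hc (by rwa [hfix])).2
  have hex : ∃ i, ⟪w u, α i⟫ = 0 := by
    by_contra hne
    push Not at hne
    have : {g | ∃ i, ⟪w u, α i⟫ = 0 ∧ g = refl (α i)} = ∅ := by
      ext g; simp [hne]
    rw [this, Subgroup.closure_empty, Subgroup.mem_bot] at h2
    apply hg1
    have := conj_eq_one_iff.mp h2
    exact this
  obtain ⟨i, hi⟩ := hex
  refine ⟨w⁻¹, W.inv_mem hw, i, fun x hx => ?_⟩
  refine hgen _ ⟨w⁻¹, W.inv_mem hw, i, rfl⟩ ?_ x hx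
  rw [inner_inv_right, hi]

theorem exists_eq_or_eq_neg [Finite W] (h : SimpleSystem W α) {v : Euc n} (hv : ‖v‖ = 1)
    (hm : refl v ∈ W) : ∃ w ∈ W, ∃ i, v = w (α i) ∨ v = -w (α i) := by
  obtain ⟨w, hw, i, H⟩ := h.exists_root_orthogonal_fixed hm (refl_ne_one (ne_zero_of_norm hv))
  refine ⟨w, hw, i, ?_⟩
  have := eq_or_eq_neg_of_orthogonal (h.apply_norm w i) hv fun x hx =>
    H x (refl_apply_eq_self_iff.mpr (by rwa [real_inner_comm]))
  rcases this with h1 | h1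
  · left; exact h1.symm
  · right; rw [h1, neg_neg]

theorem root_dichotomy [Finite W] (h : SimpleSystem W α) {v : Euc n} (hv : ‖v‖ = 1)
    (hm : refl v ∈ W) : (∀ j, 0 ≤ α.repr v j) ∨ (∀ j, α.repr v j ≤ 0) := by
  obtain ⟨w, hw, i, rfl | rfl⟩ := h.exists_eq_or_eq_neg hv hm
  · exact h.dichotomy w hw i
  · simp only [map_neg, Finsupp.neg_apply, neg_nonneg, neg_nonpos]
    exact (h.dichotomy w hw i).symm

/-- In the basis `α` both `a` and its inverse have nonnegative matrices: each column has constant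
sign since images of roots are roots, and the chamber points `x` and `a x` decide the sign. Such a
matrix is monomial, and unit lengths make it a permutation matrix. -/
theorem exists_perm [Finite W] (h : SimpleSystem W α) {a : OrthGroup n}
    (ha : ∀ g, g ∈ W ↔ a * g * a⁻¹ ∈ W) {x : Euc n} (hx : ∀ i, 0 < ⟪x, α i⟫)
    (hc : Chamber α (a x)) : ∃ σ : Equiv.Perm ι, ∀ i, a (α i) = α (σ i) := by
  have hpos (i : ι) : ∀ j, 0 ≤ α.repr (a (α i)) j := by
    have hm : refl (a (α i)) ∈ W := by
      rw [← conj_refl]; exact (ha _).mp (h.refl_mem i)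
    refine (h.root_dichotomy (h.apply_norm a i) hm).resolve_right fun hneg => ?_
    have h1 := hx i
    rw [← inner_map a, inner_eq_sum α] at h1
    exact absurd h1 (not_lt.mpr (Finset.sum_nonpos fun j _ =>
      mul_nonpos_of_nonpos_of_nonneg (hneg j) (hc j)))
  have hpos' (i : ι) : ∀ j, 0 ≤ α.repr (a⁻¹ (α i)) j := by
    have hm : refl (a⁻¹ (α i)) ∈ W := by
      rw [← conj_refl, ha]
      simpa [mul_assoc] using h.refl_mem i
    refine (h.root_dichotomy (h.apply_norm a⁻¹ i) hm).resolve_right fun hneg => ?_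
    have h1 := hc i
    rw [← inner_inv_right, inner_eq_sum α] at h1
    have h2 (j : ι) : α.repr (a⁻¹ (α i)) j * ⟪x, α j⟫ ≤ 0 :=
      mul_nonpos_of_nonpos_of_nonneg (hneg j) (hx j).le
    have h3 : ∑ j, α.repr (a⁻¹ (α i)) j * ⟪x, α j⟫ = 0 :=
      le_antisymm (Finset.sum_nonpos fun j _ => h2 j) h1
    have h4 := (Finset.sum_eq_zero_iff_of_nonpos fun j _ => h2 j).mp h3
    apply ne_zero_of_norm (h.apply_norm a⁻¹ i)
    rw [← α.repr.map_eq_zero_iff]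
    ext j
    exact (mul_eq_zero.mp (h4 j (Finset.mem_univ j))).resolve_right (hx j).ne'
  have hex (i : ι) : ∃ j, a (α i) = α j := by
    have hne : ∃ j, α.repr (a (α i)) j ≠ 0 := by
      by_contra hz
      push Not at hz
      apply ne_zero_of_norm (h.apply_norm a i)
      rw [← α.repr.map_eq_zero_iff]
      ext j; exact hz j
    obtain ⟨j, hj⟩ := hne
    refine ⟨j, ?_⟩
    have hsum : α i = ∑ j, α.repr (a (α i)) j • a⁻¹ (α j) := by
      conv_lhs => rw [← inv_apply_self a (α i), ← α.sum_repr (a (α i)), map_sum]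
      simp only [map_smul]
    have hz (k : ι) (hk : k ≠ i) : α.repr (a⁻¹ (α j)) k = 0 := by
      have h1 := congrArg (fun v => α.repr v k) hsum
      simp only [map_sum, map_smul, α.repr_self, Finsupp.single_eq_of_ne hk, Finsupp.finsetSum_apply,
        Finsupp.smul_apply, smul_eq_mul] at h1
      have h2 := (Finset.sum_eq_zero_iff_of_nonneg fun j _ =>
        mul_nonneg (hpos i j) (hpos' j k)).mp h1.symm
      exact (mul_eq_zero.mp (h2 j (Finset.mem_univ j))).resolve_left hj
    have hv : a⁻¹ (α j) = α.repr (a⁻¹ (α j)) i • α i := by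
      apply α.repr.injective
      ext k
      rw [map_smul, α.repr_self, Finsupp.smul_apply]
      by_cases hk : k = i
      · subst hk; simp
      · rw [hz k hk, Finsupp.single_eq_of_ne hk]; simp
    rcases eq_or_eq_neg_of_smul (h.norm i) (h.apply_norm a⁻¹ j) hv with h2 | h2
    · exact (inv_apply_eq.mp h2).symm
    · have := hpos' j i
      rw [h2, map_neg, α.repr_self, Finsupp.neg_apply, Finsupp.single_eq_same] at this
      linarith
  choose f hf using hex
  have hinj : Function.Injective f := by
    intro i j hij
    have : a (α i) = a (α j) := by rw [hf, hf, hij]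
    exact α.injective (a.injective this)
  exact ⟨Equiv.ofBijective f (Finite.injective_iff_bijective.mp hinj), hf⟩

theorem chamber_perm {a : OrthGroup n} {σ : Equiv.Perm ι}
    (hσ : ∀ i, a (α i) = α (σ i)) {x : Euc n} (hx : Chamber α x) : Chamber α (a x) := by
  intro i
  have : α i = a (α (σ.symm i)) := by rw [hσ, Equiv.apply_symm_apply]
  rw [this, inner_map]
  exact hx _

/-- An interior chamber point is sent into the chamber, and no simple reflection is available to
generate its stabilizer. -/
theorem eq_one_of_perm (h : SimpleSystem W α) {w : OrthGroup n} (hw : w ∈ W) {σ : Equiv.Perm ι}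
    (hσ : ∀ i, w (α i) = α (σ i)) : w = 1 := by
  obtain ⟨ρ, hρ⟩ := exists_dual α fun _ => 1
  have hc : Chamber α ρ := fun i => by rw [hρ]; norm_num
  have h2 := (h.chamber_eq hw hc (chamber_perm hσ hc)).2
  simpa [hρ] using h2

theorem normalizes_of_perm (h : SimpleSystem W α) {a : OrthGroup n} {σ : Equiv.Perm ι}
    (hσ : ∀ i, a (α i) = α (σ i)) (g : OrthGroup n) : g ∈ W ↔ a * g * a⁻¹ ∈ W := by
  have key (b : OrthGroup n) (τ : Equiv.Perm ι) (hb : ∀ i, b (α i) = α (τ i)) (g : OrthGroup n)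
      (hg : g ∈ W) : b * g * b⁻¹ ∈ W := by
    have hg' : g ∈ W.comap (MulAut.conj b).toMonoidHom := by
      have : W ≤ W.comap (MulAut.conj b).toMonoidHom := by
        conv_lhs => rw [h.eq_closure]
        rw [Subgroup.closure_le]
        rintro _ ⟨i, rfl⟩
        change b * refl (α i) * b⁻¹ ∈ W
        rw [conj_refl, hb]
        exact h.refl_mem _
      exact this hg
    exact hg'
  refine ⟨key a σ hσ g, fun hg => ?_⟩
  have := key a⁻¹ σ.symm (fun i => inv_apply_eq.mpr (by rw [hσ, Equiv.apply_symm_apply])) _ hg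
  simpa [mul_assoc] using this

/-- An element of the normalizer is the product of an element of `W` and a diagram automorphism
whose fixed space is at least as large. -/
theorem exists_decomposition [Finite W] (h : SimpleSystem W α) {b : OrthGroup n}
    (hb : ∀ g, g ∈ W ↔ b * g * b⁻¹ ∈ W) :
    ∃ w ∈ W, ∃ (a : OrthGroup n) (σ : Equiv.Perm ι), (∀ i, a (α i) = α (σ i)) ∧ b = w * a ∧
      Module.finrank ℝ (fixedSpace b) ≤ Module.finrank ℝ (fixedSpace a) := by
  obtain ⟨u, hu, hgen⟩ := exists_generic (fixedSpace b) (finite_roots (W := W) α)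
  obtain ⟨w, hw, hc⟩ := h.exists_chamber u
  obtain ⟨ρ, hρ⟩ := exists_dual α fun _ => 1
  -- `w₁` carries the image of the chamber under `w * b * w⁻¹` back to the chamber, so the product
  -- `a` permutes the simple roots.
  obtain ⟨w₁, hw₁, hc₁⟩ := h.exists_chamber ((w * b * w⁻¹) ρ)
  have hconj {w : OrthGroup n} (hw : w ∈ W) (g : OrthGroup n) : g ∈ W ↔ w * g * w⁻¹ ∈ W := by
    refine ⟨fun hg => W.mul_mem (W.mul_mem hw hg) (W.inv_mem hw), fun hg => ?_⟩
    have := W.mul_mem (W.mul_mem (W.inv_mem hw) hg) hw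
    simpa [mul_assoc] using this
  obtain ⟨σ, hσ⟩ := h.exists_perm (a := w₁ * (w * b * w⁻¹)) (x := ρ) (fun g => by
      rw [hconj (W.inv_mem hw) g, hb, hconj hw, hconj hw₁]
      simp only [mul_inv_rev, inv_inv, mul_assoc]) (fun i => by rw [hρ]; norm_num) hc₁
  set a := w₁ * (w * b * w⁻¹) with ha
  have hau : a (w u) = w₁ (w u) := by
    simp only [ha, mul_apply, inv_apply_self]; rw [mem_fixedSpace.mp hu]
  have h2 := (h.chamber_eq hw₁ hc (by rw [← hau]; exact chamber_perm hσ hc)).2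
  -- `w₁` is a product of simple reflections fixing `w u`. As `u` is generic in the fixed space of
  -- `b`, these fix the whole image of that space under `w`, and hence `a` fixes this image too.
  have hfix (x : Euc n) (hx : b x = x) : w₁ (w x) = w x := by
    refine apply_eq_self_of_mem_closure ?_ h2
    rintro _ ⟨i, hi, rfl⟩
    rw [refl_apply_eq_self_iff, real_inner_comm, ← inner_inv_right]
    exact hgen _ ⟨w⁻¹, W.inv_mem hw, i, rfl⟩ (by rw [inner_inv_right, hi]) x hx
  refine ⟨w⁻¹ * w₁⁻¹ * (a * w * a⁻¹), ?_, a, σ, hσ, ?_, ?_⟩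
  · exact W.mul_mem (W.mul_mem (W.inv_mem hw) (W.inv_mem hw₁))
      ((h.normalizes_of_perm hσ w).mp hw)
  · rw [ha]; group
  · rw [← LinearEquiv.finrank_map_eq w.toLinearEquiv (fixedSpace b)]
    apply Submodule.finrank_mono
    rintro _ ⟨x, hx, rfl⟩
    change a (w x) = w x
    simp only [ha, mul_apply, inv_apply_self]
    rw [mem_fixedSpace.mp hx, hfix x hx]

end SimpleSystem
end ReflectionGroup

/-! ### Existence of simple systems. -/

namespace ReflectionGroup
variable {n : ℕ}

/-- The unit normals of the reflecting hyperplanes of `W`. -/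
def roots (W : Subgroup (OrthGroup n)) : Set (Euc n) := {v | ‖v‖ = 1 ∧ refl v ∈ W}

theorem finite_roots (W : Subgroup (OrthGroup n)) [Finite W] : (roots W).Finite := by
  have hW : (W : Set (OrthGroup n)).Finite := Set.toFinite _
  refine Set.Finite.of_finite_fibers refl (hW.subset ?_) ?_
  · rintro _ ⟨v, hv, rfl⟩; exact hv.2
  · rintro _ ⟨v, hv, rfl⟩
    apply (Set.toFinite {v, -v}).subset
    rintro w ⟨hw, hwv⟩
    exact eq_or_eq_neg_of_refl_eq hv.1 hw.1 (Set.mem_singleton_iff.mp hwv).symm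

theorem neg_mem_roots {W : Subgroup (OrthGroup n)} {v : Euc n} (hv : v ∈ roots W) :
    -v ∈ roots W := ⟨by rw [norm_neg]; exact hv.1, by rw [refl_neg]; exact hv.2⟩

theorem apply_mem_roots {W : Subgroup (OrthGroup n)} {v : Euc n} (hv : v ∈ roots W)
    {w : OrthGroup n} (hw : w ∈ W) : w v ∈ roots W :=
  ⟨by rw [w.norm_map]; exact hv.1, by
    rw [← conj_refl]; exact W.mul_mem (W.mul_mem hw hv.2) (W.inv_mem hw)⟩

theorem eq_closure_roots {W : Subgroup (OrthGroup n)} (hW : IsReflectionGroup W) :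
    W = Subgroup.closure (refl '' roots W) := by
  apply le_antisymm
  · obtain ⟨-, S, hS, hWS⟩ := hW
    conv_lhs => rw [hWS]
    rw [Subgroup.closure_le]
    intro s hs
    obtain ⟨v, hv, rfl⟩ := isReflection_iff.mp (hS s hs)
    refine Subgroup.subset_closure ⟨v, ⟨hv, ?_⟩, rfl⟩
    rw [hWS]; exact Subgroup.subset_closure hs
  · rw [Subgroup.closure_le]
    rintro _ ⟨v, hv, rfl⟩
    exact hv.2

/-- Vectors in an open half space with pairwise obtuse angles are linearly independent. -/
theorem linearIndependent_of_obtuse {ι : Type*} [Fintype ι] {v : ι → Euc n} {x : Euc n}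
    (hx : ∀ i, 0 < ⟪x, v i⟫) (hv : ∀ i j, i ≠ j → ⟪v i, v j⟫ ≤ 0) : LinearIndependent ℝ v := by
  rw [Fintype.linearIndependent_iff]
  intro g hg
  have hsplit : ∑ i, (g i)⁺ • v i = ∑ i, (g i)⁻ • v i := by
    rw [← sub_eq_zero, ← Finset.sum_sub_distrib, ← hg]
    refine Finset.sum_congr rfl fun i _ => ?_
    rw [← sub_smul, posPart_sub_negPart]
  -- The two sums have disjoint supports, so only obtuse pairs contribute. Being equal, both sums
  -- have nonpositive square norm and vanish; pairing with `x` then kills the coefficients.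
  have hle : ⟪∑ i, (g i)⁺ • v i, ∑ i, (g i)⁻ • v i⟫ ≤ 0 := by
    rw [sum_inner]
    refine Finset.sum_nonpos fun i _ => ?_
    rw [inner_sum]
    refine Finset.sum_nonpos fun j _ => ?_
    rw [inner_smul_left, inner_smul_right, ← mul_assoc]
    simp only [conj_trivial]
    by_cases hij : i = j
    · subst hij
      rcases le_total 0 (g i) with h | h
      · rw [negPart_of_nonneg h, mul_zero, zero_mul]
      · rw [posPart_of_nonpos h, zero_mul, zero_mul]
    · exact mul_nonpos_of_nonneg_of_nonpos (mul_nonneg (posPart_nonneg _) (negPart_nonneg _))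
        (hv i j hij)
  have key (c : ι → ℝ) (hc : ∀ i, 0 ≤ c i) (h0 : ∑ i, c i • v i = 0) (i : ι) : c i = 0 := by
    have h1 : ∑ i, c i * ⟪x, v i⟫ = 0 := by
      rw [← inner_zero_right (𝕜 := ℝ) x, ← h0, inner_sum]
      simp only [inner_smul_right]
    have h2 := (Finset.sum_eq_zero_iff_of_nonneg fun i _ => mul_nonneg (hc i) (hx i).le).mp h1 i
      (Finset.mem_univ i)
    exact (mul_eq_zero.mp h2).resolve_right (hx i).ne'
  have h0 : ∑ i, (g i)⁺ • v i = 0 := by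
    rw [← hsplit] at hle
    exact real_inner_self_nonpos.mp hle
  intro i
  rw [← posPart_sub_negPart (g i), key _ (fun i => posPart_nonneg _) h0 i,
    key _ (fun i => negPart_nonneg _) (hsplit ▸ h0) i, sub_zero]

open NNReal in
theorem inner_nonneg_of_mem_span {S : Set (Euc n)} {x : Euc n} (hS : ∀ s ∈ S, 0 < ⟪x, s⟫)
    {u : Euc n} (hu : u ∈ Submodule.span ℝ≥0 S) : 0 ≤ ⟪x, u⟫ := by
  induction hu using Submodule.span_induction with
  | mem s hs => exact (hS s hs).le
  | zero => rw [inner_zero_right]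
  | add u v _ _ hu hv => rw [inner_add_right]; exact add_nonneg hu hv
  | smul c u _ hu =>
    rw [NNReal.smul_def, inner_smul_right]; exact mul_nonneg c.2 hu

open NNReal in
/-- A minimal generating set of the cone spanned by the roots in an open half space. -/
theorem exists_minimal_cone_generators {P : Set (Euc n)} (hP : P.Finite) :
    ∃ D ⊆ P, P ⊆ Submodule.span ℝ≥0 D ∧
      ∀ b ∈ D, b ∉ Submodule.span ℝ≥0 (D \ {b}) := by
  have hfin : {D : Set (Euc n) | D ⊆ P ∧ P ⊆ Submodule.span ℝ≥0 D}.Finite :=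
    hP.finite_subsets.subset fun D hD => hD.1
  obtain ⟨D, hD, hmin⟩ := hfin.exists_minimal ⟨P, subset_rfl, Submodule.subset_span⟩
  refine ⟨D, hD.1, hD.2, fun b hb hmem => ?_⟩
  have hspan : Submodule.span ℝ≥0 (D \ {b}) = Submodule.span ℝ≥0 D := by
    rw [← Submodule.span_insert_eq_span hmem, Set.insert_sdiff_singleton, Set.insert_eq_of_mem hb]
  have := hmin (y := D \ {b}) ⟨Set.sdiff_subset.trans hD.1, by rw [hspan]; exact hD.2⟩
    Set.sdiff_subset hb
  exact this.2 rfl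

open NNReal in
theorem not_smul_mem_span {D : Set (Euc n)} {x : Euc n} (hx : ∀ s ∈ D, 0 < ⟪x, s⟫)
    {b : Euc n} (hb : b ∈ D) (hmin : b ∉ Submodule.span ℝ≥0 (D \ {b})) {t : ℝ}
    (ht : t • b ∈ Submodule.span ℝ≥0 (D \ {b})) (hpos : 0 < ⟪x, t • b⟫) : False := by
  rw [inner_smul_right] at hpos
  have ht0 : 0 < t := pos_of_mul_pos_left hpos (hx b hb).le
  apply hmin
  have h1 : t⁻¹ • t • b ∈ Submodule.span ℝ≥0 (D \ {b}) :=
    Submodule.smul_mem _ (⟨t⁻¹, (inv_pos.mpr ht0).le⟩ : ℝ≥0) ht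
  rwa [smul_smul, inv_mul_cancel₀ ht0.ne', one_smul] at h1

-- If `⟪a, b⟫` were positive, `b - 2 * ⟪a, b⟫ • a` or its negative would be a positive root, hence a
-- nonnegative combination of `D`. Collecting the terms in `b`, respectively `a`, expresses a
-- positive multiple of that vector by the other generators, against minimality.
open NNReal in
theorem obtuse_of_minimal {W : Subgroup (OrthGroup n)} {x : Euc n} (hx : ∀ s ∈ roots W, ⟪x, s⟫ ≠ 0)
    {D : Set (Euc n)} (hD : D ⊆ {s ∈ roots W | 0 < ⟪x, s⟫})
    (hspan : {s ∈ roots W | 0 < ⟪x, s⟫} ⊆ Submodule.span ℝ≥0 D)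
    (hmin : ∀ b ∈ D, b ∉ Submodule.span ℝ≥0 (D \ {b})) {a b : Euc n} (ha : a ∈ D) (hb : b ∈ D)
    (hab : a ≠ b) : ⟪a, b⟫ ≤ 0 := by
  by_contra! hpos
  have hDx : ∀ s ∈ D, 0 < ⟪x, s⟫ := fun s hs => (hD hs).2
  have hDx' (c : Euc n) : ∀ s ∈ D \ {c}, 0 < ⟪x, s⟫ := fun s hs => hDx s hs.1
  have hins (c : Euc n) (hc : c ∈ D) : D = insert c (D \ {c}) := by
    rw [Set.insert_sdiff_singleton, Set.insert_eq_of_mem hc]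
  have hr : refl a b ∈ roots W := apply_mem_roots (hD hb).1 (hD ha).1.2
  have he : refl a b = b - (2 * ⟪a, b⟫) • a := refl_apply_of_norm (hD ha).1.1 b
  rcases lt_or_gt_of_ne (hx _ hr) with hneg | hp
  · have hm : -refl a b ∈ Submodule.span ℝ≥0 D :=
      hspan ⟨neg_mem_roots hr, by rw [inner_neg_right]; linarith⟩
    rw [hins a ha, Submodule.mem_span_insert] at hm
    obtain ⟨c, z, hz, hcz⟩ := hm
    have hz0 := inner_nonneg_of_mem_span (hDx' a) hz
    rw [NNReal.smul_def] at hcz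
    have hsum : (2 * ⟪a, b⟫ - c) • a = b + z := by
      have : z = -refl a b - (c : ℝ) • a := by rw [hcz]; abel
      rw [this, he]; module
    refine not_smul_mem_span hDx ha (hmin a ha) (t := 2 * ⟪a, b⟫ - c) ?_ ?_
    · rw [hsum]
      exact Submodule.add_mem _ (Submodule.subset_span ⟨hb, hab.symm⟩) hz
    · rw [hsum, inner_add_right]
      have := hDx b hb
      linarith
  · have hm : refl a b ∈ Submodule.span ℝ≥0 D := hspan ⟨hr, hp⟩
    rw [hins b hb, Submodule.mem_span_insert] at hm
    obtain ⟨c, z, hz, hcz⟩ := hm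
    have hz0 := inner_nonneg_of_mem_span (hDx' b) hz
    rw [NNReal.smul_def] at hcz
    have hsum : (1 - c : ℝ) • b = (2 * ⟪a, b⟫) • a + z := by
      have : z = refl a b - (c : ℝ) • b := by rw [hcz]; abel
      rw [this, he]; module
    refine not_smul_mem_span hDx hb (hmin b hb) (t := 1 - c) ?_ ?_
    · rw [hsum]
      refine Submodule.add_mem _ ?_ hz
      exact Submodule.smul_mem _ (⟨2 * ⟪a, b⟫, by linarith⟩ : ℝ≥0)
        (Submodule.subset_span ⟨ha, hab⟩)
    · rw [hsum, inner_add_right, inner_smul_right]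
      have := mul_pos (show 0 < 2 * ⟪a, b⟫ by linarith) (hDx a ha)
      linarith

/-- The angle between two simple roots is `π - π / m`. -/
theorem exists_angle {ι : Type*} [Fintype ι] {W : Subgroup (OrthGroup n)}
    {α : Module.Basis ι ℝ (Euc n)} (hr : ∀ i, α i ∈ roots W)
    (hd : ∀ v ∈ roots W, (∀ j, 0 ≤ α.repr v j) ∨ (∀ j, α.repr v j ≤ 0))
    {i j : ι} (hij : i ≠ j) (hob : ⟪α i, α j⟫ ≤ 0) :
    ∃ m : ℕ, 2 ≤ m ∧ ⟪α i, α j⟫ = -Real.cos (Real.pi / m) := by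
  have hn (i : ι) : ⟪α i, α i⟫ = 1 := inner_self_of_norm (hr i).1
  have hlow : -1 < ⟪α i, α j⟫ := by
    have h1 : α i + α j ≠ 0 := by
      intro h0
      have := congrArg (fun v => α.repr v i) h0
      simp [Finsupp.single_eq_of_ne hij] at this
    have h2 : 0 < ⟪α i + α j, α i + α j⟫ := real_inner_self_pos.mpr h1
    rw [inner_add_left, inner_add_right, inner_add_right, hn, hn, real_inner_comm (α i) (α j)] at h2
    linarith
  set θ := Real.arccos (-⟪α i, α j⟫) with hθ
  have hcos : Real.cos θ = -⟪α i, α j⟫ := Real.cos_arccos (by linarith) (by linarith)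
  have hθ0 : 0 < θ := Real.arccos_pos.mpr (by linarith)
  have hθ1 : θ ≤ Real.pi / 2 := Real.arccos_le_pi_div_two.mpr (by linarith)
  have hπ := Real.pi_pos
  have hsin : 0 < Real.sin θ := Real.sin_pos_of_pos_of_lt_pi hθ0 (by linarith)
  -- Reflecting alternately in two vectors at angle `π - θ` produces these roots, with coefficients
  -- Chebyshev polynomials in `cos θ`.
  let V (k : ℕ) (a b : Euc n) : Euc n :=
    (Real.sin ((k + 1) * θ) / Real.sin θ) • a + (Real.sin (k * θ) / Real.sin θ) • b
  have hstep (k : ℕ) (a b : Euc n) (hb : ‖b‖ = 1) (hab : ⟪b, a⟫ = -Real.cos θ) :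
      refl b (V k a b) = V (k + 1) b a := by
    have hs : Real.sin ((k + 1 + 1) * θ) =
        2 * Real.cos θ * Real.sin ((k + 1) * θ) - Real.sin (k * θ) := by
      have e1 : ((k : ℝ) + 1 + 1) * θ = (k + 1) * θ + θ := by ring
      have e2 : (k : ℝ) * θ = (k + 1) * θ - θ := by ring
      rw [e1, e2, Real.sin_add, Real.sin_sub]; ring
    rw [refl_apply_of_norm hb]
    simp only [V, inner_add_right, inner_smul_right, hab, inner_self_of_norm hb]
    push_cast
    rw [hs]
    have : Real.sin θ ≠ 0 := hsin.ne'
    match_scalars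
    · field_simp
    · field_simp; ring
  have hV (k : ℕ) : V k (α i) (α j) ∈ roots W ∧ V k (α j) (α i) ∈ roots W := by
    induction k with
    | zero => simpa [V, div_self hsin.ne'] using ⟨hr i, hr j⟩
    | succ k ih =>
      rw [← hstep k (α j) (α i) (hr i).1 (by rw [hcos, neg_neg]),
        ← hstep k (α i) (α j) (hr j).1 (by rw [hcos, neg_neg, real_inner_comm])]
      exact ⟨apply_mem_roots ih.2 (hr i).2, apply_mem_roots ih.1 (hr j).2⟩
  have hsign (k : ℕ) : 0 ≤ Real.sin ((k + 1) * θ) * Real.sin (k * θ) := by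
    have ci : α.repr (V k (α i) (α j)) i = Real.sin ((k + 1) * θ) / Real.sin θ := by
      simp [V, Finsupp.single_eq_of_ne hij]
    have cj : α.repr (V k (α i) (α j)) j = Real.sin (k * θ) / Real.sin θ := by
      simp [V, Finsupp.single_eq_of_ne hij.symm]
    have : 0 ≤ Real.sin ((k + 1) * θ) / Real.sin θ * (Real.sin (k * θ) / Real.sin θ) := by
      rw [← ci, ← cj]
      rcases hd _ (hV k).1 with h | h
      · exact mul_nonneg (h i) (h j)
      · exact mul_nonneg_of_nonpos_of_nonpos (h i) (h j)
    rw [div_mul_div_comm] at this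
    have h2 := mul_nonneg this (mul_pos hsin hsin).le
    rwa [div_mul_cancel₀ _ (mul_pos hsin hsin).ne'] at h2
  -- `m + 1` is the first multiple of `θ` reaching `π`. Were `π` overshot, the sines at `m * θ` and
  -- `(m + 1) * θ` would have opposite signs and give a root with coordinates of both signs.
  obtain ⟨m, hm⟩ : ∃ m : ℕ, ⌈Real.pi / θ⌉₊ = m + 1 :=
    ⟨_, (Nat.succ_pred_eq_of_pos (Nat.ceil_pos.mpr (div_pos hπ hθ0))).symm⟩
  have h1 : Real.pi ≤ (m + 1) * θ := by
    have := Nat.le_ceil (Real.pi / θ)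
    rw [hm, div_le_iff₀ hθ0] at this
    exact_mod_cast this
  have h2 : m * θ < Real.pi := by
    have := Nat.ceil_lt_add_one (div_pos hπ hθ0).le
    rw [hm] at this
    push_cast at this
    rw [add_lt_add_iff_right, lt_div_iff₀ hθ0] at this
    exact this
  have hm1 : 1 ≤ m := by
    rcases Nat.eq_zero_or_pos m with rfl | h
    · norm_num at h1; linarith
    · exact h
  have hm1' : (1 : ℝ) ≤ m := by exact_mod_cast hm1
  have hspos : 0 < Real.sin (m * θ) :=
    Real.sin_pos_of_pos_of_lt_pi (by positivity) h2
  have hs0 : 0 ≤ Real.sin ((m + 1) * θ) := nonneg_of_mul_nonneg_left (hsign m) hspos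
  have heq : (m + 1) * θ = Real.pi := by
    by_contra hne
    have hlt : 0 < (m + 1) * θ - Real.pi := sub_pos.mpr (lt_of_le_of_ne h1 (Ne.symm hne))
    have : 0 < Real.sin ((m + 1) * θ - Real.pi) :=
      Real.sin_pos_of_pos_of_lt_pi hlt (by nlinarith)
    rw [Real.sin_sub_pi] at this
    linarith
  refine ⟨m + 1, by omega, ?_⟩
  have : Real.pi / ((m + 1 : ℕ) : ℝ) = θ := by
    rw [← heq]; push_cast; field_simp
  rw [this, hcos, neg_neg]

open NNReal in
/-- An essential finite reflection group has a simple system, which realizes a Coxeter matrix. -/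
theorem exists_simpleSystem {W : Subgroup (OrthGroup n)} (hW : IsReflectionGroup W)
    (hspan : Submodule.span ℝ (roots W) = ⊤) :
    ∃ (ι : Type) (_ : Fintype ι) (α : Module.Basis ι ℝ (Euc n)), SimpleSystem W α ∧
      ∀ i j, i ≠ j → ∃ m : ℕ, 2 ≤ m ∧ ⟪α i, α j⟫ = -Real.cos (Real.pi / m) := by
  have := hW.1
  -- `x` lies on no reflecting hyperplane, and so separates positive from negative roots.
  obtain ⟨x, -, hgen⟩ := exists_generic ⊤ (finite_roots W)
  have hx : ∀ s ∈ roots W, ⟪x, s⟫ ≠ 0 := by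
    intro s hs h0
    have := hgen s hs h0 s trivial
    rw [inner_self_eq_zero] at this
    exact ne_zero_of_norm hs.1 this
  obtain ⟨D, hD, hDspan, hmin⟩ := exists_minimal_cone_generators
    (P := {s ∈ roots W | 0 < ⟪x, s⟫}) ((finite_roots W).subset fun s hs => hs.1)
  have hDfin : D.Finite := (finite_roots W).subset fun s hs => (hD hs).1
  have : Fintype D := hDfin.fintype
  have hob (i j : D) (hij : i ≠ j) : ⟪(i : Euc n), j⟫ ≤ 0 :=
    obtuse_of_minimal hx hD hDspan hmin i.2 j.2 fun h => hij (Subtype.ext h)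
  have hli : LinearIndependent ℝ (fun i : D => (i : Euc n)) :=
    linearIndependent_of_obtuse (fun i => (hD i.2).2) hob
  have hcone : (Submodule.span ℝ≥0 D : Set (Euc n)) ⊆ Submodule.span ℝ D := by
    intro u hu
    induction hu using Submodule.span_induction with
    | mem s hs => exact Submodule.subset_span hs
    | zero => exact Submodule.zero_mem _
    | add u v _ _ hu hv => exact Submodule.add_mem _ hu hv
    | smul c u _ hu => exact Submodule.smul_mem _ (c : ℝ) hu
  have htop : ⊤ ≤ Submodule.span ℝ (Set.range fun i : D => (i : Euc n)) := by
    rw [← hspan, Submodule.span_le, Subtype.range_coe]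
    intro s hs
    rcases lt_or_gt_of_ne (hx s hs) with h | h
    · rw [← neg_neg s]
      exact Submodule.neg_mem _ (hcone (hDspan ⟨neg_mem_roots hs, by
        rw [inner_neg_right]; linarith⟩))
    · exact hcone (hDspan ⟨hs, h⟩)
  let α : Module.Basis D ℝ (Euc n) := Module.Basis.mk hli htop
  have hα (i : D) : α i = i := Module.Basis.mk_apply hli htop i
  have hroot (i : D) : α i ∈ roots W := by rw [hα]; exact (hD i.2).1
  have hpos {u : Euc n} (hu : u ∈ Submodule.span ℝ≥0 D) (j : D) : 0 ≤ α.repr u j := by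
    classical
    induction hu using Submodule.span_induction with
    | mem s hs =>
      rw [show s = α ⟨s, hs⟩ from (hα ⟨s, hs⟩).symm, α.repr_self, Finsupp.single_apply]
      split_ifs <;> norm_num
    | zero => simp
    | add u v _ _ hu hv => rw [map_add]; exact add_nonneg hu hv
    | smul c u _ hu =>
      rw [NNReal.smul_def, map_smul]; exact mul_nonneg c.2 hu
  have hdich : ∀ v ∈ roots W, (∀ j, 0 ≤ α.repr v j) ∨ (∀ j, α.repr v j ≤ 0) := by
    intro v hv
    rcases lt_or_gt_of_ne (hx v hv) with h | h
    · right
      intro j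
      have := hpos (hDspan ⟨neg_mem_roots hv, by rw [inner_neg_right]; linarith⟩) j
      rw [map_neg, Finsupp.neg_apply] at this
      linarith
    · left; exact hpos (hDspan ⟨hv, h⟩)
  refine ⟨D, inferInstance, α, ⟨fun i => (hroot i).1, ?_, fun w hw i => hdich _
    (apply_mem_roots (hroot i) hw)⟩, fun i j hij =>
    exists_angle hroot hdich hij (by rw [hα, hα]; exact hob i j hij)⟩
  set W₀ := Subgroup.closure (Set.range fun i => refl (α i)) with hW₀
  have hle : W₀ ≤ W := by
    rw [hW₀, Subgroup.closure_le]; rintro _ ⟨i, rfl⟩; exact (hroot i).2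
  apply le_antisymm _ hle
  -- Among the positive roots in the `W₀`-orbit of `b` take one of minimal height. It has positive
  -- inner product with some simple root, whose reflection would lower the height; so that
  -- reflection makes it negative, which only the simple root itself allows.
  have hP : ∀ b ∈ roots W, 0 < ⟪x, b⟫ → refl b ∈ W₀ := by
    intro b hb hbx
    obtain ⟨c, ⟨hc, hcx, w, hw, rfl⟩, hcmin⟩ := Set.exists_min_image
      {c | c ∈ roots W ∧ 0 < ⟪x, c⟫ ∧ ∃ w ∈ W₀, c = w b} (fun c => ⟪x, c⟫)
      ((finite_roots W).subset fun c hc => hc.1) ⟨b, hb, hbx, 1, W₀.one_mem, rfl⟩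
    have hcpos : ∀ j, 0 ≤ α.repr (w b) j := hpos (hDspan ⟨hc, hcx⟩)
    obtain ⟨j, hj⟩ : ∃ j, 0 < ⟪w b, α j⟫ := by
      by_contra! hnp
      have h1 := inner_self_of_norm hc.1
      rw [inner_eq_sum α] at h1
      have := Finset.sum_nonpos fun j (_ : j ∈ Finset.univ) =>
        mul_nonpos_of_nonneg_of_nonpos (hcpos j) (hnp j)
      linarith
    have hrj : refl (α j) ∈ W₀ := Subgroup.subset_closure ⟨j, rfl⟩
    have hfin : w b = α j := by
      by_contra hne
      have hs : refl (α j) (w b) ∈ roots W := apply_mem_roots hc (hroot j).2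
      have hsx : 0 < ⟪x, refl (α j) (w b)⟫ := by
        by_contra hlt
        refine hne (eq_simple_of_refl_nonpos (hroot j).1 hc.1 hcpos fun k => ?_)
        have := hpos (hDspan ⟨neg_mem_roots hs, by
          rw [inner_neg_right, neg_pos]; exact lt_of_le_of_ne (not_lt.mp hlt) (hx _ hs)⟩) k
        rw [map_neg, Finsupp.neg_apply] at this
        linarith
      have h1 := hcmin _ ⟨hs, hsx, refl (α j) * w, W₀.mul_mem hrj hw, rfl⟩
      rw [refl_apply_of_norm (hroot j).1, inner_sub_right, inner_smul_right,
        real_inner_comm (w b) (α j)] at h1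
      have h2 : 0 < ⟪x, α j⟫ := by rw [hα]; exact (hD j.2).2
      have := mul_pos (show 0 < 2 * ⟪w b, α j⟫ by linarith) h2
      linarith
    have : refl b = w⁻¹ * refl (α j) * w := by
      rw [← hfin, ← conj_refl]; group
    rw [this]
    exact W₀.mul_mem (W₀.mul_mem (W₀.inv_mem hw) hrj) hw
  rw [eq_closure_roots hW, Subgroup.closure_le]
  rintro _ ⟨b, hb, rfl⟩
  rcases lt_or_gt_of_ne (hx b hb) with h | h
  · rw [← refl_neg]
    exact hP _ (neg_mem_roots hb) (by rw [inner_neg_right]; linarith)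
  · exact hP b hb h

end ReflectionGroup

/-! ### Isometries permuting a basis, and the codimension of their fixed spaces. -/

namespace ReflectionGroup
variable {n : ℕ}

section Perm
variable {ι : Type*} [Fintype ι] {α : Module.Basis ι ℝ (Euc n)} {a : OrthGroup n}
  {σ : Equiv.Perm ι}

theorem repr_perm (hσ : ∀ i, a (α i) = α (σ i)) (x : Euc n) (i : ι) :
    α.repr (a x) (σ i) = α.repr x i := by
  classical
  conv_lhs => rw [← α.sum_repr x, map_sum, map_sum, Finsupp.finsetSum_apply]
  simp [hσ, Finsupp.single_apply]

theorem repr_of_mem_fixedSpace (hσ : ∀ i, a (α i) = α (σ i)) {x : Euc n}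
    (hx : x ∈ fixedSpace a) (i : ι) : α.repr x (σ i) = α.repr x i := by
  rw [← repr_perm hσ x i, mem_fixedSpace.mp hx]

theorem mem_fixedSpace_of_repr (hσ : ∀ i, a (α i) = α (σ i)) {x : Euc n}
    (hx : ∀ i, α.repr x (σ i) = α.repr x i) : x ∈ fixedSpace a := by
  rw [mem_fixedSpace]
  apply α.repr.injective
  ext j
  obtain ⟨i, rfl⟩ := σ.surjective j
  rw [repr_perm hσ, hx]

/-- `H` says that `U` meets the span of the `α i` with `i ∈ P` trivially. -/
theorem finrank_add_card_le (α : Module.Basis ι ℝ (Euc n)) (U : Submodule ℝ (Euc n)) (P : Finset ι)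
    (H : ∀ x ∈ U, (∀ i ∉ P, α.repr x i = 0) → x = 0) :
    Module.finrank ℝ U + P.card ≤ n := by
  classical
  let V := Submodule.span ℝ (Set.range fun i : P => α i)
  have hV : Module.finrank ℝ V = P.card := by
    have h1 := finrank_span_eq_card (α.linearIndependent.comp (Subtype.val : P → ι)
      Subtype.val_injective)
    rwa [Fintype.card_coe] at h1
  have hsupp (x : Euc n) (hx : x ∈ V) : ∀ i ∉ P, α.repr x i = 0 := by
    intro i hi
    induction hx using Submodule.span_induction with
    | mem s hs =>
      obtain ⟨j, rfl⟩ := hs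
      rw [α.repr_self, Finsupp.single_eq_of_ne]
      rintro rfl; exact hi j.2
    | zero => simp
    | add u v _ _ hu hv => simp [hu, hv]
    | smul c u _ hu => simp [hu]
  have hdis : Disjoint U V := by
    rw [Submodule.disjoint_def]
    exact fun x hx hxV => H x hx (hsupp x hxV)
  have h1 := Submodule.finrank_add_finrank_le_of_disjoint hdis
  rwa [hV, finrank_euclideanSpace_fin] at h1

theorem le_finrank_add {k : ℕ} (L : Euc n →ₗ[ℝ] (Fin k → ℝ)) {U : Submodule ℝ (Euc n)}
    (h : LinearMap.ker L ≤ U) : n ≤ Module.finrank ℝ U + k := by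
  have h1 := L.finrank_range_add_finrank_ker
  have h2 := Submodule.finrank_mono h
  have h3 := Submodule.finrank_le (LinearMap.range L)
  rw [Module.finrank_fin_fun] at h3
  rw [finrank_euclideanSpace_fin] at h1
  omega

/-- A fixed vector supported on `{σ p, σ q, σ r}` vanishes. Its coordinate at `σ p` equals the one
at `p`, which is off the support; the coordinates at `q` and then `r` are either off the support or
already known to be zero. -/
theorem finrank_add_three_le (hσ : ∀ i, a (α i) = α (σ i)) {p q r : ι}
    (h1 : σ p ≠ σ q) (h2 : σ p ≠ σ r) (h3 : σ q ≠ σ r) (hp1 : p ≠ σ p) (hp2 : p ≠ σ q)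
    (hp3 : p ≠ σ r) (hq2 : q ≠ σ q) (hq3 : q ≠ σ r) (hr3 : r ≠ σ r) :
    Module.finrank ℝ (fixedSpace a) + 3 ≤ n := by
  classical
  have hc : ({σ p, σ q, σ r} : Finset ι).card = 3 := Finset.card_eq_three.mpr
    ⟨_, _, _, h1, h2, h3, rfl⟩
  rw [← hc]
  refine finrank_add_card_le α _ _ fun x hx h0 => ?_
  have hx' := repr_of_mem_fixedSpace hσ hx
  have ep : α.repr x (σ p) = 0 := by
    rw [hx']; exact h0 _ (by simp [hp1, hp2, hp3])
  have eq : α.repr x (σ q) = 0 := by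
    rw [hx']
    by_cases h : q = σ p
    · rw [h, ep]
    · exact h0 _ (by simp [h, hq2, hq3])
  have er : α.repr x (σ r) = 0 := by
    rw [hx']
    by_cases h : r = σ p
    · rw [h, ep]
    by_cases h' : r = σ q
    · rw [h', eq]
    · exact h0 _ (by simp [h, h', hr3])
  apply α.repr.map_eq_zero_iff.mp
  ext i
  by_cases hi : i ∈ ({σ p, σ q, σ r} : Finset ι)
  · simp only [Finset.mem_insert, Finset.mem_singleton] at hi
    rcases hi with rfl | rfl | rfl
    · exact ep
    · exact eq
    · exact er
  · exact h0 i hi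

/-- `σ` is a cycle of length three. -/
def IsThreeCycleOn (σ : Equiv.Perm ι) (x y z : ι) : Prop :=
  x ≠ y ∧ y ≠ z ∧ z ≠ x ∧ σ x = y ∧ σ y = z ∧ σ z = x ∧
    ∀ i, i ≠ x → i ≠ y → i ≠ z → σ i = i

/-- `σ` is the product of two disjoint transpositions. -/
def IsDoubleSwapOn (σ : Equiv.Perm ι) (x x' y y' : ι) : Prop :=
  x ≠ x' ∧ x ≠ y ∧ x ≠ y' ∧ x' ≠ y ∧ x' ≠ y' ∧ y ≠ y' ∧
  σ x = x' ∧ σ x' = x ∧ σ y = y' ∧ σ y' = y ∧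
    ∀ i, i ≠ x → i ≠ x' → i ≠ y → i ≠ y' → σ i = i

theorem IsDoubleSwapOn.symm {x x' y y' : ι} (h : IsDoubleSwapOn σ x x' y y') :
    IsDoubleSwapOn σ y y' x x' := by
  obtain ⟨xx', xy, xy', x'y, x'y', yy', hx, hx', hy, hy', hfix⟩ := h
  exact ⟨yy', xy.symm, x'y.symm, xy'.symm, x'y'.symm, xx', hy, hy', hx, hx',
    fun i h1 h2 h3 h4 => hfix i h3 h4 h1 h2⟩

theorem IsDoubleSwapOn.flip {x x' y y' : ι} (h : IsDoubleSwapOn σ x x' y y') :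
    IsDoubleSwapOn σ x x' y' y := by
  obtain ⟨xx', xy, xy', x'y, x'y', yy', hx, hx', hy, hy', hfix⟩ := h
  exact ⟨xx', xy', xy, x'y', x'y, yy'.symm, hx, hx', hy', hy,
    fun i h1 h2 h3 h4 => hfix i h1 h2 h4 h3⟩

/-- `σ` is a transposition. -/
def IsSwapOn (σ : Equiv.Perm ι) (x x' : ι) : Prop :=
  x ≠ x' ∧ σ x = x' ∧ σ x' = x ∧ ∀ i, i ≠ x → i ≠ x' → σ i = i

/-- The codimension of the fixed space is the number of indices minus the number of cycles. A cycle
of length at least four, a three-cycle with another moved point, or three disjoint transpositions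
each provide three indices showing codimension at least three. -/
theorem perm_cases (hσ : ∀ i, a (α i) = α (σ i))
    (hn : n ≤ Module.finrank ℝ (fixedSpace a) + 2) :
    σ = 1 ∨ (∃ x x', IsSwapOn σ x x') ∨ (∃ x y z, IsThreeCycleOn σ x y z) ∨
      ∃ x x' y y', IsDoubleSwapOn σ x x' y y' := by
  have H {p q r : ι} (h1 : p ≠ q) (h2 : p ≠ r) (h3 : q ≠ r) (hp1 : p ≠ σ p) (hp2 : p ≠ σ q)
      (hp3 : p ≠ σ r) (hq2 : q ≠ σ q) (hq3 : q ≠ σ r) (hr3 : r ≠ σ r) : False := by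
    have := finrank_add_three_le hσ (σ.injective.ne h1) (σ.injective.ne h2) (σ.injective.ne h3)
      hp1 hp2 hp3 hq2 hq3 hr3
    omega
  by_cases hone : σ = 1
  · exact Or.inl hone
  right
  obtain ⟨x, hx⟩ : ∃ x, σ x ≠ x := by
    by_contra! h
    exact hone (Equiv.ext h)
  have inj := fun i j => σ.injective.eq_iff (a := i) (b := j)
  by_cases hlong : ∃ x, σ (σ x) ≠ x
  · right; left
    obtain ⟨x, hx2⟩ := hlong
    have hx : σ x ≠ x := fun h => hx2 (by rw [h, h])
    have hx1 : σ (σ x) ≠ σ x := fun h => hx (σ.injective h)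
    have h3 : σ (σ (σ x)) = x := by
      by_contra h3
      refine H (p := x) (q := σ x) (r := σ (σ x)) hx.symm hx2.symm hx1.symm hx.symm hx2.symm
        (Ne.symm h3) hx1.symm ?_ ?_
      · intro h; exact hx2 (σ.injective h).symm
      · intro h; exact hx1 (σ.injective h).symm
    refine ⟨x, σ x, σ (σ x), hx.symm, hx1.symm, hx2, rfl, rfl, h3, fun i h1 h2 h4 => ?_⟩
    by_contra hi
    refine H (p := i) (q := x) (r := σ x) h1 h2 hx.symm (Ne.symm hi) h2 h4 hx.symm hx2.symm
      hx1.symm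
  · push Not at hlong
    by_cases hsw : ∀ i, i ≠ x → i ≠ σ x → σ i = i
    · exact Or.inl ⟨x, σ x, hx.symm, rfl, hlong x, hsw⟩
    · push Not at hsw
      obtain ⟨y, hy1, hy2, hy⟩ := hsw
      have hy3 : x ≠ σ y := fun h => hy2 (by rw [h, hlong])
      have hy4 : σ x ≠ σ y := fun h => hy1 (σ.injective h).symm
      refine Or.inr (Or.inr ⟨x, σ x, y, σ y, hx.symm, hy1.symm, hy3, hy2.symm, hy4, hy.symm, rfl,
        hlong x, rfl, hlong y, fun i h1 h2 h3 h4 => ?_⟩)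
      by_contra hi
      refine H (p := i) (q := x) (r := y) h1 h3 hy1.symm (Ne.symm hi) h2 h4 hx.symm hy3 hy.symm

theorem finrank_swap (hσ : ∀ i, a (α i) = α (σ i)) {x x' : ι} (h : IsSwapOn σ x x') :
    IsReflection a := by
  obtain ⟨hne, hx, hx', hfix⟩ := h
  apply le_antisymm
  · refine finrank_add_card_le α _ {x} fun v hv h0 => ?_
    have h1 := repr_of_mem_fixedSpace hσ hv x
    rw [hx, h0 x' (by simpa using hne.symm)] at h1
    apply α.repr.map_eq_zero_iff.mp
    ext i
    by_cases hi : i = x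
    · rw [hi, ← h1]; rfl
    · exact h0 i (by simpa using hi)
  · let L : Euc n →ₗ[ℝ] (Fin 1 → ℝ) := LinearMap.pi fun _ => α.coord x - α.coord x'
    refine le_finrank_add L fun v hv => mem_fixedSpace_of_repr hσ fun i => ?_
    have h1 : α.repr v x = α.repr v x' := by
      have := congrFun (LinearMap.mem_ker.mp hv) 0
      simpa [L, sub_eq_zero] using this
    by_cases hi : i = x
    · rw [hi, hx, h1]
    by_cases hi' : i = x'
    · rw [hi', hx', h1]
    · rw [hfix i hi hi']

theorem finrank_threeCycle (hσ : ∀ i, a (α i) = α (σ i)) {x y z : ι} (h : IsThreeCycleOn σ x y z) :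
    IsRotation a := by
  classical
  obtain ⟨hxy, hyz, hzx, hx, hy, hz, hfix⟩ := h
  apply le_antisymm
  · rw [← Finset.card_pair hxy]
    refine finrank_add_card_le α _ {x, y} fun v hv h0 => ?_
    have h1 := repr_of_mem_fixedSpace hσ hv
    have ez : α.repr v z = 0 := h0 z (by simp [hzx, hyz.symm])
    have ex : α.repr v x = 0 := by rw [← hz, h1, ez]
    have ey : α.repr v y = 0 := by rw [← hx, h1, ex]
    apply α.repr.map_eq_zero_iff.mp
    ext i
    by_cases hi : i = x
    · rw [hi, ex]; rfl
    by_cases hi' : i = y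
    · rw [hi', ey]; rfl
    · exact h0 i (by simp [hi, hi'])
  · let L : Euc n →ₗ[ℝ] (Fin 2 → ℝ) :=
      LinearMap.pi ![α.coord x - α.coord y, α.coord y - α.coord z]
    refine le_finrank_add L fun v hv => mem_fixedSpace_of_repr hσ fun i => ?_
    have h1 : α.repr v x = α.repr v y := by
      have := congrFun (LinearMap.mem_ker.mp hv) 0
      simpa [L, sub_eq_zero] using this
    have h2 : α.repr v y = α.repr v z := by
      have := congrFun (LinearMap.mem_ker.mp hv) 1
      simpa [L, sub_eq_zero] using this
    by_cases hi : i = x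
    · rw [hi, hx, h1]
    by_cases hi' : i = y
    · rw [hi', hy, h2]
    by_cases hi'' : i = z
    · rw [hi'', hz, h1, h2]
    · rw [hfix i hi hi' hi'']

theorem finrank_doubleSwap (hσ : ∀ i, a (α i) = α (σ i)) {x x' y y' : ι}
    (h : IsDoubleSwapOn σ x x' y y') : IsRotation a := by
  classical
  obtain ⟨hxx', hxy, hxy', hx'y, hx'y', hyy', hx, hx', hy, hy', hfix⟩ := h
  apply le_antisymm
  · rw [← Finset.card_pair hxy]
    refine finrank_add_card_le α _ {x, y} fun v hv h0 => ?_
    have h1 := repr_of_mem_fixedSpace hσ hv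
    have ex : α.repr v x = 0 := by rw [← h1, hx]; exact h0 _ (by simp [hxx'.symm, hx'y])
    have ey : α.repr v y = 0 := by rw [← h1, hy]; exact h0 _ (by simp [hxy'.symm, hyy'.symm])
    apply α.repr.map_eq_zero_iff.mp
    ext i
    by_cases hi : i = x
    · rw [hi, ex]; rfl
    by_cases hi' : i = y
    · rw [hi', ey]; rfl
    · exact h0 i (by simp [hi, hi'])
  · let L : Euc n →ₗ[ℝ] (Fin 2 → ℝ) :=
      LinearMap.pi ![α.coord x - α.coord x', α.coord y - α.coord y']
    refine le_finrank_add L fun v hv => mem_fixedSpace_of_repr hσ fun i => ?_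
    have h1 : α.repr v x = α.repr v x' := by
      have := congrFun (LinearMap.mem_ker.mp hv) 0
      simpa [L, sub_eq_zero] using this
    have h2 : α.repr v y = α.repr v y' := by
      have := congrFun (LinearMap.mem_ker.mp hv) 1
      simpa [L, sub_eq_zero] using this
    by_cases hi : i = x
    · rw [hi, hx, h1]
    by_cases hi' : i = y
    · rw [hi', hy, h2]
    by_cases hi2 : i = x'
    · rw [hi2, hx', h1]
    by_cases hi3 : i = y'
    · rw [hi3, hy', h2]
    · rw [hfix i hi hi2 hi' hi3]

theorem perm_pow (hσ : ∀ i, a (α i) = α (σ i)) (k : ℕ) (i : ι) : (a ^ k) (α i) = α ((σ ^ k) i) := by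
  induction k with
  | zero => rfl
  | succ k ih => rw [pow_succ', mul_apply, ih, hσ, pow_succ', Equiv.Perm.mul_apply]

theorem eq_one_of_perm_eq_one (hσ : ∀ i, a (α i) = α (σ i)) (h : σ = 1) : a = 1 := by
  subst h; exact ext_basis α hσ

theorem isOfFinOrder_of_perm (hσ : ∀ i, a (α i) = α (σ i)) : IsOfFinOrder a := by
  classical
  rw [isOfFinOrder_iff_pow_eq_one]
  obtain ⟨k, hk, h⟩ := isOfFinOrder_iff_pow_eq_one.mp (isOfFinOrder_of_finite σ)
  exact ⟨k, hk, eq_one_of_perm_eq_one (perm_pow hσ k) h⟩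

theorem perm_inv (hσ : ∀ i, a (α i) = α (σ i)) (i : ι) : a⁻¹ (α i) = α (σ⁻¹ i) :=
  inv_apply_eq.mpr (by rw [hσ]; simp)

theorem perm_zpow (hσ : ∀ i, a (α i) = α (σ i)) (k : ℤ) (i : ι) :
    (a ^ k) (α i) = α ((σ ^ k) i) := by
  cases k with
  | ofNat k => exact perm_pow hσ k i
  | negSucc k =>
    rw [zpow_negSucc, zpow_negSucc]
    exact perm_inv (perm_pow hσ (k + 1)) i

end Perm

/-! ### Extending a reflection group by a diagram automorphism. -/

section Extension
variable {W : Subgroup (OrthGroup n)} {a : OrthGroup n}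

theorem conj_zpow_mem {a : OrthGroup n} (ha : ∀ g, g ∈ W ↔ a * g * a⁻¹ ∈ W) (t : ℤ)
    {g : OrthGroup n} (hg : g ∈ W) : a ^ t * g * (a ^ t)⁻¹ ∈ W := by
  have h1 (k : ℕ) (g : OrthGroup n) : g ∈ W ↔ a ^ k * g * (a ^ k)⁻¹ ∈ W := by
    induction k generalizing g with
    | zero => simp
    | succ k ih =>
      rw [ih, ha, pow_succ']
      simp only [mul_inv_rev, mul_assoc]
  cases t with
  | ofNat k => exact (h1 k g).mp hg
  | negSucc k =>
    rw [h1 (k + 1), zpow_negSucc]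
    simpa [mul_assoc] using hg

/-- Since `a` normalizes `W`, powers of `a` can be moved to the right past elements of `W`. -/
theorem exists_mul_zpow_of_mem_closure (ha : ∀ g, g ∈ W ↔ a * g * a⁻¹ ∈ W) {g : OrthGroup n}
    (hg : g ∈ Subgroup.closure ((W : Set (OrthGroup n)) ∪ {a})) :
    ∃ w ∈ W, ∃ t : ℤ, g = w * a ^ t := by
  induction hg using Subgroup.closure_induction with
  | mem g hg =>
    rcases hg with hg | hg
    · exact ⟨g, hg, 0, by simp⟩
    · exact ⟨1, W.one_mem, 1, by simpa using hg⟩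
  | one => exact ⟨1, W.one_mem, 0, by simp⟩
  | mul g g' _ _ h1 h2 =>
    obtain ⟨w, hw, t, rfl⟩ := h1
    obtain ⟨w', hw', t', rfl⟩ := h2
    refine ⟨w * (a ^ t * w' * (a ^ t)⁻¹), W.mul_mem hw (conj_zpow_mem ha t hw'), t + t', ?_⟩
    rw [zpow_add]; group
  | inv g _ h1 =>
    obtain ⟨w, hw, t, rfl⟩ := h1
    refine ⟨a ^ (-t) * w⁻¹ * (a ^ (-t))⁻¹, conj_zpow_mem ha _ (W.inv_mem hw), -t, ?_⟩
    group

theorem finite_closure_union [Finite W] (ha : ∀ g, g ∈ W ↔ a * g * a⁻¹ ∈ W)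
    (hfin : IsOfFinOrder a) : Finite (Subgroup.closure ((W : Set (OrthGroup n)) ∪ {a})) := by
  have : Finite (Subgroup.zpowers a) := (finite_zpowers.mpr hfin).to_subtype
  refine Set.Finite.to_subtype (s := (Subgroup.closure ((W : Set (OrthGroup n)) ∪ {a}) : Set _))
    ((Set.finite_range fun p : W × Subgroup.zpowers a =>
      (p.1 : OrthGroup n) * (p.2 : OrthGroup n)).subset ?_)
  intro g hg
  obtain ⟨w, hw, t, rfl⟩ := exists_mul_zpow_of_mem_closure ha hg
  exact ⟨(⟨w, hw⟩, ⟨a ^ t, t, rfl⟩), rfl⟩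

theorem extendedGroup_le {h w : OrthGroup n} (hw : w ∈ W) (hh : h = w * a) :
    extendedGroup W h ≤ Subgroup.closure ((W : Set (OrthGroup n)) ∪ {a}) := by
  rw [extendedGroup, Subgroup.closure_le]
  rintro g (hg | hg)
  · exact Subgroup.subset_closure (Or.inl hg.1)
  · rw [Set.mem_singleton_iff.mp hg, hh]
    exact Subgroup.mul_mem _ (Subgroup.subset_closure (Or.inl hw))
      (Subgroup.subset_closure (Or.inr rfl))

/-- Adjoining a reflection to a reflection group: the extension by `w * a` consists of the
orientation preserving elements of a reflection group. -/
theorem extendedGroup_eq_of_isReflection (hW : IsReflectionGroup W)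
    (ha : ∀ g, g ∈ W ↔ a * g * a⁻¹ ∈ W) (hr : IsReflection a) {h w : OrthGroup n} (hw : w ∈ W)
    (hh : h = w * a) (hdet : odet n h = 1) :
    ∃ W' : Subgroup (OrthGroup n), IsReflectionGroup W' ∧
      extendedGroup W h = orientationPreserving W' := by
  have := hW.1
  have ha2 : a * a = 1 := by
    obtain ⟨v, -, rfl⟩ := isReflection_iff.mp hr
    exact refl_mul_self v
  have hfin : IsOfFinOrder a := isOfFinOrder_iff_pow_eq_one.mpr ⟨2, by norm_num, by rw [pow_two, ha2]⟩
  refine ⟨Subgroup.closure ((W : Set (OrthGroup n)) ∪ {a}), ⟨finite_closure_union ha hfin, ?_⟩, ?_⟩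
  · obtain ⟨-, S, hS, hWS⟩ := hW
    refine ⟨S ∪ {a}, ?_, ?_⟩
    · rintro s (hs | hs)
      · exact hS s hs
      · rw [Set.mem_singleton_iff.mp hs]; exact hr
    · rw [Subgroup.closure_union, Subgroup.closure_union, Subgroup.closure_eq, hWS]
  · apply le_antisymm
    · rw [extendedGroup, Subgroup.closure_le]
      rintro g (hg | hg)
      · exact ⟨Subgroup.subset_closure (Or.inl hg.1), hg.2⟩
      · rw [Set.mem_singleton_iff.mp hg]
        refine ⟨extendedGroup_le hw hh (Subgroup.subset_closure (Or.inr rfl)), hdet⟩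
    · rintro g ⟨hg, hgd⟩
      obtain ⟨w', hw', t, rfl⟩ := exists_mul_zpow_of_mem_closure ha hg
      rcases Int.even_or_odd' t with ⟨k, rfl | rfl⟩
      · have h1 : a ^ (2 * k) = 1 := by rw [zpow_mul, zpow_two, ha2, one_zpow]
        rw [h1, mul_one] at hgd ⊢
        exact Subgroup.subset_closure (Or.inl ⟨hw', hgd⟩)
      · have h1 : a ^ (2 * k + 1) = a := by
          rw [zpow_add, zpow_mul, zpow_two, ha2, one_zpow, one_mul, zpow_one]
        rw [h1] at hgd ⊢
        have h2 : w' * a = (w' * w⁻¹) * h := by rw [hh]; group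
        rw [h2] at hgd ⊢
        have hgd' : odet n (w' * w⁻¹ * h) = 1 := hgd
        rw [map_mul, hdet, mul_one] at hgd'
        exact Subgroup.mul_mem _ (Subgroup.subset_closure
          (Or.inl ⟨W.mul_mem hw' (W.inv_mem hw), hgd'⟩)) (Subgroup.subset_closure (Or.inr rfl))

/-- An extending rotation induces a three-cycle or a double transposition of the diagram. -/
theorem exists_perm_of_isExtendingRotation {ι : Type*} [Fintype ι] (hW : IsReflectionGroup W)
    {α : Module.Basis ι ℝ (Euc n)} (hα : SimpleSystem W α) {h : OrthGroup n}
    (hh : IsExtendingRotation W h) :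
    ∃ w ∈ W, ∃ (a : OrthGroup n) (σ : Equiv.Perm ι), (∀ i, a (α i) = α (σ i)) ∧ h = w * a ∧
      ((∃ x y z, IsThreeCycleOn σ x y z) ∨ ∃ x x' y y', IsDoubleSwapOn σ x x' y y') := by
  have := hW.1
  obtain ⟨w, hw, a, σ, hσ, hwa, hrank⟩ := hα.exists_decomposition hh.normalizes
  refine ⟨w, hw, a, σ, hσ, hwa, ?_⟩
  have hrot := hh.isRotation
  unfold IsRotation at hrot
  -- The fixed space of `a` is at least as large as that of the rotation `h`, so it has codimension
  -- at most two.
  rcases perm_cases hσ (by omega) with h1 | ⟨x, x', h1⟩ | h1 | h1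
  · exfalso
    apply hh.notMem
    rw [hwa, eq_one_of_perm_eq_one hσ h1, mul_one]; exact hw
  · exfalso
    exact hh.not_orientationPreserving (extendedGroup_eq_of_isReflection hW
      (hα.normalizes_of_perm hσ) (finrank_swap hσ h1) hw hwa hh.mem_SO)
  · exact Or.inl h1
  · exact Or.inr h1

end Extension

end ReflectionGroup

/-! ### Subdiagrams excluded by positive definiteness. -/

namespace ReflectionGroup
variable {n : ℕ}

section Diagram
variable {ι : Type*} [Fintype ι]

/-- A connected Coxeter diagram: unit vectors whose inner products are, as far as needed, those of
the simple roots of an irreducible reflection group. -/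
structure IsDiagram (α : Module.Basis ι ℝ (Euc n)) : Prop where
  norm : ∀ i, ⟪α i, α i⟫ = 1
  val : ∀ i j, i ≠ j → ⟪α i, α j⟫ = 0 ∨ ⟪α i, α j⟫ = -(1 / 2) ∨ ⟪α i, α j⟫ = -(√2 / 2) ∨
    ⟪α i, α j⟫ ≤ -(3 / 4)
  conn : ∀ S : Finset ι, S.Nonempty → (∃ j, j ∉ S) → ∃ i ∈ S, ∃ j ∉ S, ⟪α i, α j⟫ ≠ 0

/-- The quadratic form of a linear combination of basis vectors given by a list. -/
noncomputable def quad (α : Module.Basis ι ℝ (Euc n)) : List (ℝ × ι) → ℝ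
  | [] => 0
  | p :: l => p.1 * p.1 * ⟪α p.2, α p.2⟫ +
      (l.map fun q => 2 * (p.1 * q.1) * ⟪α p.2, α q.2⟫).sum + quad α l

theorem quad_eq (α : Module.Basis ι ℝ (Euc n)) (l : List (ℝ × ι)) :
    quad α l = ⟪(l.map fun q => q.1 • α q.2).sum, (l.map fun q => q.1 • α q.2).sum⟫ := by
  induction l with
  | nil => simp [quad]
  | cons p l ih =>
    have h (v : Euc n) (c : ℝ) (l : List (ℝ × ι)) :
        (l.map fun q => 2 * (c * q.1) * ⟪v, α q.2⟫).sum =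
          2 * (c * ⟪v, (l.map fun q => q.1 • α q.2).sum⟫) := by
      induction l with
      | nil => simp
      | cons q l ih =>
        simp only [List.map_cons, List.sum_cons, ih, inner_add_right, inner_smul_right]; ring
    rw [quad, h, ih, List.map_cons, List.sum_cons]
    simp only [inner_add_left, inner_add_right, inner_smul_left, inner_smul_right, conj_trivial]
    rw [real_inner_comm (α p.2) (List.sum _)]
    ring

/-- The coefficient of `α x` is `c`, so the combination is nonzero. In the exclusions below the list
holds a vector on which the form would be nonpositive, usually the null vector of an affine diagram.
-/
theorem quad_pos (α : Module.Basis ι ℝ (Euc n)) {c : ℝ} (hc : 0 < c) {x : ι} {l : List (ℝ × ι)}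
    (hx : ∀ p ∈ l, x ≠ p.2) : 0 < quad α ((c, x) :: l) := by
  rw [quad_eq]
  apply real_inner_self_pos.mpr
  intro h0
  have h1 : α.repr ((l.map fun q => q.1 • α q.2).sum) x = 0 := by
    clear h0
    induction l with
    | nil => simp
    | cons q l ih =>
      simp only [List.mem_cons, forall_eq_or_imp] at hx
      rw [List.map_cons, List.sum_cons, map_add, Finsupp.add_apply, ih hx.2, map_smul, α.repr_self,
        Finsupp.smul_apply, Finsupp.single_eq_of_ne hx.1]
      simp
  have h2 := congrArg (fun v => α.repr v x) h0
  simp only [List.map_cons, List.sum_cons, map_add, Finsupp.add_apply, h1, map_smul, α.repr_self,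
    Finsupp.smul_apply, Finsupp.single_eq_same, map_zero, Finsupp.zero_apply, smul_eq_mul] at h2
  linarith

namespace IsDiagram
variable {α : Module.Basis ι ℝ (Euc n)} (h : IsDiagram α)
include h

theorem sqrt_two_bounds : 1.4 < √2 ∧ √2 < 1.5 ∧ √2 * √2 = 2 :=
  ⟨Real.lt_sqrt_of_sq_lt (by norm_num), by rw [Real.sqrt_lt' (by norm_num)]; norm_num,
    Real.mul_self_sqrt (by norm_num)⟩

theorem nonpos {i j : ι} (hij : i ≠ j) : ⟪α i, α j⟫ ≤ 0 := by
  have := h.sqrt_two_bounds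
  rcases h.val i j hij with h | h | h | h <;> linarith

theorem bond {i j : ι} (hij : i ≠ j) (h0 : ⟪α i, α j⟫ ≠ 0) : ⟪α i, α j⟫ ≤ -(1 / 2) := by
  have := h.sqrt_two_bounds
  rcases h.val i j hij with h | h | h | h
  · exact absurd h h0
  all_goals linarith

theorem bond_cases {i j : ι} (hij : i ≠ j) (h0 : ⟪α i, α j⟫ ≠ 0) :
    ⟪α i, α j⟫ = -(1 / 2) ∨ ⟪α i, α j⟫ ≤ -(√2 / 2) := by
  have := h.sqrt_two_bounds
  rcases h.val i j hij with h | h | h | h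
  · exact absurd h h0
  · exact Or.inl h
  · exact Or.inr h.le
  · right; linarith

/-- The sum of the roots around a cycle of length `m` has square norm at most `m - m = 0`, as every
bond contributes at most `-1`. The same vector serves for the longer cycles. -/
theorem no_triangle {x y z : ι} (hd : [x, y, z].Nodup) (h1 : ⟪α x, α y⟫ ≠ 0)
    (h2 : ⟪α y, α z⟫ ≠ 0) (h3 : ⟪α x, α z⟫ ≠ 0) : False := by
  simp only [List.nodup_cons, List.mem_cons, List.not_mem_nil, or_false, not_or] at hd
  obtain ⟨⟨xy, xz⟩, yz, -⟩ := hd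
  have := quad_pos α (c := 1) one_pos (x := x) (l := [(1, y), (1, z)]) (by simp [*])
  simp only [quad, h.norm, List.map_cons, List.map_nil, List.sum_cons, List.sum_nil] at this
  linarith [h.bond xy h1, h.bond yz h2, h.bond xz h3]

theorem no_square {x y z w : ι} (hd : [x, y, z, w].Nodup) (h1 : ⟪α x, α y⟫ ≠ 0)
    (h2 : ⟪α y, α z⟫ ≠ 0) (h3 : ⟪α z, α w⟫ ≠ 0) (h4 : ⟪α x, α w⟫ ≠ 0) : False := by
  simp only [List.nodup_cons, List.mem_cons, List.not_mem_nil, or_false, not_or] at hd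
  obtain ⟨⟨xy, xz, xw⟩, ⟨yz, yw⟩, zw, -⟩ := hd
  have := quad_pos α (c := 1) one_pos (x := x) (l := [(1, y), (1, z), (1, w)]) (by simp [*])
  simp only [quad, h.norm, List.map_cons, List.map_nil, List.sum_cons, List.sum_nil] at this
  linarith [h.bond xy h1, h.bond yz h2, h.bond zw h3, h.bond xw h4, h.nonpos xz, h.nonpos yw]

theorem no_pentagon {a b c d e : ι} (hd : [a, b, c, d, e].Nodup) (h1 : ⟪α a, α b⟫ ≠ 0)
    (h2 : ⟪α b, α c⟫ ≠ 0) (h3 : ⟪α c, α d⟫ ≠ 0) (h4 : ⟪α d, α e⟫ ≠ 0) (h5 : ⟪α a, α e⟫ ≠ 0) :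
    False := by
  simp only [List.nodup_cons, List.mem_cons, List.not_mem_nil, or_false, not_or] at hd
  obtain ⟨⟨ab, ac, ad, ae⟩, ⟨bc, bd, be⟩, ⟨cd, ce⟩, de, -⟩ := hd
  have := quad_pos α (c := 1) one_pos (x := a) (l := [(1, b), (1, c), (1, d), (1, e)]) (by simp [*])
  simp only [quad, h.norm, List.map_cons, List.map_nil, List.sum_cons, List.sum_nil] at this
  linarith [h.bond ab h1, h.bond bc h2, h.bond cd h3, h.bond de h4, h.bond ae h5, h.nonpos ac,
    h.nonpos ad, h.nonpos bd, h.nonpos be, h.nonpos ce]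

theorem no_hexagon {a b c d e f : ι} (hd : [a, b, c, d, e, f].Nodup) (h1 : ⟪α a, α b⟫ ≠ 0)
    (h2 : ⟪α b, α c⟫ ≠ 0) (h3 : ⟪α c, α d⟫ ≠ 0) (h4 : ⟪α d, α e⟫ ≠ 0) (h5 : ⟪α e, α f⟫ ≠ 0)
    (h6 : ⟪α a, α f⟫ ≠ 0) : False := by
  simp only [List.nodup_cons, List.mem_cons, List.not_mem_nil, or_false, not_or] at hd
  obtain ⟨⟨ab, ac, ad, ae, af⟩, ⟨bc, bd, be, bf⟩, ⟨cd, ce, cf⟩, ⟨de, df⟩, ef, -⟩ := hd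
  have := quad_pos α (c := 1) one_pos (x := a)
    (l := [(1, b), (1, c), (1, d), (1, e), (1, f)]) (by simp [*])
  simp only [quad, h.norm, List.map_cons, List.map_nil, List.sum_cons, List.sum_nil] at this
  linarith [h.bond ab h1, h.bond bc h2, h.bond cd h3, h.bond de h4, h.bond ef h5, h.bond af h6,
    h.nonpos ac, h.nonpos ad, h.nonpos ae, h.nonpos bd, h.nonpos be, h.nonpos bf, h.nonpos ce,
    h.nonpos cf, h.nonpos df]

/-- The coefficients 2, 1, 1, 1, 1 are those of the null vector of affine D₄. -/
theorem no_four_star {c x y z w : ι} (hd : [c, x, y, z, w].Nodup) (h1 : ⟪α c, α x⟫ ≠ 0)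
    (h2 : ⟪α c, α y⟫ ≠ 0) (h3 : ⟪α c, α z⟫ ≠ 0) (h4 : ⟪α c, α w⟫ ≠ 0) : False := by
  simp only [List.nodup_cons, List.mem_cons, List.not_mem_nil, or_false, not_or] at hd
  obtain ⟨⟨cx, cy, cz, cw⟩, ⟨xy, xz, xw⟩, ⟨yz, yw⟩, zw, -⟩ := hd
  have := quad_pos α (c := 2) two_pos (x := c) (l := [(1, x), (1, y), (1, z), (1, w)]) (by simp [*])
  simp only [quad, h.norm, List.map_cons, List.map_nil, List.sum_cons, List.sum_nil] at this
  linarith [h.bond cx h1, h.bond cy h2, h.bond cz h3, h.bond cw h4, h.nonpos xy, h.nonpos xz,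
    h.nonpos xw, h.nonpos yz, h.nonpos yw, h.nonpos zw]

/-- Null vector of affine B₃; the factor `√2` accounts for the other root length. -/
theorem no_heavy_three_star {c x y z : ι} (hd : [c, x, y, z].Nodup) (h1 : ⟪α c, α x⟫ ≠ 0)
    (h2 : ⟪α c, α y⟫ ≠ 0) (h3 : ⟪α c, α z⟫ ≤ -(√2 / 2)) : False := by
  simp only [List.nodup_cons, List.mem_cons, List.not_mem_nil, or_false, not_or] at hd
  obtain ⟨⟨cx, cy, cz⟩, ⟨xy, xz⟩, yz, -⟩ := hd
  have := quad_pos α (c := 2) two_pos (x := c) (l := [(1, x), (1, y), (√2, z)]) (by simp [*])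
  simp only [quad, h.norm, List.map_cons, List.map_nil, List.sum_cons, List.sum_nil] at this
  obtain ⟨s1, s2, s3⟩ := h.sqrt_two_bounds
  have e1 := mul_le_mul_of_nonneg_left h3 (by linarith : (0 : ℝ) ≤ √2)
  have e2 := mul_nonpos_of_nonneg_of_nonpos (by linarith : (0 : ℝ) ≤ √2) (h.nonpos xz)
  have e3 := mul_nonpos_of_nonneg_of_nonpos (by linarith : (0 : ℝ) ≤ √2) (h.nonpos yz)
  linarith [h.bond cx h1, h.bond cy h2, h.nonpos xy]

/-- Null vector of affine C₂. The next two lemmas use affine C₃ and C₄ in the same way. -/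
theorem no_two_heavy {c x y : ι} (hd : [c, x, y].Nodup) (h1 : ⟪α c, α x⟫ ≤ -(√2 / 2))
    (h2 : ⟪α c, α y⟫ ≤ -(√2 / 2)) : False := by
  simp only [List.nodup_cons, List.mem_cons, List.not_mem_nil, or_false, not_or] at hd
  obtain ⟨⟨cx, cy⟩, xy, -⟩ := hd
  obtain ⟨s1, s2, s3⟩ := h.sqrt_two_bounds
  have hs : 0 < √2 := by linarith
  have := quad_pos α (c := √2) hs (x := c) (l := [(1, x), (1, y)]) (by simp [*])
  simp only [quad, h.norm, List.map_cons, List.map_nil, List.sum_cons, List.sum_nil] at this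
  have e1 := mul_le_mul_of_nonneg_left h1 hs.le
  have e2 := mul_le_mul_of_nonneg_left h2 hs.le
  linarith [h.nonpos xy]

theorem no_heavy_ends_four {a b c d : ι} (hd : [a, b, c, d].Nodup) (h1 : ⟪α a, α b⟫ ≤ -(√2 / 2))
    (h2 : ⟪α b, α c⟫ ≠ 0) (h3 : ⟪α c, α d⟫ ≤ -(√2 / 2)) : False := by
  simp only [List.nodup_cons, List.mem_cons, List.not_mem_nil, or_false, not_or] at hd
  obtain ⟨⟨ab, ac, ad⟩, ⟨bc, bd⟩, cd, -⟩ := hd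
  obtain ⟨s1, s2, s3⟩ := h.sqrt_two_bounds
  have hs : 0 < √2 := by linarith
  have := quad_pos α (c := 1) one_pos (x := a) (l := [(√2, b), (√2, c), (1, d)]) (by simp [*])
  simp only [quad, h.norm, List.map_cons, List.map_nil, List.sum_cons, List.sum_nil, s3] at this
  have e1 := mul_le_mul_of_nonneg_left h1 hs.le
  have e2 := mul_le_mul_of_nonneg_left h3 hs.le
  have e3 := mul_nonpos_of_nonneg_of_nonpos hs.le (h.nonpos ac)
  have e4 := mul_nonpos_of_nonneg_of_nonpos hs.le (h.nonpos bd)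
  linarith [h.bond bc h2, h.nonpos ad]

theorem no_heavy_ends_five {a b c d e : ι} (hd : [a, b, c, d, e].Nodup)
    (h1 : ⟪α a, α b⟫ ≤ -(√2 / 2)) (h2 : ⟪α b, α c⟫ ≠ 0) (h3 : ⟪α c, α d⟫ ≠ 0)
    (h4 : ⟪α d, α e⟫ ≤ -(√2 / 2)) : False := by
  simp only [List.nodup_cons, List.mem_cons, List.not_mem_nil, or_false, not_or] at hd
  obtain ⟨⟨ab, ac, ad, ae⟩, ⟨bc, bd, be⟩, ⟨cd, ce⟩, de, -⟩ := hd
  obtain ⟨s1, s2, s3⟩ := h.sqrt_two_bounds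
  have hs : 0 < √2 := by linarith
  have := quad_pos α (c := 1) one_pos (x := a)
    (l := [(√2, b), (√2, c), (√2, d), (1, e)]) (by simp [*])
  simp only [quad, h.norm, List.map_cons, List.map_nil, List.sum_cons, List.sum_nil, s3] at this
  have e1 := mul_le_mul_of_nonneg_left h1 hs.le
  have e2 := mul_le_mul_of_nonneg_left h4 hs.le
  have e3 := mul_nonpos_of_nonneg_of_nonpos hs.le (h.nonpos ac)
  have e4 := mul_nonpos_of_nonneg_of_nonpos hs.le (h.nonpos ad)
  have e5 := mul_nonpos_of_nonneg_of_nonpos hs.le (h.nonpos be)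
  have e6 := mul_nonpos_of_nonneg_of_nonpos hs.le (h.nonpos ce)
  linarith [h.bond bc h2, h.bond cd h3, h.nonpos bd, h.nonpos ae]

/-- The vector with coefficients 1, 2, 2, 1 has square norm at most `10 - 2 - 6 - 2 = 0`. -/
theorem no_heavy_middle {a b c d : ι} (hd : [a, b, c, d].Nodup) (h1 : ⟪α a, α b⟫ ≠ 0)
    (h2 : ⟪α b, α c⟫ ≤ -(3 / 4)) (h3 : ⟪α c, α d⟫ ≠ 0) : False := by
  simp only [List.nodup_cons, List.mem_cons, List.not_mem_nil, or_false, not_or] at hd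
  obtain ⟨⟨ab, ac, ad⟩, ⟨bc, bd⟩, cd, -⟩ := hd
  have := quad_pos α (c := 1) one_pos (x := a) (l := [(2, b), (2, c), (1, d)]) (by simp [*])
  simp only [quad, h.norm, List.map_cons, List.map_nil, List.sum_cons, List.sum_nil] at this
  linarith [h.bond ab h1, h.bond cd h3, h.nonpos ac, h.nonpos bd, h.nonpos ad]

/-- Null vector of affine E₆: coefficient 3 at the centre, then 2 and 1 along each arm. -/
theorem no_long_three_star {c x y z x' y' z' : ι} (hd : [c, x, y, z, x', y', z'].Nodup)
    (h1 : ⟪α c, α x⟫ ≠ 0) (h2 : ⟪α c, α y⟫ ≠ 0) (h3 : ⟪α c, α z⟫ ≠ 0)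
    (h4 : ⟪α x, α x'⟫ ≠ 0) (h5 : ⟪α y, α y'⟫ ≠ 0) (h6 : ⟪α z, α z'⟫ ≠ 0) : False := by
  simp only [List.nodup_cons, List.mem_cons, List.not_mem_nil, or_false, not_or] at hd
  obtain ⟨⟨cx, cy, cz, cx', cy', cz'⟩, ⟨xy, xz, xx', xy', xz'⟩, ⟨yz, yx', yy', yz'⟩,
    ⟨zx', zy', zz'⟩, ⟨x'y', x'z'⟩, y'z', -⟩ := hd
  have := quad_pos α (c := 3) three_pos (x := c)
    (l := [(2, x), (2, y), (2, z), (1, x'), (1, y'), (1, z')]) (by simp [*])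
  simp only [quad, h.norm, List.map_cons, List.map_nil, List.sum_cons, List.sum_nil] at this
  linarith [h.bond cx h1, h.bond cy h2, h.bond cz h3, h.bond xx' h4, h.bond yy' h5, h.bond zz' h6,
    h.nonpos cx', h.nonpos cy', h.nonpos cz', h.nonpos xy, h.nonpos xz, h.nonpos xy', h.nonpos xz',
    h.nonpos yz, h.nonpos yx', h.nonpos yz', h.nonpos zx', h.nonpos zy', h.nonpos x'y',
    h.nonpos x'z', h.nonpos y'z']

/-- Add the nodes one at a time, each bonded to an earlier one: the square norm grows by at most `1
- 2 * (1 / 2) = 0`. A maximal set of nodes whose sum has norm at most one is therefore everything.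
-/
theorem inner_sum_self_le (i₀ : ι) : ⟪∑ i, α i, ∑ i, α i⟫ ≤ 1 := by
  classical
  obtain ⟨S, hS, hmax⟩ := Finset.exists_max_image
    (Finset.univ.filter fun S : Finset ι => i₀ ∈ S ∧ ⟪∑ i ∈ S, α i, ∑ i ∈ S, α i⟫ ≤ 1)
    Finset.card ⟨{i₀}, by
      rw [Finset.mem_filter, Finset.sum_singleton, h.norm]
      exact ⟨Finset.mem_univ _, Finset.mem_singleton_self _, le_rfl⟩⟩
  rw [Finset.mem_filter] at hS
  obtain ⟨-, h0, hle⟩ := hS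
  suffices hu : S = Finset.univ by rwa [hu] at hle
  by_contra hu
  obtain ⟨i, hi, j, hj, hij⟩ := h.conn S ⟨i₀, h0⟩ (by
    by_contra! hall; exact hu (Finset.eq_univ_iff_forall.mpr hall))
  have hne (k : ι) (hk : k ∈ S) : j ≠ k := fun e => hj (e ▸ hk)
  have h1 : ⟪α j, ∑ k ∈ S, α k⟫ ≤ -(1 / 2) := by
    rw [inner_sum, ← Finset.add_sum_erase _ _ hi]
    have e1 := h.bond (hne i hi) (by rwa [real_inner_comm])
    have e2 : ∑ k ∈ S.erase i, ⟪α j, α k⟫ ≤ 0 :=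
      Finset.sum_nonpos fun k hk => h.nonpos (hne k (Finset.mem_of_mem_erase hk))
    linarith
  have := hmax (insert j S) (by
    rw [Finset.mem_filter]
    refine ⟨Finset.mem_univ _, Finset.mem_insert_of_mem h0, ?_⟩
    rw [Finset.sum_insert hj, inner_add_left, inner_add_right, inner_add_right, h.norm,
      real_inner_comm (α j) (∑ k ∈ S, α k)]
    linarith)
  rw [Finset.card_insert_of_notMem hj] at this
  omega

/-- Two forks exclude each other: `α f` and `α g` each carry two leaves. -/
theorem no_double_fork {f g x x' y y' : ι} (hd : [x, x', y, y'].Nodup)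
    (hx : ∀ i, i ≠ x → i ≠ f → ⟪α x, α i⟫ = 0) (hx' : ∀ i, i ≠ x' → i ≠ f → ⟪α x', α i⟫ = 0)
    (hy : ∀ i, i ≠ y → i ≠ g → ⟪α y, α i⟫ = 0) (hy' : ∀ i, i ≠ y' → i ≠ g → ⟪α y', α i⟫ = 0)
    (xf : x ≠ f) (xf' : x' ≠ f) (yf : y ≠ f) (yf' : y' ≠ f)
    (xg : x ≠ g) (xg' : x' ≠ g) (yg : y ≠ g) (yg' : y' ≠ g)
    (h1 : ⟪α x, α f⟫ = -(1 / 2)) (h2 : ⟪α x', α f⟫ = -(1 / 2))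
    (h3 : ⟪α y, α g⟫ = -(1 / 2)) (h4 : ⟪α y', α g⟫ = -(1 / 2)) : False := by
  classical
  simp only [List.nodup_cons, List.mem_cons, List.not_mem_nil, or_false, not_or] at hd
  obtain ⟨⟨xx', xy, xy'⟩, ⟨x'y, x'y'⟩, yy', -⟩ := hd
  have key (x f : ι) (hxf : x ≠ f) (H : ∀ i, i ≠ x → i ≠ f → ⟪α x, α i⟫ = 0)
      (he : ⟪α x, α f⟫ = -(1 / 2)) : ⟪α x, ∑ i, α i⟫ = 1 / 2 := by
    rw [inner_sum, ← Finset.add_sum_erase _ _ (Finset.mem_univ x),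
      ← Finset.add_sum_erase _ _ (Finset.mem_erase.mpr ⟨hxf.symm, Finset.mem_univ f⟩), h.norm, he,
      Finset.sum_eq_zero]
    · norm_num
    · intro i hi
      simp only [Finset.mem_erase, Finset.mem_univ, and_true] at hi
      exact H i hi.2 hi.1
  have kx := key x f xf hx h1
  have kx' := key x' f xf' hx' h2
  have ky := key y g yg hy h3
  have ky' := key y' g yg' hy' h4
  have hs := h.inner_sum_self_le x
  set s := ∑ i, α i with hsdef
  set X := α x + α x' + α y + α y' with hX
  have hXX : ⟪X, X⟫ = 4 := by
    simp only [hX, inner_add_left, inner_add_right, h.norm, hx x' (Ne.symm xx') xf', hx y (Ne.symm xy) yf,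
      hx y' (Ne.symm xy') yf', hx' x xx' xf, hx' y (Ne.symm x'y) yf, hx' y' (Ne.symm x'y') yf', hy x xy xg,
      hy x' x'y xg', hy y' (Ne.symm yy') yg', hy' x xy' xg, hy' x' x'y' xg', hy' y yy' yg]
    norm_num
  have hXs : ⟪X, s⟫ = 2 := by
    simp only [hX, inner_add_left, kx, kx', ky, ky']; norm_num
  -- Coefficient 1 at the four leaves and 2 elsewhere, as in affine D of any rank. The square norm
  -- is at most `4 - 8 + 4 = 0`, and the part between the forks need not be known.
  have hpos : 0 < ⟪(2 : ℝ) • s - X, (2 : ℝ) • s - X⟫ := by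
    apply real_inner_self_pos.mpr
    intro h0
    have e := congrArg (fun v => α.repr v x) h0
    simp [hsdef, hX, Finsupp.single_apply, Ne.symm xx', Ne.symm xy, Ne.symm xy'] at e
    norm_num at e
  rw [inner_sub_left, inner_sub_right, inner_sub_right, inner_smul_left, inner_smul_left,
    inner_smul_right, inner_smul_right, hXX, real_inner_comm X s, hXs] at hpos
  simp only [conj_trivial] at hpos
  linarith

end IsDiagram

end Diagram
end ReflectionGroup

/-! ### Connected diagrams with a three-cycle or double transposition symmetry. -/

namespace ReflectionGroup
variable {n : ℕ}

section Realizes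
variable {ι κ : Type*} [Fintype ι]

/-- After a relabelling of its members, `α` realizes the Coxeter matrix `M`. -/
def Realizes (α : Module.Basis ι ℝ (Euc n)) (M : CoxeterMatrix κ) : Prop :=
  ∃ f : κ ≃ ι, ∀ i j, ⟪α (f i), α (f j)⟫ = -Real.cos (Real.pi / (M i j : ℝ))

theorem eq_cos_of_two {m : ℕ} (hm : m = 2) {t : ℝ} (ht : t = 0) :
    t = -Real.cos (Real.pi / (m : ℝ)) := by
  subst hm ht; simp

theorem eq_cos_of_three {m : ℕ} (hm : m = 3) {t : ℝ} (ht : t = -(1 / 2)) :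
    t = -Real.cos (Real.pi / (m : ℝ)) := by
  subst hm ht; simp

theorem eq_cos_of_four {m : ℕ} (hm : m = 4) {t : ℝ} (ht : t = -(√2 / 2)) :
    t = -Real.cos (Real.pi / (m : ℝ)) := by
  subst hm ht; simp

theorem realizes_of_lt {k : ℕ} {α : Module.Basis ι ℝ (Euc n)} (hα : ∀ i, ⟪α i, α i⟫ = 1)
    (M : CoxeterMatrix (Fin k)) (f : Fin k → ι) (hf : Function.Injective f)
    (hf' : Function.Surjective f)
    (H : ∀ i j, i < j → ⟪α (f i), α (f j)⟫ = -Real.cos (Real.pi / (M i j : ℝ))) :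
    Realizes α M := by
  refine ⟨Equiv.ofBijective f ⟨hf, hf'⟩, fun i j => ?_⟩
  change ⟪α (f i), α (f j)⟫ = _
  rcases lt_trichotomy i j with hij | rfl | hij
  · exact H i j hij
  · rw [hα, M.diagonal]; simp
  · rw [real_inner_comm, H j i hij, M.symmetric]

theorem realizes_four {α : Module.Basis ι ℝ (Euc n)} (hα : ∀ i, ⟪α i, α i⟫ = 1)
    (M : CoxeterMatrix (Fin 4)) {a b c d : ι} (hd : [a, b, c, d].Nodup)
    (hs : ∀ i, i = a ∨ i = b ∨ i = c ∨ i = d)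
    (h01 : ⟪α a, α b⟫ = -Real.cos (Real.pi / (M 0 1 : ℝ)))
    (h02 : ⟪α a, α c⟫ = -Real.cos (Real.pi / (M 0 2 : ℝ)))
    (h03 : ⟪α a, α d⟫ = -Real.cos (Real.pi / (M 0 3 : ℝ)))
    (h12 : ⟪α b, α c⟫ = -Real.cos (Real.pi / (M 1 2 : ℝ)))
    (h13 : ⟪α b, α d⟫ = -Real.cos (Real.pi / (M 1 3 : ℝ)))
    (h23 : ⟪α c, α d⟫ = -Real.cos (Real.pi / (M 2 3 : ℝ))) : Realizes α M := by
  refine realizes_of_lt hα M [a, b, c, d].get (List.nodup_iff_injective_get.mp hd) ?_ ?_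
  · intro i
    rcases hs i with rfl | rfl | rfl | rfl
    exacts [⟨0, rfl⟩, ⟨1, rfl⟩, ⟨2, rfl⟩, ⟨3, rfl⟩]
  · intro i j hij
    fin_cases i <;> fin_cases j <;> first
      | exact absurd hij (by decide) | exact h01 | exact h02 | exact h03 | exact h12 | exact h13
      | exact h23

theorem realizes_five {α : Module.Basis ι ℝ (Euc n)} (hα : ∀ i, ⟪α i, α i⟫ = 1)
    (M : CoxeterMatrix (Fin 5)) {a b c d e : ι} (hd : [a, b, c, d, e].Nodup)
    (hs : ∀ i, i = a ∨ i = b ∨ i = c ∨ i = d ∨ i = e)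
    (h01 : ⟪α a, α b⟫ = -Real.cos (Real.pi / (M 0 1 : ℝ)))
    (h02 : ⟪α a, α c⟫ = -Real.cos (Real.pi / (M 0 2 : ℝ)))
    (h03 : ⟪α a, α d⟫ = -Real.cos (Real.pi / (M 0 3 : ℝ)))
    (h04 : ⟪α a, α e⟫ = -Real.cos (Real.pi / (M 0 4 : ℝ)))
    (h12 : ⟪α b, α c⟫ = -Real.cos (Real.pi / (M 1 2 : ℝ)))
    (h13 : ⟪α b, α d⟫ = -Real.cos (Real.pi / (M 1 3 : ℝ)))
    (h14 : ⟪α b, α e⟫ = -Real.cos (Real.pi / (M 1 4 : ℝ)))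
    (h23 : ⟪α c, α d⟫ = -Real.cos (Real.pi / (M 2 3 : ℝ)))
    (h24 : ⟪α c, α e⟫ = -Real.cos (Real.pi / (M 2 4 : ℝ)))
    (h34 : ⟪α d, α e⟫ = -Real.cos (Real.pi / (M 3 4 : ℝ))) : Realizes α M := by
  refine realizes_of_lt hα M [a, b, c, d, e].get (List.nodup_iff_injective_get.mp hd) ?_ ?_
  · intro i
    rcases hs i with rfl | rfl | rfl | rfl | rfl
    exacts [⟨0, rfl⟩, ⟨1, rfl⟩, ⟨2, rfl⟩, ⟨3, rfl⟩, ⟨4, rfl⟩]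
  · intro i j hij
    fin_cases i <;> fin_cases j <;> first
      | exact absurd hij (by decide) | exact h01 | exact h02 | exact h03 | exact h04 | exact h12
      | exact h13 | exact h14 | exact h23 | exact h24 | exact h34

theorem realizes_six {α : Module.Basis ι ℝ (Euc n)} (hα : ∀ i, ⟪α i, α i⟫ = 1)
    (M : CoxeterMatrix (Fin 6)) {a b c d e f : ι} (hd : [a, b, c, d, e, f].Nodup)
    (hs : ∀ i, i = a ∨ i = b ∨ i = c ∨ i = d ∨ i = e ∨ i = f)
    (h01 : ⟪α a, α b⟫ = -Real.cos (Real.pi / (M 0 1 : ℝ)))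
    (h02 : ⟪α a, α c⟫ = -Real.cos (Real.pi / (M 0 2 : ℝ)))
    (h03 : ⟪α a, α d⟫ = -Real.cos (Real.pi / (M 0 3 : ℝ)))
    (h04 : ⟪α a, α e⟫ = -Real.cos (Real.pi / (M 0 4 : ℝ)))
    (h05 : ⟪α a, α f⟫ = -Real.cos (Real.pi / (M 0 5 : ℝ)))
    (h12 : ⟪α b, α c⟫ = -Real.cos (Real.pi / (M 1 2 : ℝ)))
    (h13 : ⟪α b, α d⟫ = -Real.cos (Real.pi / (M 1 3 : ℝ)))
    (h14 : ⟪α b, α e⟫ = -Real.cos (Real.pi / (M 1 4 : ℝ)))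
    (h15 : ⟪α b, α f⟫ = -Real.cos (Real.pi / (M 1 5 : ℝ)))
    (h23 : ⟪α c, α d⟫ = -Real.cos (Real.pi / (M 2 3 : ℝ)))
    (h24 : ⟪α c, α e⟫ = -Real.cos (Real.pi / (M 2 4 : ℝ)))
    (h25 : ⟪α c, α f⟫ = -Real.cos (Real.pi / (M 2 5 : ℝ)))
    (h34 : ⟪α d, α e⟫ = -Real.cos (Real.pi / (M 3 4 : ℝ)))
    (h35 : ⟪α d, α f⟫ = -Real.cos (Real.pi / (M 3 5 : ℝ)))
    (h45 : ⟪α e, α f⟫ = -Real.cos (Real.pi / (M 4 5 : ℝ))) : Realizes α M := by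
  refine realizes_of_lt hα M [a, b, c, d, e, f].get (List.nodup_iff_injective_get.mp hd) ?_ ?_
  · intro i
    rcases hs i with rfl | rfl | rfl | rfl | rfl | rfl
    exacts [⟨0, rfl⟩, ⟨1, rfl⟩, ⟨2, rfl⟩, ⟨3, rfl⟩, ⟨4, rfl⟩, ⟨5, rfl⟩]
  · intro i j hij
    fin_cases i <;> fin_cases j <;> first
      | exact absurd hij (by decide) | exact h01 | exact h02 | exact h03 | exact h04 | exact h05
      | exact h12 | exact h13 | exact h14 | exact h15 | exact h23 | exact h24 | exact h25
      | exact h34 | exact h35 | exact h45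

/-- `α` realizes the Coxeter matrix of type `A₄`, `D₄`, `F₄`, `A₅` or `E₆`. -/
def RealizesExtendable (α : Module.Basis ι ℝ (Euc n)) : Prop :=
  Realizes α (CoxeterMatrix.A 4) ∨ Realizes α coxeterMatrixD4 ∨ Realizes α CoxeterMatrix.F₄ ∨
    Realizes α (CoxeterMatrix.A 5) ∨ Realizes α CoxeterMatrix.E₆

end Realizes

namespace IsDiagram
variable {ι : Type*} [Fintype ι] {α : Module.Basis ι ℝ (Euc n)} {σ : Equiv.Perm ι}

/-- The three moved nodes are pairwise orthogonal, or they would form a triangle. By connectedness a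
fixed node `f` is joined to one of them, hence to all three. A further node would create a four-star
at `f` or a square, and a bond label above three would make two heavy bonds at `f`. -/
theorem realizes_of_threeCycle (h : IsDiagram α) (hσ : ∀ i j, ⟪α (σ i), α (σ j)⟫ = ⟪α i, α j⟫)
    {x y z : ι} (hc : IsThreeCycleOn σ x y z) : Realizes α coxeterMatrixD4 := by
  classical
  obtain ⟨xy, yz, zx, hx, hy, hz, hfix⟩ := hc
  have e1 : ⟪α y, α z⟫ = ⟪α x, α y⟫ := by rw [← hσ x y, hx, hy]
  have e2 : ⟪α z, α x⟫ = ⟪α x, α y⟫ := by rw [← e1, ← hσ y z, hy, hz]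
  have e2' : ⟪α x, α z⟫ = ⟪α x, α y⟫ := by rw [real_inner_comm, e2]
  have h0 : ⟪α x, α y⟫ = 0 := by
    by_contra hne
    exact h.no_triangle (x := x) (y := y) (z := z) (by simp [*, Ne.symm zx]) hne (by rwa [e1])
      (by rwa [e2'])
  have hf1 (f : ι) (fx : f ≠ x) (fy : f ≠ y) (fz : f ≠ z) : ⟪α f, α y⟫ = ⟪α f, α x⟫ := by
    rw [← hσ f x, hfix f fx fy fz, hx]
  have hf2 (f : ι) (fx : f ≠ x) (fy : f ≠ y) (fz : f ≠ z) : ⟪α f, α z⟫ = ⟪α f, α x⟫ := by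
    rw [← hf1 f fx fy fz, ← hσ f y, hfix f fx fy fz, hy]
  obtain ⟨f, fx, fy, fz, hne⟩ : ∃ f, f ≠ x ∧ f ≠ y ∧ f ≠ z ∧ ⟪α f, α x⟫ ≠ 0 := by
    obtain ⟨i, hi, f, hf, hif⟩ := h.conn {x} ⟨x, by simp⟩ ⟨y, by simp [Ne.symm xy]⟩
    obtain rfl := Finset.mem_singleton.mp hi
    refine ⟨f, by simpa using hf, ?_, ?_, by rwa [real_inner_comm]⟩
    · rintro rfl; exact hif h0
    · rintro rfl; exact hif (by rw [e2', h0])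
  have hall : ∀ i, i = x ∨ i = f ∨ i = y ∨ i = z := by
    by_contra! hex
    obtain ⟨j₀, j1, j2, j3, j4⟩ := hex
    obtain ⟨i, hi, g, hg, hig⟩ := h.conn {x, y, z, f} ⟨x, by simp⟩ ⟨j₀, by simp [*]⟩
    simp only [Finset.mem_insert, Finset.mem_singleton, not_or] at hi hg
    obtain ⟨gx, gy, gz, gf⟩ := hg
    by_cases hgx : ⟪α g, α x⟫ = 0
    · rcases hi with rfl | rfl | rfl | rfl
      · exact hig (by rw [real_inner_comm, hgx])
      · exact hig (by rw [real_inner_comm, hf1 g gx gy gz, hgx])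
      · exact hig (by rw [real_inner_comm, hf2 g gx gy gz, hgx])
      · exact h.no_four_star (c := i) (x := x) (y := y) (z := z) (w := g)
          (by simp [*, Ne.symm zx, Ne.symm gx, Ne.symm gy, Ne.symm gz, Ne.symm gf]) hne
          (by rwa [hf1 i fx fy fz]) (by rwa [hf2 i fx fy fz]) hig
    · exact h.no_square (x := f) (y := x) (z := g) (w := y)
        (by simp [*, Ne.symm gx, Ne.symm gf]) hne (by rwa [real_inner_comm])
        (by rwa [hf1 g gx gy gz]) (by rwa [hf1 f fx fy fz])
  have hval : ⟪α f, α x⟫ = -(1 / 2) := by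
    refine (h.bond_cases fx hne).resolve_right fun hle => ?_
    exact h.no_two_heavy (c := f) (x := x) (y := y) (by simp [*]) hle (by rwa [hf1 f fx fy fz])
  exact realizes_four h.norm _ (a := x) (b := f) (c := y) (d := z)
    (by simp [*, Ne.symm fx, Ne.symm zx]) hall
    (eq_cos_of_three (by decide) (by rw [real_inner_comm, hval]))
    (eq_cos_of_two (by decide) h0) (eq_cos_of_two (by decide) (by rw [e2', h0]))
    (eq_cos_of_three (by decide) (by rw [hf1 f fx fy fz, hval]))
    (eq_cos_of_three (by decide) (by rw [hf2 f fx fy fz, hval]))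
    (eq_cos_of_two (by decide) (by rw [e1, h0]))

/-- The diagram is the path `y`, `x`, `x'`, `y'`. The outer bonds agree by symmetry and so cannot
both be heavy; the middle one is labelled three (A₄) or four (F₄). -/
theorem realizes_of_path (h : IsDiagram α) (hσ : ∀ i j, ⟪α (σ i), α (σ j)⟫ = ⟪α i, α j⟫)
    {x x' y y' : ι} (hc : IsDoubleSwapOn σ x x' y y') (hall : ∀ i, i = x ∨ i = x' ∨ i = y ∨ i = y')
    (hs : ⟪α x, α y'⟫ = 0) (hr : ⟪α x, α y⟫ ≠ 0) (hp : ⟪α x, α x'⟫ ≠ 0)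
    (hq : ⟪α y, α y'⟫ = 0) : RealizesExtendable α := by
  obtain ⟨xx', xy, xy', x'y, x'y', yy', hx, hx', hy, hy', -⟩ := hc
  have hr' : ⟪α x', α y'⟫ = ⟪α x, α y⟫ := by rw [← hσ x y, hx, hy]
  have hs' : ⟪α x', α y⟫ = 0 := by rw [← hs, ← hσ x y', hx, hy']
  have hd : [y, x, x', y'].Nodup := by simp [*, Ne.symm xy, Ne.symm x'y]
  have hval : ⟪α x, α y⟫ = -(1 / 2) := by
    refine (h.bond_cases xy hr).resolve_right fun hle => ?_
    exact h.no_heavy_ends_four hd (by rwa [real_inner_comm]) hp (by rwa [hr'])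
  have hall' : ∀ i, i = y ∨ i = x ∨ i = x' ∨ i = y' := by
    intro i; rcases hall i with h | h | h | h <;> simp [h]
  have e1 : ⟪α y, α x⟫ = -(1 / 2) := by rw [real_inner_comm, hval]
  have e2 : ⟪α y, α x'⟫ = 0 := by rw [real_inner_comm, hs']
  rcases h.val x x' xx' with h1 | h1 | h1 | h1
  · exact absurd h1 hp
  · left
    exact realizes_four h.norm _ hd hall' (eq_cos_of_three (by decide) e1)
      (eq_cos_of_two (by decide) e2) (eq_cos_of_two (by decide) hq)
      (eq_cos_of_three (by decide) h1) (eq_cos_of_two (by decide) hs)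
      (eq_cos_of_three (by decide) (by rw [hr', hval]))
  · right; right; left
    exact realizes_four h.norm _ hd hall' (eq_cos_of_three (by decide) e1)
      (eq_cos_of_two (by decide) e2) (eq_cos_of_two (by decide) hq)
      (eq_cos_of_four (by decide) h1) (eq_cos_of_two (by decide) hs)
      (eq_cos_of_three (by decide) (by rw [hr', hval]))
  · exact (h.no_heavy_middle hd (by rwa [real_inner_comm]) h1 (by rwa [hr'])).elim

/-- The fixed node `f` is joined to `x` and `x'`. A fixed node joined to `y` and `y'` would give a
four-star, a double fork or a hexagon. So `y` hangs on `x`, and `y`, `x`, `f`, `x'`, `y'` form a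
path: this is A₅, unless another node `g` hangs on `f`, which gives E₆. Anything more is a four-star
at `f` or affine E₆. -/
theorem realizes_of_fixed (h : IsDiagram α) (hσ : ∀ i j, ⟪α (σ i), α (σ j)⟫ = ⟪α i, α j⟫)
    {x x' y y' : ι} (hc : IsDoubleSwapOn σ x x' y y') (hs : ⟪α x, α y'⟫ = 0) {f : ι}
    (fx : f ≠ x) (fx' : f ≠ x') (fy : f ≠ y) (fy' : f ≠ y') (hfx : ⟪α f, α x⟫ ≠ 0) :
    RealizesExtendable α := by
  classical
  obtain ⟨xx', xy, xy', x'y, x'y', yy', hx, hx', hy, hy', hfix⟩ := hc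
  have hr' : ⟪α x', α y'⟫ = ⟪α x, α y⟫ := by rw [← hσ x y, hx, hy]
  have hs' : ⟪α x', α y⟫ = 0 := by rw [← hs, ← hσ x y', hx, hy']
  have gx' (g : ι) (h1 : g ≠ x) (h2 : g ≠ x') (h3 : g ≠ y) (h4 : g ≠ y') :
      ⟪α g, α x'⟫ = ⟪α g, α x⟫ := by rw [← hσ g x, hfix g h1 h2 h3 h4, hx]
  have gy' (g : ι) (h1 : g ≠ x) (h2 : g ≠ x') (h3 : g ≠ y) (h4 : g ≠ y') :
      ⟪α g, α y'⟫ = ⟪α g, α y⟫ := by rw [← hσ g y, hfix g h1 h2 h3 h4, hy]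
  have hfx' : ⟪α f, α x'⟫ = ⟪α f, α x⟫ := gx' f fx fx' fy fy'
  have hp : ⟪α x, α x'⟫ = 0 := by
    by_contra hp
    exact h.no_triangle (x := f) (y := x) (z := x') (by simp [*]) hfx hp (by rwa [hfx'])
  have hux (g : ι) (h1 : g ≠ x) (h2 : g ≠ x') (h3 : g ≠ y) (h4 : g ≠ y') (hgf : g ≠ f) :
      ⟪α g, α x⟫ = 0 := by
    by_contra hne
    exact h.no_square (x := f) (y := x) (z := g) (w := x')
      (by simp [*, Ne.symm hgf, Ne.symm h1]) hfx (by rwa [real_inner_comm])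
      (by rwa [gx' g h1 h2 h3 h4]) (by rwa [hfx'])
  have hvf : ⟪α f, α x⟫ = -(1 / 2) := by
    refine (h.bond_cases fx hfx).resolve_right fun hle => ?_
    exact h.no_two_heavy (c := f) (x := x) (y := x') (by simp [*]) hle (by rwa [hfx'])
  have hny (g : ι) (h1 : g ≠ x) (h2 : g ≠ x') (h3 : g ≠ y) (h4 : g ≠ y') : ⟪α g, α y⟫ = 0 := by
    by_contra hgy
    have hgy' : ⟪α g, α y'⟫ = ⟪α g, α y⟫ := gy' g h1 h2 h3 h4
    have hq : ⟪α y, α y'⟫ = 0 := by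
      by_contra hq
      exact h.no_triangle (x := g) (y := y) (z := y') (by simp [*]) hgy hq (by rwa [hgy'])
    by_cases hgf : g = f
    · subst hgf
      exact h.no_four_star (c := g) (x := x) (y := x') (z := y) (w := y') (by simp [*]) hfx
        (by rwa [hfx']) hgy (by rwa [hgy'])
    by_cases hr : ⟪α x, α y⟫ = 0
    · have hvg : ⟪α g, α y⟫ = -(1 / 2) := by
        refine (h.bond_cases h3 hgy).resolve_right fun hle => ?_
        exact h.no_two_heavy (c := g) (x := y) (y := y') (by simp [*]) hle (by rwa [hgy'])
      have huy (k : ι) (k1 : k ≠ x) (k2 : k ≠ x') (k3 : k ≠ y) (k4 : k ≠ y') (hkg : k ≠ g) :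
          ⟪α k, α y⟫ = 0 := by
        by_contra hne
        exact h.no_square (x := g) (y := y) (z := k) (w := y')
          (by simp [*, Ne.symm hkg, Ne.symm k3]) hgy (by rwa [real_inner_comm])
          (by rwa [gy' k k1 k2 k3 k4]) (by rwa [hgy'])
      refine h.no_double_fork (f := f) (g := g) (x := x) (x' := x') (y := y) (y' := y')
        (by simp [*]) ?_ ?_ ?_ ?_ (Ne.symm fx) (Ne.symm fx') (Ne.symm fy) (Ne.symm fy')
        (Ne.symm h1) (Ne.symm h2) (Ne.symm h3) (Ne.symm h4)
        (by rw [real_inner_comm, hvf]) (by rw [real_inner_comm, hfx', hvf])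
        (by rw [real_inner_comm, hvg]) (by rw [real_inner_comm, hgy', hvg])
      · intro i ix jf
        by_cases ix' : i = x'; · rw [ix', hp]
        by_cases iy : i = y; · rw [iy, hr]
        by_cases iy' : i = y'; · rw [iy', hs]
        rw [real_inner_comm, hux i ix ix' iy iy' jf]
      · intro i ix' jf
        by_cases ix : i = x; · rw [ix, real_inner_comm, hp]
        by_cases iy : i = y; · rw [iy, hs']
        by_cases iy' : i = y'; · rw [iy', hr', hr]
        rw [real_inner_comm, gx' i ix ix' iy iy', hux i ix ix' iy iy' jf]
      · intro i iy jg
        by_cases ix : i = x; · rw [ix, real_inner_comm, hr]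
        by_cases ix' : i = x'; · rw [ix', real_inner_comm, hs']
        by_cases iy' : i = y'; · rw [iy', hq]
        rw [real_inner_comm, huy i ix ix' iy iy' jg]
      · intro i iy' jg
        by_cases ix : i = x; · rw [ix, real_inner_comm, hs]
        by_cases ix' : i = x'; · rw [ix', real_inner_comm, hr', hr]
        by_cases iy : i = y; · rw [iy, real_inner_comm, hq]
        rw [real_inner_comm, gy' i ix ix' iy iy', huy i ix ix' iy iy' jg]
    · exact h.no_hexagon (a := f) (b := x) (c := y) (d := g) (e := y') (f := x')
        (by simp [*, Ne.symm hgf, Ne.symm h1, Ne.symm h3, Ne.symm x'y, Ne.symm x'y']) hfx hr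
        (by rwa [real_inner_comm]) (by rwa [hgy']) (by rwa [real_inner_comm, hr']) (by rwa [hfx'])
  have hny' (g : ι) (h1 : g ≠ x) (h2 : g ≠ x') (h3 : g ≠ y) (h4 : g ≠ y') : ⟪α g, α y'⟫ = 0 := by
    rw [gy' g h1 h2 h3 h4, hny g h1 h2 h3 h4]
  have hr : ⟪α x, α y⟫ ≠ 0 := by
    obtain ⟨i, hi, j, hj, hij⟩ := h.conn {y, y'} ⟨y, by simp⟩ ⟨x, by simp [*]⟩
    simp only [Finset.mem_insert, Finset.mem_singleton, not_or] at hi hj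
    intro hr
    apply hij
    rw [real_inner_comm]
    by_cases jx : j = x
    · rcases hi with rfl | rfl
      · rw [jx, hr]
      · rw [jx, hs]
    by_cases jx' : j = x'
    · rcases hi with rfl | rfl
      · rw [jx', hs']
      · rw [jx', hr', hr]
    rcases hi with rfl | rfl
    · exact hny j jx jx' hj.1 hj.2
    · exact hny' j jx jx' hj.1 hj.2
  have hq : ⟪α y, α y'⟫ = 0 := by
    by_contra hq
    exact h.no_pentagon (a := f) (b := x) (c := y) (d := y') (e := x')
      (by simp [*, Ne.symm x'y, Ne.symm x'y']) hfx hr hq (by rwa [real_inner_comm, hr'])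
      (by rwa [hfx'])
  have hd : [y, x, f, x', y'].Nodup := by
    simp [*, Ne.symm xy, Ne.symm x'y, Ne.symm fx, Ne.symm fy]
  have hvr : ⟪α x, α y⟫ = -(1 / 2) := by
    refine (h.bond_cases xy hr).resolve_right fun hle => ?_
    exact h.no_heavy_ends_five hd (by rwa [real_inner_comm]) (by rwa [real_inner_comm])
      (by rwa [hfx']) (by rwa [hr'])
  by_cases hall : ∀ i, i = y ∨ i = x ∨ i = f ∨ i = x' ∨ i = y'
  · right; right; right; left
    exact realizes_five h.norm _ hd hall
      (eq_cos_of_three (by decide) (by rw [real_inner_comm, hvr]))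
      (eq_cos_of_two (by decide) (by rw [real_inner_comm, hny f fx fx' fy fy']))
      (eq_cos_of_two (by decide) (by rw [real_inner_comm, hs']))
      (eq_cos_of_two (by decide) hq)
      (eq_cos_of_three (by decide) (by rw [real_inner_comm, hvf]))
      (eq_cos_of_two (by decide) hp)
      (eq_cos_of_two (by decide) hs)
      (eq_cos_of_three (by decide) (by rw [hfx', hvf]))
      (eq_cos_of_two (by decide) (hny' f fx fx' fy fy'))
      (eq_cos_of_three (by decide) (by rw [hr', hvr]))
  push Not at hall
  obtain ⟨j₀, j1, j2, j3, j4, j5⟩ := hall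
  obtain ⟨i, hi, g, hg, hig⟩ := h.conn {y, x, f, x', y'} ⟨y, by simp⟩ ⟨j₀, by simp [*]⟩
  simp only [Finset.mem_insert, Finset.mem_singleton, not_or] at hi hg
  obtain ⟨gy, gx, gf, hgx', hgy'⟩ := hg
  have zgx := hux g gx hgx' gy hgy' gf
  have zgy := hny g gx hgx' gy hgy'
  have hfg : ⟪α f, α g⟫ ≠ 0 := by
    rcases hi with rfl | rfl | rfl | rfl | rfl
    · exact absurd (by rw [real_inner_comm, zgy]) hig
    · exact absurd (by rw [real_inner_comm, zgx]) hig
    · exact hig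
    · exact absurd (by rw [real_inner_comm, gx' g gx hgx' gy hgy', zgx]) hig
    · exact absurd (by rw [real_inner_comm, hny' g gx hgx' gy hgy']) hig
  have hvg : ⟪α f, α g⟫ = -(1 / 2) := by
    refine (h.bond_cases (Ne.symm gf) hfg).resolve_right fun hle => ?_
    exact h.no_heavy_three_star (c := f) (x := x) (y := x') (z := g)
      (by simp [*, Ne.symm gf, Ne.symm gx, Ne.symm hgx']) hfx (by rwa [hfx']) hle
  have hall : ∀ i, i = y ∨ i = g ∨ i = x ∨ i = f ∨ i = x' ∨ i = y' := by
    by_contra! hex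
    obtain ⟨k₀, k1, k2, k3, k4, k5, k6⟩ := hex
    obtain ⟨i, hi, k, hk, hik⟩ := h.conn {y, g, x, f, x', y'} ⟨y, by simp⟩ ⟨k₀, by simp [*]⟩
    simp only [Finset.mem_insert, Finset.mem_singleton, not_or] at hi hk
    obtain ⟨ky, kg, kx, kf, kx', ky'⟩ := hk
    have zkx := hux k kx kx' ky ky' kf
    rcases hi with rfl | rfl | rfl | rfl | rfl | rfl
    · exact hik (by rw [real_inner_comm, hny k kx kx' ky ky'])
    · exact h.no_long_three_star (c := f) (x := x) (y := x') (z := i) (x' := y) (y' := y') (z' := k)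
        (by simp [*, Ne.symm gf, Ne.symm gx, Ne.symm hgx', Ne.symm kf, Ne.symm kx, Ne.symm kx',
          Ne.symm kg, Ne.symm ky, Ne.symm ky']) hfx (by rwa [hfx']) hfg hr (by rwa [hr']) hik
    · exact hik (by rw [real_inner_comm, zkx])
    · exact h.no_four_star (c := i) (x := x) (y := x') (z := g) (w := k)
        (by simp [*, Ne.symm gf, Ne.symm gx, Ne.symm hgx', Ne.symm kf, Ne.symm kx, Ne.symm kx',
          Ne.symm kg]) hfx (by rwa [hfx']) hfg hik
    · exact hik (by rw [real_inner_comm, gx' k kx kx' ky ky', zkx])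
    · exact hik (by rw [real_inner_comm, hny' k kx kx' ky ky'])
  right; right; right; right
  exact realizes_six h.norm _ (a := y) (b := g) (c := x) (d := f) (e := x') (f := y')
    (by simp [*, Ne.symm xy, Ne.symm x'y, Ne.symm fx, Ne.symm fy, Ne.symm gy]) hall
    (eq_cos_of_two (by decide) (by rw [real_inner_comm, zgy]))
    (eq_cos_of_three (by decide) (by rw [real_inner_comm, hvr]))
    (eq_cos_of_two (by decide) (by rw [real_inner_comm, hny f fx fx' fy fy']))
    (eq_cos_of_two (by decide) (by rw [real_inner_comm, hs']))
    (eq_cos_of_two (by decide) hq)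
    (eq_cos_of_two (by decide) zgx)
    (eq_cos_of_three (by decide) (by rw [real_inner_comm, hvg]))
    (eq_cos_of_two (by decide) (by rw [gx' g gx hgx' gy hgy', zgx]))
    (eq_cos_of_two (by decide) (hny' g gx hgx' gy hgy'))
    (eq_cos_of_three (by decide) (by rw [real_inner_comm, hvf]))
    (eq_cos_of_two (by decide) hp)
    (eq_cos_of_two (by decide) hs)
    (eq_cos_of_three (by decide) (by rw [hfx', hvf]))
    (eq_cos_of_two (by decide) (hny' f fx fx' fy fy'))
    (eq_cos_of_three (by decide) (by rw [hr', hvr]))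

/-- Either a fixed node is joined to a moved one, or by connectedness the four moved nodes are
everything. In the latter case `x` is joined to `y`, and exactly one of the two swapped pairs is
bonded, for otherwise the diagram would be disconnected or contain a square. -/
theorem realizes_of_doubleSwap_aux (h : IsDiagram α)
    (hσ : ∀ i j, ⟪α (σ i), α (σ j)⟫ = ⟪α i, α j⟫) {x x' y y' : ι}
    (hc : IsDoubleSwapOn σ x x' y y') (hs : ⟪α x, α y'⟫ = 0) : RealizesExtendable α := by
  classical
  have hc₀ := hc
  obtain ⟨xx', xy, xy', x'y, x'y', yy', hx, hx', hy, hy', hfix⟩ := hc₀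
  have hr' : ⟪α x', α y'⟫ = ⟪α x, α y⟫ := by rw [← hσ x y, hx, hy]
  have hs' : ⟪α x', α y⟫ = 0 := by rw [← hs, ← hσ x y', hx, hy']
  have hs'' : ⟪α y, α x'⟫ = 0 := by rw [real_inner_comm, hs']
  by_cases h1 : ∃ f, f ≠ x ∧ f ≠ x' ∧ f ≠ y ∧ f ≠ y' ∧ ⟪α f, α x⟫ ≠ 0
  · obtain ⟨f, f1, f2, f3, f4, hf⟩ := h1
    exact h.realizes_of_fixed hσ hc hs f1 f2 f3 f4 hf
  by_cases h2 : ∃ f, f ≠ x ∧ f ≠ x' ∧ f ≠ y ∧ f ≠ y' ∧ ⟪α f, α y⟫ ≠ 0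
  · obtain ⟨f, f1, f2, f3, f4, hf⟩ := h2
    exact h.realizes_of_fixed hσ hc.symm hs'' f3 f4 f1 f2 hf
  push Not at h1 h2
  have hall : ∀ i, i = x ∨ i = x' ∨ i = y ∨ i = y' := by
    by_contra! hex
    obtain ⟨j₀, j1, j2, j3, j4⟩ := hex
    obtain ⟨i, hi, g, hg, hig⟩ := h.conn {x, x', y, y'} ⟨x, by simp⟩ ⟨j₀, by simp [*]⟩
    simp only [Finset.mem_insert, Finset.mem_singleton, not_or] at hi hg
    obtain ⟨g1, g2, g3, g4⟩ := hg
    have zx := h1 g g1 g2 g3 g4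
    have zy := h2 g g1 g2 g3 g4
    have gf := hfix g g1 g2 g3 g4
    apply hig
    rw [real_inner_comm]
    rcases hi with rfl | rfl | rfl | rfl
    · exact zx
    · rw [← zx, ← hσ g x, gf, hx]
    · exact zy
    · rw [← zy, ← hσ g y, gf, hy]
  have hr : ⟪α x, α y⟫ ≠ 0 := by
    intro hr
    obtain ⟨i, hi, j, hj, hij⟩ := h.conn {x, x'} ⟨x, by simp⟩ ⟨y, by simp [*, Ne.symm xy, Ne.symm x'y]⟩
    simp only [Finset.mem_insert, Finset.mem_singleton, not_or] at hi hj
    apply hij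
    rcases hi with rfl | rfl <;> rcases hall j with rfl | rfl | rfl | rfl <;> simp_all
  by_cases hp : ⟪α x, α x'⟫ = 0
  · by_cases hq : ⟪α y, α y'⟫ = 0
    · obtain ⟨i, hi, j, hj, hij⟩ := h.conn {x, y} ⟨x, by simp⟩ ⟨x', by simp [*, Ne.symm xx']⟩
      simp only [Finset.mem_insert, Finset.mem_singleton, not_or] at hi hj
      exfalso
      apply hij
      rcases hi with rfl | rfl <;> rcases hall j with rfl | rfl | rfl | rfl <;> simp_all
    · exact h.realizes_of_path hσ hc.symm
        (fun i => by rcases hall i with h | h | h | h <;> simp [h]) hs''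
        (by rwa [real_inner_comm]) hq hp
  · by_cases hq : ⟪α y, α y'⟫ = 0
    · exact h.realizes_of_path hσ hc hall hs hr hp hq
    · exact (h.no_square (x := x) (y := x') (z := y') (w := y)
        (by simp [*, Ne.symm yy']) hp (by rwa [hr']) (by rwa [real_inner_comm]) hr).elim

/-- `x` cannot be joined to both `y` and `y'`: by symmetry so would `x'`, closing a square.
Interchanging `y` and `y'` reduces to the case that `x` and `y'` are orthogonal. -/
theorem realizes_of_doubleSwap (h : IsDiagram α) (hσ : ∀ i j, ⟪α (σ i), α (σ j)⟫ = ⟪α i, α j⟫)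
    {x x' y y' : ι} (hc : IsDoubleSwapOn σ x x' y y') : RealizesExtendable α := by
  by_cases hs : ⟪α x, α y'⟫ = 0
  · exact h.realizes_of_doubleSwap_aux hσ hc hs
  by_cases hr : ⟪α x, α y⟫ = 0
  · exact h.realizes_of_doubleSwap_aux hσ hc.flip hr
  obtain ⟨xx', xy, xy', x'y, x'y', yy', hx, hx', hy, hy', hfix⟩ := hc
  have hr' : ⟪α x', α y'⟫ = ⟪α x, α y⟫ := by rw [← hσ x y, hx, hy]
  have hs' : ⟪α x', α y⟫ = ⟪α x, α y'⟫ := by rw [← hσ x y', hx, hy']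
  exact (h.no_square (x := x) (y := y) (z := x') (w := y')
    (by simp [*, Ne.symm x'y]) hr (by rwa [real_inner_comm, hs']) (by rwa [hr']) hs).elim

end IsDiagram

theorem SimpleSystem.hasCoxeterType {ι κ : Type} {W : Subgroup (OrthGroup n)}
    {α : Module.Basis ι ℝ (Euc n)} (h : SimpleSystem W α) {M : CoxeterMatrix κ} [Fintype ι]
    (hM : Realizes α M) : HasCoxeterType W M := by
  obtain ⟨f, hf⟩ := hM
  refine ⟨α.reindex f.symm, fun i j => ?_, ?_⟩
  · simpa using hf i j
  · rw [h.eq_closure]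
    congr 1
    ext g
    constructor
    · rintro ⟨i, rfl⟩; exact ⟨f.symm i, by simp⟩
    · rintro ⟨i, rfl⟩; exact ⟨f i, by simp⟩

end ReflectionGroup

/-! ### Irreducibility, and the passage from an extending rotation to the type. -/

namespace ReflectionGroup
variable {n : ℕ}

theorem apply_mem_of_forall_refl {ι : Type*} [Fintype ι] {W : Subgroup (OrthGroup n)}
    {α : Module.Basis ι ℝ (Euc n)} (h : SimpleSystem W α) {U : Submodule ℝ (Euc n)}
    (hU : ∀ i, ∀ v ∈ U, refl (α i) v ∈ U) {g : OrthGroup n} (hg : g ∈ W) {v : Euc n}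
    (hv : v ∈ U) : g v ∈ U := by
  obtain ⟨l, rfl⟩ := h.exists_word hg
  clear hg
  induction l with
  | nil => exact hv
  | cons i l ih =>
    have : word α (i :: l) v = refl (α i) (word α l v) := by simp [word, mul_apply]
    rw [this]
    exact hU i _ ih

/-- The span of the roots is invariant. If it is zero then `W` is trivial and every line is
invariant, which is impossible for `n ≥ 2`; on a line the trivial group does act irreducibly. -/
theorem span_roots_eq_top {W : Subgroup (OrthGroup n)} (hW : IsReflectionGroup W)
    (hirr : ActsIrreducibly W) (hn : 2 ≤ n) : Submodule.span ℝ (roots W) = ⊤ := by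
  refine (hirr.2 _ fun g hg v hv => ?_).resolve_left fun hbot => ?_
  · induction hv using Submodule.span_induction with
    | mem s hs => exact Submodule.subset_span (apply_mem_roots hs hg)
    | zero => rw [map_zero]; exact Submodule.zero_mem _
    | add u v _ _ hu hv => rw [map_add]; exact Submodule.add_mem _ hu hv
    | smul c u _ hu => rw [map_smul]; exact Submodule.smul_mem _ c hu
  · have hempty : roots W = ∅ := by
      by_contra hne
      obtain ⟨v, hv⟩ := Set.nonempty_iff_ne_empty.mpr hne
      have : v ∈ Submodule.span ℝ (roots W) := Submodule.subset_span hv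
      rw [hbot, Submodule.mem_bot] at this
      exact ne_zero_of_norm hv.1 this
    have hone : W = ⊥ := by
      rw [eq_closure_roots hW, hempty, Set.image_empty, Subgroup.closure_empty]
    have hnt : Nontrivial (Euc n) :=
      Module.nontrivial_of_finrank_pos (R := ℝ) (by rw [finrank_euclideanSpace_fin]; omega)
    obtain ⟨v, hv⟩ := exists_ne (0 : Euc n)
    have hfr := finrank_span_singleton (K := ℝ) hv
    rcases hirr.2 (Submodule.span ℝ {v}) (fun g hg u hu => by
      rw [hone, Subgroup.mem_bot] at hg; rw [hg]; exact hu) with h | h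
    · rw [h, finrank_bot] at hfr; omega
    · rw [h, finrank_top, finrank_euclideanSpace_fin] at hfr; omega

theorem isDiagram_of_irreducible {ι : Type*} [Fintype ι] {W : Subgroup (OrthGroup n)}
    (hirr : ActsIrreducibly W) {α : Module.Basis ι ℝ (Euc n)} (h : SimpleSystem W α)
    (hm : ∀ i j, i ≠ j → ∃ m : ℕ, 2 ≤ m ∧ ⟪α i, α j⟫ = -Real.cos (Real.pi / m)) :
    IsDiagram α := by
  refine ⟨fun i => inner_self_of_norm (h.norm i), fun i j hij => ?_, fun S ⟨i₀, hi₀⟩ ⟨j₀, hj₀⟩ => ?_⟩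
  · obtain ⟨m, hm2, he⟩ := hm i j hij
    rw [he]
    rcases Nat.lt_or_ge m 5 with hlt | hge
    · interval_cases m
      · left; simp
      · right; left; simp
      · right; right; left; simp
    · right; right; right
      have hm5 : (5 : ℝ) ≤ m := by exact_mod_cast hge
      -- All labels from five on are covered by one bound, since `cos (π / 5) = (1 + √5) / 4 ≥ 3 /
      -- 4`.
      have h1 : Real.cos (Real.pi / 5) ≤ Real.cos (Real.pi / m) := by
        apply Real.cos_le_cos_of_nonneg_of_le_pi
        · positivity
        · exact div_le_self Real.pi_pos.le (by norm_num)
        · exact div_le_div_of_nonneg_left Real.pi_pos.le (by norm_num) hm5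
      rw [Real.cos_pi_div_five] at h1
      have h2 : (2 : ℝ) ≤ √5 := Real.le_sqrt_of_sq_le (by norm_num)
      linarith
  -- Simple roots orthogonal to all the others span an invariant subspace.
  · by_contra! hno
    have hspan (v : Euc n) (hv : v ∈ Submodule.span ℝ (α '' S)) (j : ι) (hj : j ∉ S) :
        ⟪α j, v⟫ = 0 ∧ α.repr v j = 0 := by
      induction hv using Submodule.span_induction with
      | mem s hs =>
        obtain ⟨i, hi, rfl⟩ := hs
        refine ⟨by rw [real_inner_comm]; exact hno i hi j hj, ?_⟩
        rw [α.repr_self, Finsupp.single_eq_of_ne]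
        rintro rfl; exact hj hi
      | zero => simp
      | add u v _ _ hu hv => simp [inner_add_right, hu, hv]
      | smul c u _ hu => simp [inner_smul_right, hu]
    rcases hirr.2 (Submodule.span ℝ (α '' S)) (fun g hg v hv =>
      apply_mem_of_forall_refl h (fun i v hv => by
        by_cases hi : i ∈ S
        · rw [refl_apply_of_norm (h.norm i)]
          exact Submodule.sub_mem _ hv (Submodule.smul_mem _ _ (Submodule.subset_span ⟨i, hi, rfl⟩))
        · rwa [refl_apply_eq_self_iff.mpr (hspan v hv i hi).1]) hg hv) with hb | ht
    · have : α i₀ ∈ Submodule.span ℝ (α '' S) := Submodule.subset_span ⟨i₀, hi₀, rfl⟩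
      rw [hb, Submodule.mem_bot] at this
      exact α.ne_zero i₀ this
    · have := (hspan (α j₀) (by rw [ht]; trivial) j₀ hj₀).2
      simp at this

theorem hasExtendableType_of_isExtendingRotation {W : Subgroup (OrthGroup n)}
    (hW : IsReflectionGroup W) (hirr : ActsIrreducibly W) {h : OrthGroup n}
    (hh : IsExtendingRotation W h) : HasExtendableType W := by
  have hn : 2 ≤ n := by have := hh.isRotation; unfold IsRotation at this; omega
  obtain ⟨ι, _, α, hα, hm⟩ := exists_simpleSystem hW (span_roots_eq_top hW hirr hn)
  have hd := isDiagram_of_irreducible hirr hα hm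
  obtain ⟨w, -, a, σ, hσ, -, hcase⟩ := exists_perm_of_isExtendingRotation hW hα hh
  have hσ' (i j : ι) : ⟪α (σ i), α (σ j)⟫ = ⟪α i, α j⟫ := by rw [← hσ, ← hσ, inner_map]
  rcases hcase with ⟨x, y, z, hc⟩ | ⟨x, x', y, y', hc⟩
  · exact Or.inr (Or.inl (hα.hasCoxeterType (hd.realizes_of_threeCycle hσ' hc)))
  · rcases hd.realizes_of_doubleSwap hσ' hc with h | h | h | h | h
    · exact Or.inl (hα.hasCoxeterType h)
    · exact Or.inr (Or.inl (hα.hasCoxeterType h))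
    · exact Or.inr (Or.inr (Or.inl (hα.hasCoxeterType h)))
    · exact Or.inr (Or.inr (Or.inr (Or.inl (hα.hasCoxeterType h))))
    · exact Or.inr (Or.inr (Or.inr (Or.inr (hα.hasCoxeterType h))))

end ReflectionGroup

/-! ### Simple systems from integral lattices. -/

namespace ReflectionGroup
variable {n : ℕ}

section Lattice
variable {ι : Type*} [Fintype ι]

/-- The lattice spanned by the vectors `t i • α i`. -/
def scaledLattice (α : Module.Basis ι ℝ (Euc n)) (t : ι → ℝ) : Set (Euc n) :=
  {v | ∀ j, ∃ c : ℤ, α.repr v j = c * t j}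

/-- For nonzero `t`, `h` says that the vectors `t i • α i` have integral Cartan numbers `2⟪β_i, β_j⟫
/ ⟪β_j, β_j⟫`. -/
theorem refl_mem_scaledLattice {α : Module.Basis ι ℝ (Euc n)} (hα : ∀ i, ‖α i‖ = 1) {t : ι → ℝ}
    (h : ∀ i j, ∃ k : ℤ, 2 * t i * ⟪α i, α j⟫ = k * t j) (i : ι) {v : Euc n}
    (hv : v ∈ scaledLattice α t) : refl (α i) v ∈ scaledLattice α t := by
  classical
  intro j
  by_cases hj : j = i
  · subst hj
    choose c hc using hv
    choose k hk using fun l => h l j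
    refine ⟨c j - ∑ l, c l * k l, ?_⟩
    rw [refl_apply_of_norm (hα j), map_sub, map_smul, α.repr_self, Finsupp.sub_apply,
      Finsupp.smul_apply, Finsupp.single_eq_same, smul_eq_mul, mul_one, inner_eq_sum α, hc j,
      Finset.mul_sum]
    push_cast
    rw [sub_mul, Finset.sum_mul]
    congr 1
    refine Finset.sum_congr rfl fun l _ => ?_
    rw [mul_assoc, ← hk, hc, real_inner_comm]
    ring
  · obtain ⟨c, hc⟩ := hv j
    exact ⟨c, by rw [repr_refl (hα i) v hj, hc]⟩

theorem inner_self_int_of_mem_scaledLattice {α : Module.Basis ι ℝ (Euc n)}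
    (hα : ∀ i, ‖α i‖ = 1) {t : ι → ℝ} (ht : ∀ i, ∃ k : ℤ, t i * t i = k)
    (h : ∀ i j, ∃ k : ℤ, 2 * t i * ⟪α i, α j⟫ = k * t j) {v : Euc n}
    (hv : v ∈ scaledLattice α t) : ∃ k : ℤ, ⟪v, v⟫ = k := by
  classical
  choose c hc using hv
  choose s hs using ht
  choose k hk using h
  suffices H : ∀ S : Finset ι, ∃ m : ℤ, ⟪∑ i ∈ S, α.repr v i • α i, ∑ i ∈ S, α.repr v i • α i⟫ = m by
    obtain ⟨m, hm⟩ := H Finset.univ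
    rw [α.sum_repr] at hm
    exact ⟨m, hm⟩
  intro S
  induction S using Finset.induction_on with
  | empty => exact ⟨0, by simp⟩
  | insert i S hi ih =>
    obtain ⟨m, hm⟩ := ih
    have hcross : 2 * ⟪α.repr v i • α i, ∑ j ∈ S, α.repr v j • α j⟫ =
        ((∑ j ∈ S, c i * c j * k i j * s j : ℤ) : ℝ) := by
      rw [inner_sum, Finset.mul_sum]
      push_cast
      refine Finset.sum_congr rfl fun j _ => ?_
      rw [inner_smul_left, inner_smul_right, hc, hc, ← hs]
      simp only [conj_trivial]
      linear_combination (c i * c j * t j : ℝ) * hk i j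
    refine ⟨c i * c i * s i + ∑ j ∈ S, c i * c j * k i j * s j + m, ?_⟩
    rw [Finset.sum_insert hi, inner_add_left, inner_add_right, inner_add_right, hm,
      real_inner_comm (α.repr v i • α i) (∑ j ∈ S, α.repr v j • α j)]
    have hd : ⟪α.repr v i • α i, α.repr v i • α i⟫ = ((c i * c i * s i : ℤ) : ℝ) := by
      rw [inner_smul_left, inner_smul_right, inner_self_of_norm (hα i), hc]
      push_cast
      rw [← hs]
      simp only [conj_trivial]
      ring
    rw [hd]
    push_cast at hcross ⊢
    linarith

/-- A unit vector of an integral lattice has coordinates of constant sign with respect to an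
obtuse basis. -/
theorem sign_of_mem_scaledLattice {α : Module.Basis ι ℝ (Euc n)} (hα : ∀ i, ‖α i‖ = 1)
    (hob : ∀ i j, i ≠ j → ⟪α i, α j⟫ ≤ 0) {t : ι → ℝ} (ht : ∀ i, ∃ k : ℤ, t i * t i = k)
    (h : ∀ i j, ∃ k : ℤ, 2 * t i * ⟪α i, α j⟫ = k * t j) {v : Euc n}
    (hv : v ∈ scaledLattice α t) (hv1 : ‖v‖ = 1) :
    (∀ j, 0 ≤ α.repr v j) ∨ (∀ j, α.repr v j ≤ 0) := by
  classical
  set p := ∑ i, (α.repr v i)⁺ • α i with hp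
  set q := ∑ i, (α.repr v i)⁻ • α i with hq
  have hvpq : v = p - q := by
    conv_lhs => rw [← α.sum_repr v]
    rw [hp, hq, ← Finset.sum_sub_distrib]
    refine Finset.sum_congr rfl fun i _ => ?_
    rw [← sub_smul, posPart_sub_negPart]
  have rp (i : ι) : α.repr p i = (α.repr v i)⁺ := by
    rw [hp, α.repr_sum_self]
  have rq (i : ι) : α.repr q i = (α.repr v i)⁻ := by
    rw [hq, α.repr_sum_self]
  have hpl : p ∈ scaledLattice α t := by
    intro j
    rw [rp]
    rcases le_total 0 (α.repr v j) with h0 | h0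
    · rw [posPart_of_nonneg h0]; exact hv j
    · exact ⟨0, by rw [posPart_of_nonpos h0]; simp⟩
  have hql : q ∈ scaledLattice α t := by
    intro j
    rw [rq]
    rcases le_total 0 (α.repr v j) with h0 | h0
    · exact ⟨0, by rw [negPart_of_nonneg h0]; simp⟩
    · obtain ⟨c, hc⟩ := hv j
      exact ⟨-c, by rw [negPart_of_nonpos h0, hc]; push_cast; ring⟩
  have hpq : ⟪p, q⟫ ≤ 0 := by
    rw [hp, hq, sum_inner]
    refine Finset.sum_nonpos fun i _ => ?_
    rw [inner_sum]
    refine Finset.sum_nonpos fun j _ => ?_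
    rw [inner_smul_left, inner_smul_right, ← mul_assoc]
    simp only [conj_trivial]
    by_cases hij : i = j
    · subst hij
      rcases le_total 0 (α.repr v i) with h | h
      · rw [negPart_of_nonneg h, mul_zero, zero_mul]
      · rw [posPart_of_nonpos h, zero_mul, zero_mul]
    · exact mul_nonpos_of_nonneg_of_nonpos (mul_nonneg (posPart_nonneg _) (negPart_nonneg _))
        (hob i j hij)
  have hone {u : Euc n} (hu : u ∈ scaledLattice α t) (hu0 : u ≠ 0) : 1 ≤ ⟪u, u⟫ := by
    obtain ⟨k, hk⟩ := inner_self_int_of_mem_scaledLattice hα ht h hu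
    have := real_inner_self_pos.mpr hu0
    rw [hk] at this ⊢
    exact_mod_cast this
  -- Nonzero lattice vectors have square norm at least one. If `p` and `q` were both nonzero, then
  -- `1 = ‖p - q‖² ≥ ‖p‖² + ‖q‖² ≥ 2`, because `⟪p, q⟫ ≤ 0`.
  have hz : p = 0 ∨ q = 0 := by
    by_contra! hne
    have h1 := hone hpl hne.1
    have h2 := hone hql hne.2
    have h3 := inner_self_of_norm hv1
    rw [hvpq, inner_sub_left, inner_sub_right, inner_sub_right, real_inner_comm p q] at h3
    linarith
  rcases hz with hz | hz
  · right
    intro j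
    have := rp j
    rw [hz, map_zero, Finsupp.zero_apply] at this
    exact posPart_eq_zero.mp this.symm
  · left
    intro j
    have := rq j
    rw [hz, map_zero, Finsupp.zero_apply] at this
    exact negPart_eq_zero.mp this.symm

/-- The group preserves the lattice, so images of `α l` are unit lattice vectors and have
coordinates of constant sign. The scaling depends on `l` because `α l` itself must lie in the
lattice. This replaces any description of the full root system. -/
theorem simpleSystem_of_lattice {W : Subgroup (OrthGroup n)} {α : Module.Basis ι ℝ (Euc n)}
    (hα : ∀ i, ‖α i‖ = 1) (hW : W = Subgroup.closure (Set.range fun i => refl (α i)))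
    (hob : ∀ i j, i ≠ j → ⟪α i, α j⟫ ≤ 0)
    (H : ∀ l, ∃ t : ι → ℝ, t l = 1 ∧ (∀ i, ∃ k : ℤ, t i * t i = k) ∧
      ∀ i j, ∃ k : ℤ, 2 * t i * ⟪α i, α j⟫ = k * t j) : SimpleSystem W α := by
  classical
  refine ⟨hα, hW, fun w hw l => ?_⟩
  obtain ⟨t, htl, ht, h⟩ := H l
  refine sign_of_mem_scaledLattice hα hob ht h ?_ (by rw [w.norm_map, hα])
  have hl : α l ∈ scaledLattice α t := by
    intro j
    by_cases hj : j = l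
    · exact ⟨1, by rw [hj, α.repr_self, Finsupp.single_eq_same, htl]; simp⟩
    · exact ⟨0, by rw [α.repr_self, Finsupp.single_eq_of_ne hj]; simp⟩
  have key : ∀ v ∈ scaledLattice α t, w v ∈ scaledLattice α t ∧ w⁻¹ v ∈ scaledLattice α t := by
    rw [hW] at hw
    induction hw using Subgroup.closure_induction with
    | mem x hx =>
      obtain ⟨i, rfl⟩ := hx
      intro v hv
      simp only [refl_inv]
      exact ⟨refl_mem_scaledLattice hα h i hv, refl_mem_scaledLattice hα h i hv⟩
    | one => intro v hv; rw [inv_one]; exact ⟨hv, hv⟩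
    | mul x y _ _ hx hy =>
      intro v hv
      rw [mul_inv_rev]
      exact ⟨(hx _ (hy v hv).1).1, (hy _ (hx v hv).2).2⟩
    | inv x _ hx => intro v hv; rw [inv_inv]; exact (hx v hv).symm
  exact (key _ hl).1

end Lattice
end ReflectionGroup

/-! ### Symmetries of a cube. -/

namespace ReflectionGroup
variable {n : ℕ}

section Frame
variable {e : Fin 3 → Euc n}

/-- `g` permutes the lines spanned by an orthonormal triple and fixes its orthogonal complement. -/
def PreservesFrame (e : Fin 3 → Euc n) (g : OrthGroup n) : Prop :=
  (∃ π : Equiv.Perm (Fin 3), ∀ a, g (e a) = e (π a) ∨ g (e a) = -e (π a)) ∧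
    ∀ y, (∀ a, ⟪y, e a⟫ = 0) → g y = y

theorem inner_of_orthonormal (he : Orthonormal ℝ e) (a b : Fin 3) :
    ⟪e a, e b⟫ = if a = b then 1 else 0 := orthonormal_iff_ite.mp he a b

theorem preservesFrame_of_mem_closure {S : Set (OrthGroup n)} (hS : ∀ s ∈ S, PreservesFrame e s)
    {g : OrthGroup n} (hg : g ∈ Subgroup.closure S) : PreservesFrame e g := by
  induction hg using Subgroup.closure_induction with
  | mem s hs => exact hS s hs
  | one => exact ⟨⟨1, fun a => Or.inl rfl⟩, fun y _ => rfl⟩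
  | mul g h _ _ hg hh =>
    obtain ⟨⟨π, hπ⟩, hg'⟩ := hg
    obtain ⟨⟨τ, hτ⟩, hh'⟩ := hh
    refine ⟨⟨π * τ, fun a => ?_⟩, fun y hy => by rw [mul_apply, hh' y hy, hg' y hy]⟩
    rw [mul_apply, Equiv.Perm.mul_apply]
    rcases hτ a with h1 | h1 <;> rcases hπ (τ a) with h2 | h2 <;> simp [h1, h2]
  | inv g _ hg =>
    obtain ⟨⟨π, hπ⟩, hg'⟩ := hg
    refine ⟨⟨π⁻¹, fun a => ?_⟩, fun y hy => inv_apply_eq.mpr (hg' y hy).symm⟩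
    have h1 := hπ (π⁻¹ a)
    have h2 : π (π⁻¹ a) = a := by simp
    rw [h2] at h1
    rcases h1 with h1 | h1
    · left; rw [inv_apply_eq, h1]
    · right; rw [inv_apply_eq, map_neg, h1, neg_neg]

theorem eq_one_of_fixes_frame (he : Orthonormal ℝ e) {g : OrthGroup n} (h : ∀ a, g (e a) = e a)
    (h' : ∀ y, (∀ a, ⟪y, e a⟫ = 0) → g y = y) : g = 1 := by
  ext1 x
  have hz := h' (x - ∑ a, ⟪e a, x⟫ • e a) fun a => by
    rw [inner_sub_left, sum_inner]
    simp [inner_smul_left, inner_of_orthonormal he, real_inner_comm]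
  rw [map_sub, map_sum] at hz
  simp only [map_smul, h, sub_left_inj] at hz
  exact hz

/-- The fixed vectors of an element of order three have coordinates of equal absolute value. -/
theorem sq_eq_of_preservesFrame (he : Orthonormal ℝ e) {g : OrthGroup n} (hg : PreservesFrame e g)
    (h3 : g * g * g = 1) (h1 : g ≠ 1) {y : Euc n} (hy : g y = y) :
    ⟪y, e 0⟫ ^ 2 = ⟪y, e 1⟫ ^ 2 ∧ ⟪y, e 1⟫ ^ 2 = ⟪y, e 2⟫ ^ 2 := by
  obtain ⟨⟨π, hπ⟩, hfix⟩ := hg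
  have hne (a : Fin 3) : e a ≠ -e a := by
    intro h
    have h1 := inner_of_orthonormal he a a
    have h2 := congrArg (fun v => ⟪v, e a⟫) h
    simp only [inner_neg_left, h1, if_true] at h2
    norm_num at h2
  have heq {a b : Fin 3} (h : e a = e b ∨ e a = -e b) : a = b := by
    by_contra hab
    have h1 := inner_of_orthonormal he a b
    rw [if_neg hab] at h1
    rcases h with h | h <;> rw [h] at h1
    · rw [inner_of_orthonormal he, if_pos rfl] at h1
      exact one_ne_zero h1
    · rw [inner_neg_left, inner_of_orthonormal he, if_pos rfl] at h1
      norm_num at h1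
  have hg3 (a : Fin 3) : g (g (g (e a))) = e a := by
    show (g * g * g) (e a) = e a
    rw [h3, one_apply]
  have hπ3 : ∀ a, π (π (π a)) = a := by
    intro a
    apply heq
    have := hg3 a
    rcases hπ a with h1 | h1 <;> rcases hπ (π a) with h2 | h2 <;>
      rcases hπ (π (π a)) with h4 | h4 <;> simp only [h1, h2, h4, map_neg, neg_neg] at this
    all_goals first
      | exact Or.inl this
      | exact Or.inr (by rw [← this, neg_neg])
  have hsq (a : Fin 3) : ⟪y, e a⟫ ^ 2 = ⟪y, e (π a)⟫ ^ 2 := by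
    rw [← inner_map g y (e a), hy]
    rcases hπ a with h | h <;> rw [h]
    rw [inner_neg_right, neg_sq]
  -- The induced permutation has order dividing three. If it is trivial, so are the signs, since
  -- their cubes are one; otherwise it is a three-cycle carrying each coordinate to the next up to
  -- sign.
  have hcases : ∀ π : Equiv.Perm (Fin 3), (∀ a, π (π (π a)) = a) →
      (∀ a, π a = a) ∨ (π 0 = 1 ∧ π 1 = 2) ∨ (π 0 = 2 ∧ π 2 = 1) := by decide
  rcases hcases π hπ3 with h | ⟨h0, h1⟩ | ⟨h0, h2⟩
  · exfalso
    apply h1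
    refine eq_one_of_fixes_frame he (fun a => ?_) hfix
    have h4 := hπ a
    rw [h a] at h4
    rcases h4 with h4 | h4
    · exact h4
    · have := hg3 a
      simp only [h4, map_neg, neg_neg] at this
      exact absurd this.symm (hne a)
  · have e0 := hsq 0
    have e1 := hsq 1
    rw [h0] at e0; rw [h1] at e1
    exact ⟨e0, e1⟩
  · have e0 := hsq 0
    have e1 := hsq 2
    rw [h0] at e0; rw [h2] at e1
    exact ⟨by rw [e0, e1], e1.symm⟩

theorem refl_sub_left {u v : Euc n} (h : ‖u‖ = ‖v‖) : refl (u - v) u = v :=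
  Submodule.reflection_sub h

theorem refl_sub_right {u v : Euc n} (h : ‖u‖ = ‖v‖) : refl (u - v) v = u := by
  have := refl_refl (u - v) u
  rwa [refl_sub_left h] at this

theorem preservesFrame_refl_sub (he : Orthonormal ℝ e) (a b : Fin 3) :
    PreservesFrame e (refl (e a - e b)) := by
  have hn : ‖e a‖ = ‖e b‖ := by rw [he.1, he.1]
  refine ⟨⟨Equiv.swap a b, fun c => Or.inl ?_⟩, fun y hy => ?_⟩
  · by_cases hca : c = a
    · rw [hca, Equiv.swap_apply_left, refl_sub_left hn]
    by_cases hcb : c = b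
    · rw [hcb, Equiv.swap_apply_right, refl_sub_right hn]
    rw [Equiv.swap_apply_of_ne_of_ne hca hcb, refl_apply_eq_self_iff, inner_sub_left,
      inner_of_orthonormal he, inner_of_orthonormal he, if_neg (Ne.symm hca), if_neg (Ne.symm hcb),
      sub_zero]
  · rw [refl_apply_eq_self_iff, real_inner_comm, inner_sub_right, hy, hy, sub_zero]

theorem preservesFrame_refl_add (he : Orthonormal ℝ e) (a b : Fin 3) :
    PreservesFrame e (refl (e a + e b)) := by
  have hn : ‖e a‖ = ‖-e b‖ := by rw [norm_neg, he.1, he.1]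
  have hs : e a + e b = e a - -e b := (sub_neg_eq_add _ _).symm
  refine ⟨⟨Equiv.swap a b, fun c => ?_⟩, fun y hy => ?_⟩
  · by_cases hca : c = a
    · right; rw [hca, Equiv.swap_apply_left, hs, refl_sub_left hn]
    by_cases hcb : c = b
    · right
      have := refl_sub_right hn
      rw [map_neg] at this
      rw [hcb, Equiv.swap_apply_right, hs, ← this, neg_neg, this]
    left
    rw [Equiv.swap_apply_of_ne_of_ne hca hcb, refl_apply_eq_self_iff, inner_add_left,
      inner_of_orthonormal he, inner_of_orthonormal he, if_neg (Ne.symm hca), if_neg (Ne.symm hcb),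
      add_zero]
  · rw [refl_apply_eq_self_iff, real_inner_comm, inner_add_right, hy, hy, add_zero]

theorem preservesFrame_refl (he : Orthonormal ℝ e) (a : Fin 3) :
    PreservesFrame e (refl (e a)) := by
  refine ⟨⟨1, fun c => ?_⟩, fun y hy => ?_⟩
  · by_cases hca : c = a
    · right; rw [hca, refl_apply_self]; rfl
    · left
      rw [Equiv.Perm.one_apply, refl_apply_eq_self_iff, inner_of_orthonormal he,
        if_neg (Ne.symm hca)]
  · rw [refl_apply_eq_self_iff, real_inner_comm, hy]

/-- A reflection containing the axis of a rotation of order three of a cube, and conjugating another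
such rotation into a symmetry of the cube, is itself a symmetry of the cube. -/
theorem refl_mem_of_preservesFrame (he : Orthonormal ℝ e) {W : Subgroup (OrthGroup n)}
    (hp : refl (e 0 - e 1) ∈ W) (hq : refl (e 1 - e 2) ∈ W) {κ : Euc n}
    (hκ : κ = e 1 + e 2 ∨ κ = e 2) {ρ : Euc n} (hρ1 : ‖ρ‖ = 1)
    (hρ : ∀ x, refl (e 0 - e 1) (refl (e 1 - e 2) x) = x → ⟪x, ρ⟫ = 0)
    (hpres : PreservesFrame e ((refl ρ * refl κ) * (refl (e 0 - e 1) * refl (e 1 - e 2)) *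
      (refl ρ * refl κ)⁻¹)) : refl ρ ∈ W := by
  have hn (a b : Fin 3) : ‖e a‖ = ‖e b‖ := by rw [he.1, he.1]
  have hi := inner_of_orthonormal he
  have i00 : ⟪e 0, e 0⟫ = 1 := (hi 0 0).trans (if_pos rfl)
  have i11 : ⟪e 1, e 1⟫ = 1 := (hi 1 1).trans (if_pos rfl)
  have i22 : ⟪e 2, e 2⟫ = 1 := (hi 2 2).trans (if_pos rfl)
  have i01 : ⟪e 0, e 1⟫ = 0 := (hi 0 1).trans (if_neg (by decide))
  have i02 : ⟪e 0, e 2⟫ = 0 := (hi 0 2).trans (if_neg (by decide))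
  have i12 : ⟪e 1, e 2⟫ = 0 := (hi 1 2).trans (if_neg (by decide))
  have i10 : ⟪e 1, e 0⟫ = 0 := (hi 1 0).trans (if_neg (by decide))
  have i20 : ⟪e 2, e 0⟫ = 0 := (hi 2 0).trans (if_neg (by decide))
  have i21 : ⟪e 2, e 1⟫ = 0 := (hi 2 1).trans (if_neg (by decide))
  have p0 : refl (e 0 - e 1) (e 0) = e 1 := refl_sub_left (hn 0 1)
  have p1 : refl (e 0 - e 1) (e 1) = e 0 := refl_sub_right (hn 0 1)
  have p2 : refl (e 0 - e 1) (e 2) = e 2 := by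
    rw [refl_apply_eq_self_iff, inner_sub_left]; simp [hi]
  have q1 : refl (e 1 - e 2) (e 1) = e 2 := refl_sub_left (hn 1 2)
  have q2 : refl (e 1 - e 2) (e 2) = e 1 := refl_sub_right (hn 1 2)
  have q0 : refl (e 1 - e 2) (e 0) = e 0 := by
    rw [refl_apply_eq_self_iff, inner_sub_left]; simp [hi]
  have hpqp : refl (e 0 - e 1) * refl (e 1 - e 2) * refl (e 0 - e 1) = refl (e 0 - e 2) := by
    have := conj_refl (refl (e 0 - e 1)) (e 1 - e 2)
    rwa [refl_inv, map_sub, p1, p2] at this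
  have hqpq : refl (e 1 - e 2) * refl (e 0 - e 1) * refl (e 1 - e 2) = refl (e 0 - e 2) := by
    have := conj_refl (refl (e 1 - e 2)) (e 0 - e 1)
    rwa [refl_inv, map_sub, q0, q1] at this
  obtain ⟨c, hc⟩ : ∃ c, c = refl (e 0 - e 1) * refl (e 1 - e 2) := ⟨_, rfl⟩
  rw [← hc] at hpres
  have hc3 : c * c * c = 1 := by
    have : c * c * c = (refl (e 0 - e 1) * refl (e 1 - e 2) * refl (e 0 - e 1)) *
        (refl (e 1 - e 2) * refl (e 0 - e 1) * refl (e 1 - e 2)) := by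
      rw [hc]; simp only [mul_assoc]
    rw [this, hpqp, hqpq, refl_mul_self]
  have hc1 : c ≠ 1 := by
    intro h
    have h1 : c (e 0) = e 0 := by rw [h, one_apply]
    rw [hc, mul_apply, q0, p0] at h1
    have h2 := hi 0 1
    rw [h1, hi] at h2
    simp at h2
  -- `v₀` spans the axis of `c` inside the frame, so `g` fixes its image under `refl ρ * refl κ`,
  -- which must again be a diagonal of the cube.
  set v₀ := e 0 + e 1 + e 2 with hv₀
  have hcv : c v₀ = v₀ := by
    rw [hc, mul_apply, hv₀]
    simp only [map_add, q0, q1, q2, p0, p1, p2]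
    abel
  set g := (refl ρ * refl κ) * c * (refl ρ * refl κ)⁻¹ with hg
  have hg3 : g * g * g = 1 := by
    have : g * g * g = (refl ρ * refl κ) * (c * c * c) * (refl ρ * refl κ)⁻¹ := by
      rw [hg]; group
    rw [this, hc3]; group
  have hg1 : g ≠ 1 := fun h => hc1 (conj_eq_one_iff.mp h)
  have hgy : g (refl ρ (refl κ v₀)) = refl ρ (refl κ v₀) := by
    rw [← mul_apply (refl ρ) (refl κ), hg, mul_apply, mul_apply, inv_apply_self, hcv]
  obtain ⟨s1, s2⟩ := sq_eq_of_preservesFrame he hpres hg3 hg1 hgy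
  obtain ⟨a, ha⟩ : ∃ a, a = ⟪ρ, e 0⟫ := ⟨_, rfl⟩
  obtain ⟨b, hb⟩ : ∃ b, b = ⟪ρ, e 1⟫ := ⟨_, rfl⟩
  obtain ⟨d, hd⟩ : ∃ d, d = ⟪ρ, e 2⟫ := ⟨_, rfl⟩
  -- The part of `ρ` orthogonal to the frame is fixed by both reflections, hence orthogonal to `ρ`,
  -- hence zero. Orthogonality to `v₀` then gives `a + b + d = 0`.
  have hexp : ρ = a • e 0 + b • e 1 + d • e 2 := by
    set z := ρ - (a • e 0 + b • e 1 + d • e 2) with hz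
    have hze : ∀ i, ⟪z, e i⟫ = 0 := by
      intro i
      rw [hz, inner_sub_left]
      fin_cases i <;> simp [inner_add_left, inner_smul_left, hi, ha, hb, hd, he.1]
    have hzρ : ⟪z, ρ⟫ = 0 := by
      apply hρ
      have h1 : refl (e 1 - e 2) z = z := (preservesFrame_refl_sub he _ _).2 z hze
      rw [h1]
      exact (preservesFrame_refl_sub he _ _).2 z hze
    have hzz : ⟪z, z⟫ = 0 := by
      conv_lhs => rw [hz]
      rw [← hz, inner_sub_right, hzρ]
      simp [inner_add_right, inner_smul_right, hze]
    rw [inner_self_eq_zero] at hzz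
    rw [← sub_eq_zero]; exact hzz
  have hsum : a + b + d = 0 := by
    have := hρ v₀ (by rw [hc, mul_apply] at hcv; exact hcv)
    rw [real_inner_comm, hv₀, inner_add_right, inner_add_right, ← ha, ← hb, ← hd] at this
    exact this
  have hsq : a ^ 2 + b ^ 2 + d ^ 2 = 1 := by
    have := inner_self_of_norm hρ1
    rw [hexp] at this
    simp only [inner_add_left, inner_add_right, real_inner_smul_left, real_inner_smul_right,
      i00, i01, i02, i10, i11, i12, i20, i21, i22] at this
    linarith
  have hcoord (v : Euc n) (i : Fin 3) :
      ⟪refl ρ v, e i⟫ = ⟪v, e i⟫ - 2 * ⟪ρ, v⟫ * ⟪ρ, e i⟫ := by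
    rw [refl_apply_of_norm hρ1, inner_sub_left, inner_smul_left]; simp
  -- One vanishing coordinate suffices: the coordinates sum to zero, so `ρ` is then a multiple of
  -- some `e x - e y`.
  have hzero : a = 0 ∨ b = 0 ∨ d = 0 := by
    rcases hκ with rfl | rfl
    · have hn12 : ‖e 1‖ = ‖-e 2‖ := by rw [norm_neg]; exact hn 1 2
      have k1 : refl (e 1 + e 2) (e 1) = -e 2 := by
        rw [← sub_neg_eq_add]; exact refl_sub_left hn12
      have k2 : refl (e 1 + e 2) (e 2) = -e 1 := by
        have := refl_sub_right hn12
        rwa [sub_neg_eq_add, map_neg, neg_eq_iff_eq_neg] at this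
      have k0 : refl (e 1 + e 2) (e 0) = e 0 := by
        rw [refl_apply_eq_self_iff, inner_add_left]; simp [hi]
      have hv : refl (e 1 + e 2) v₀ = e 0 - e 1 - e 2 := by
        rw [hv₀, map_add, map_add, k0, k1, k2]; abel
      rw [hv, hcoord, hcoord] at s1
      rw [hv, hcoord, hcoord] at s2
      simp only [inner_sub_left, inner_sub_right, i00, i01, i02, i10, i11, i12, i20,
        i21, i22, ← ha, ← hb, ← hd] at s1 s2
      obtain rfl : a = -b - d := by linarith
      -- The reflected vector is `(1, -1, -1) - 4a(a, b, d)` with `a = -b - d`. If `b = d`, the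
      -- squares of its first two coordinates are 25/9 and 1/9; if `2a² = 1`, then `(b + d)² = b² +
      -- d²`, so `bd = 0`.
      have f2 : (b - d) * (-b - d) * (1 - 2 * (-b - d) ^ 2) = 0 := by linear_combination s2 / 8
      rcases mul_eq_zero.mp f2 with f | f
      · rcases mul_eq_zero.mp f with f | f
        · obtain rfl : b = d := by linarith
          exfalso
          have hb2 : b ^ 2 = 1 / 6 := by linarith
          have hb4 : b ^ 4 = 1 / 36 := by
            rw [show b ^ 4 = (b ^ 2) ^ 2 by ring, hb2]; norm_num
          ring_nf at s1
          rw [hb2, hb4] at s1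
          norm_num at s1
        · left; linarith
      · right
        exact mul_eq_zero.mp (by linarith)
    · have k0 : refl (e 2) (e 0) = e 0 := by rw [refl_apply_eq_self_iff]; simp [hi]
      have k1 : refl (e 2) (e 1) = e 1 := by rw [refl_apply_eq_self_iff]; simp [hi]
      have hv : refl (e 2) v₀ = e 0 + e 1 - e 2 := by
        rw [hv₀, map_add, map_add, k0, k1, refl_apply_self]; abel
      rw [hv, hcoord, hcoord] at s1
      rw [hv, hcoord, hcoord] at s2
      simp only [inner_sub_left, inner_sub_right, inner_add_left, inner_add_right, i00, i01,
        i02, i10, i11, i12, i20, i21, i22, ← ha, ← hb, ← hd] at s1 s2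
      obtain rfl : d = -a - b := by linarith
      have f2 : (a - b) * (-a - b) * (1 - 2 * (-a - b) ^ 2) = 0 := by linear_combination s1 / 8
      rcases mul_eq_zero.mp f2 with f | f
      · rcases mul_eq_zero.mp f with f | f
        · obtain rfl : a = b := by linarith
          exfalso
          have hb2 : a ^ 2 = 1 / 6 := by linarith
          have hb4 : a ^ 4 = 1 / 36 := by
            rw [show a ^ 4 = (a ^ 2) ^ 2 by ring, hb2]; norm_num
          ring_nf at s2
          rw [hb2, hb4] at s2
          norm_num at s2
        · right; right; linarith
      · rcases mul_eq_zero.mp (show a * b = 0 by linarith) with h | h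
        · exact Or.inl h
        · exact Or.inr (Or.inl h)
  have hfin {x y : Fin 3} {t : ℝ} (h : ρ = t • (e x - e y)) (hm : refl (e x - e y) ∈ W) :
      refl ρ ∈ W := by
    have ht : t ≠ 0 := by
      rintro rfl
      rw [zero_smul] at h
      exact ne_zero_of_norm hρ1 h
    rw [h, refl_smul ht]; exact hm
  rcases hzero with rfl | rfl | rfl
  · exact hfin (x := 1) (y := 2) (t := b)
      (by rw [hexp, show d = -b by linarith]; module) hq
  · exact hfin (x := 0) (y := 2) (t := a)
      (by rw [hexp, show d = -a by linarith]; module)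
      (by rw [← hpqp]; exact W.mul_mem (W.mul_mem hp hq) hp)
  · exact hfin (x := 0) (y := 1) (t := a)
      (by rw [hexp, show b = -a by linarith]; module) hp

end Frame
end ReflectionGroup

/-! ### Criterion for a diagram automorphism to give an extending rotation. -/

namespace ReflectionGroup
variable {n : ℕ}

section Extension
variable {ι : Type} [Fintype ι] [DecidableEq ι] {W : Subgroup (OrthGroup n)}
  {α : Module.Basis ι ℝ (Euc n)} {σ : Equiv.Perm ι} {a : OrthGroup n}

/-- `σ` permutes a basis isometrically, moves it as a rotation does, is up to inverses the only
such automorphism, and moves three basis vectors which generate a reflection group of type `A₃` or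
`B₃`. -/
structure IsExtendingPerm (α : Module.Basis ι ℝ (Euc n)) (σ : Equiv.Perm ι) : Prop where
  inner_eq : ∀ i j, ⟪α (σ i), α (σ j)⟫ = ⟪α i, α j⟫
  sign : Equiv.Perm.sign σ = 1
  shape : (∃ x y z, IsThreeCycleOn σ x y z) ∨ ∃ x x' y y', IsDoubleSwapOn σ x x' y y'
  order : σ ^ 2 = 1 ∨ σ ^ 3 = 1
  eq_of_inner_eq : ∀ τ : Equiv.Perm ι, (∀ i j, ⟪α (τ i), α (τ j)⟫ = ⟪α i, α j⟫) →
    τ = 1 ∨ τ = σ ∨ τ = σ⁻¹ ∨ ∃ x x', IsSwapOn τ x x'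
  frame : ∃ e : Fin 3 → Euc n, Orthonormal ℝ e ∧ ∃ i j k : ι, refl (α i) = refl (e 0 - e 1) ∧
    refl (α j) = refl (e 1 - e 2) ∧
    (refl (α k) = refl (e 1 + e 2) ∨ refl (α k) = refl (e 2)) ∧
    (∃ l, ¬(l = i ∨ l = j ∨ l = k) ∧ (σ l = i ∨ σ l = j ∨ σ l = k)) ∧
    ∃ l, ¬(l = i ∨ l = j ∨ l = k) ∧ (σ⁻¹ l = i ∨ σ⁻¹ l = j ∨ σ⁻¹ l = k)

/-- `s_j v = s_i v` differs from `v` by a multiple of `α i` and by one of `α j`; by independence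
both multiples vanish. -/
theorem inner_eq_zero_of_refl_mul_refl (hα : SimpleSystem W α) {i j : ι} (hij : i ≠ j) {v : Euc n}
    (h : refl (α i) (refl (α j) v) = v) : ⟪α i, v⟫ = 0 ∧ ⟪α j, v⟫ = 0 := by
  have h1 : refl (α j) v = refl (α i) v := by
    rw [← refl_refl (α i) (refl (α j) v), h]
  have h2 : α.repr (refl (α i) v) j = α.repr v j := repr_refl (hα.norm i) v hij.symm
  have hj : ⟪α j, v⟫ = 0 := by
    rw [← h1, refl_apply_of_norm (hα.norm j)] at h2
    simpa using h2
  refine ⟨?_, hj⟩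
  rw [refl_apply_eq_self_iff.mpr hj] at h
  exact refl_apply_eq_self_iff.mp h

theorem isRotation_refl_mul_refl (hα : SimpleSystem W α) {i j : ι} (hij : i ≠ j) :
    IsRotation (refl (α i) * refl (α j)) := by
  apply le_antisymm
  · rw [← Finset.card_pair hij]
    refine finrank_add_card_le α _ {i, j} fun x hx h0 => ?_
    rw [mem_fixedSpace, mul_apply] at hx
    obtain ⟨hi, hj⟩ := inner_eq_zero_of_refl_mul_refl hα hij hx
    rw [← inner_self_eq_zero (𝕜 := ℝ), inner_eq_sum α x x]
    refine Finset.sum_eq_zero fun l _ => ?_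
    by_cases hl : l ∈ ({i, j} : Finset ι)
    · rw [Finset.mem_insert, Finset.mem_singleton] at hl
      rcases hl with rfl | rfl
      · rw [real_inner_comm, hi, mul_zero]
      · rw [real_inner_comm, hj, mul_zero]
    · rw [h0 l hl, zero_mul]
  · let L : Euc n →ₗ[ℝ] (Fin 2 → ℝ) :=
      LinearMap.pi ![(innerₗ (Euc n)) (α i), (innerₗ (Euc n)) (α j)]
    refine le_finrank_add L fun v hv => ?_
    have h1 : ⟪α i, v⟫ = 0 := congrFun (LinearMap.mem_ker.mp hv) 0
    have h2 : ⟪α j, v⟫ = 0 := congrFun (LinearMap.mem_ker.mp hv) 1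
    rw [mem_fixedSpace, mul_apply, refl_apply_eq_self_iff.mpr h2, refl_apply_eq_self_iff.mpr h1]

/-- Letters of a word pair off; a fixed `o` absorbs the letter left over in an odd word, and the
determinant excludes that case. -/
theorem orientationPreserving_le_closure (hα : SimpleSystem W α) [Nonempty ι] :
    orientationPreserving W ≤
      Subgroup.closure {g | ∃ i j, i ≠ j ∧ g = refl (α i) * refl (α j)} := by
  set K := Subgroup.closure {g | ∃ i j, i ≠ j ∧ g = refl (α i) * refl (α j)} with hK
  have hpair (i j : ι) : refl (α i) * refl (α j) ∈ K := by
    by_cases hij : i = j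
    · rw [hij, refl_mul_self]; exact K.one_mem
    · exact Subgroup.subset_closure ⟨i, j, hij, rfl⟩
  have hdet {g : OrthGroup n} (hg : g ∈ K) : odet n g = 1 := by
    induction hg using Subgroup.closure_induction with
    | mem g hg =>
      obtain ⟨i, j, -, rfl⟩ := hg
      rw [map_mul, odet_refl (α.ne_zero i), odet_refl (α.ne_zero j)]; norm_num
    | one => exact map_one _
    | mul g h _ _ hg hh => rw [map_mul, hg, hh, mul_one]
    | inv g _ hg =>
      have := (odet n).map_mul g g⁻¹
      rwa [mul_inv_cancel, map_one, hg, one_mul, eq_comm] at this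
  obtain ⟨o⟩ := ‹Nonempty ι›
  have hword (l : List ι) : word α l ∈ K ∨ refl (α o) * word α l ∈ K := by
    induction l with
    | nil => exact Or.inl K.one_mem
    | cons i l ih =>
      have hc : word α (i :: l) = refl (α i) * word α l := by simp [word]
      rw [hc]
      rcases ih with h | h
      · right
        rw [← mul_assoc]
        exact K.mul_mem (hpair o i) h
      · left
        have := K.mul_mem (hpair i o) h
        rwa [mul_assoc, ← mul_assoc (refl (α o)) (refl (α o)), refl_mul_self, one_mul] at this
  intro g hg
  rw [mem_orientationPreserving] at hg
  obtain ⟨l, rfl⟩ := hα.exists_word hg.1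
  refine (hword l).resolve_right fun h => ?_
  have := hdet h
  rw [map_mul, hg.2, odet_refl (α.ne_zero o)] at this
  norm_num at this

theorem extendedGroup_eq_closure (hα : SimpleSystem W α) [Nonempty ι] (a : OrthGroup n) :
    extendedGroup W a =
      Subgroup.closure ({g | ∃ i j, i ≠ j ∧ g = refl (α i) * refl (α j)} ∪ {a}) := by
  apply le_antisymm
  · rw [extendedGroup, Subgroup.closure_le]
    rintro g (hg | hg)
    · exact Subgroup.closure_mono Set.subset_union_left (orientationPreserving_le_closure hα hg)
    · exact Subgroup.subset_closure (Or.inr hg)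
  · rw [Subgroup.closure_le]
    rintro g (⟨i, j, -, rfl⟩ | hg)
    · apply Subgroup.subset_closure
      left
      refine mem_orientationPreserving.mpr ⟨W.mul_mem (hα.refl_mem i) (hα.refl_mem j), ?_⟩
      rw [map_mul, odet_refl (α.ne_zero i), odet_refl (α.ne_zero j)]; norm_num
    · exact Subgroup.subset_closure (Or.inr hg)

theorem self_mem_extendedGroup : a ∈ extendedGroup W a :=
  Subgroup.subset_closure (Or.inr rfl)

theorem isRotation_of_shape (hσ : ∀ i, a (α i) = α (σ i))
    (h : (∃ x y z, IsThreeCycleOn σ x y z) ∨ ∃ x x' y y', IsDoubleSwapOn σ x x' y y') :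
    IsRotation a := by
  rcases h with ⟨x, y, z, h⟩ | ⟨x, x', y, y', h⟩
  · exact finrank_threeCycle hσ h
  · exact finrank_doubleSwap hσ h

theorem fixedSpace_inv (a : OrthGroup n) : fixedSpace a⁻¹ = fixedSpace a := by
  ext x
  rw [mem_fixedSpace, mem_fixedSpace, inv_apply_eq, eq_comm]

theorem isRotationGroup_extendedGroup [Finite W] [Nonempty ι] (hα : SimpleSystem W α)
    (hσ : ∀ i, a (α i) = α (σ i)) (ha : IsRotation a) : IsRotationGroup (extendedGroup W a) := by
  constructor
  · have := finite_closure_union (hα.normalizes_of_perm hσ) (isOfFinOrder_of_perm hσ)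
    exact Finite.of_injective _ (Subgroup.inclusion_injective
      (extendedGroup_le (a := a) W.one_mem (one_mul a).symm))
  · refine ⟨_, ?_, extendedGroup_eq_closure hα a⟩
    rintro g (⟨i, j, hij, rfl⟩ | rfl)
    · exact isRotation_refl_mul_refl hα hij
    · exact ha

/-- A vector orthogonal to the roots of `W'` is fixed by `W'`, hence by all products of two simple
reflections of `W`, and so is orthogonal to every simple root. -/
theorem span_roots_eq_top_of_le [Nontrivial ι] (hα : SimpleSystem W α)
    {W' : Subgroup (OrthGroup n)} (hW' : IsReflectionGroup W')
    (hle : orientationPreserving W ≤ W') : Submodule.span ℝ (roots W') = ⊤ := by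
  rw [← Submodule.orthogonal_eq_bot_iff, Submodule.eq_bot_iff]
  intro v hv
  have hfix {g : OrthGroup n} (hg : g ∈ W') : g v = v := by
    rw [eq_closure_roots hW'] at hg
    refine apply_eq_self_of_mem_closure ?_ hg
    rintro _ ⟨u, hu, rfl⟩
    exact refl_apply_eq_self_iff.mpr ((Submodule.mem_orthogonal _ _).mp hv u
      (Submodule.subset_span hu))
  rw [← inner_self_eq_zero (𝕜 := ℝ), inner_eq_sum α v v]
  refine Finset.sum_eq_zero fun j _ => ?_
  obtain ⟨i, hij⟩ := exists_ne j
  have := hfix (hle (mem_orientationPreserving.mpr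
    ⟨W.mul_mem (hα.refl_mem i) (hα.refl_mem j), by
      rw [map_mul, odet_refl (α.ne_zero i), odet_refl (α.ne_zero j)]; norm_num⟩))
  rw [real_inner_comm, (inner_eq_zero_of_refl_mul_refl hα hij this).2, mul_zero]

namespace IsExtendingPerm

theorem zpow_cases (h : IsExtendingPerm α σ) (t : ℤ) : σ ^ t = 1 ∨ σ ^ t = σ ∨ σ ^ t = σ⁻¹ := by
  rcases h.order with h | h
  · rcases Int.even_or_odd' t with ⟨k, rfl | rfl⟩
    · left
      rw [zpow_mul, zpow_ofNat, h, one_zpow]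
    · right; left
      rw [zpow_add, zpow_mul, zpow_ofNat, h, one_zpow, one_mul, zpow_one]
  · have h1 : t = 3 * (t / 3) + t % 3 := by omega
    have h2 : σ ^ t = σ ^ (t % 3) := by
      conv_lhs => rw [h1, zpow_add, zpow_mul, zpow_ofNat, h, one_zpow, one_mul]
    have h3 : t % 3 = 0 ∨ t % 3 = 1 ∨ t % 3 = 2 := by omega
    rcases h3 with h3 | h3 | h3 <;> rw [h2, h3]
    · left; rfl
    · right; left; rfl
    · right; right
      rw [eq_inv_iff_mul_eq_one, ← zpow_add_one]
      exact h

theorem ne_one (h : IsExtendingPerm α σ) : σ ≠ 1 := by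
  rintro rfl
  obtain ⟨e, -, i, j, k, -, -, -, ⟨l, hl, hl'⟩, -⟩ := h.frame
  exact hl hl'

theorem notMem (h : IsExtendingPerm α σ) (hα : SimpleSystem W α)
    (hσ : ∀ i, a (α i) = α (σ i)) : a ∉ W := by
  intro ha
  apply h.ne_one
  have := hα.eq_one_of_perm ha hσ
  ext i
  have hi := hσ i
  rw [this, one_apply] at hi
  exact (α.injective hi).symm

/-- A power of `a` is `1`, `a` or `a⁻¹`, and the last two are rotations. -/
theorem zpow_eq_one (h : IsExtendingPerm α σ)
    (hσ : ∀ i, a (α i) = α (σ i)) (t : ℤ)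
    (hr : n ≤ Module.finrank ℝ (fixedSpace (a ^ t)) + 1) : a ^ t = 1 := by
  have hrot := isRotation_of_shape hσ h.shape
  unfold IsRotation at hrot
  have hext {b : OrthGroup n} (hb : ∀ i, b (α i) = α ((σ ^ t) i)) : a ^ t = b :=
    ext_basis α fun i => by rw [perm_zpow hσ, hb]
  rcases h.zpow_cases t with h1 | h1 | h1
  · exact eq_one_of_perm_eq_one (perm_zpow hσ t) h1
  · rw [hext (b := a) (fun i => by rw [h1, hσ])] at hr
    omega
  · rw [hext (b := a⁻¹) (fun i => by rw [h1, perm_inv hσ]), fixedSpace_inv] at hr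
    omega

end IsExtendingPerm

end Extension
end ReflectionGroup

/-! ### The extension is not an orientation preserving subgroup, and is unique. -/

namespace ReflectionGroup
variable {n : ℕ}

section Extending
variable {ι : Type} [Fintype ι] [DecidableEq ι] {W : Subgroup (OrthGroup n)}
  {α : Module.Basis ι ℝ (Euc n)} {σ : Equiv.Perm ι} {a : OrthGroup n}

theorem chamber_dual_fixed (hα : SimpleSystem W α) (hσ : ∀ i, a (α i) = α (σ i)) {x : Euc n}
    (hx : Chamber α x) {w : OrthGroup n} (hw : w ∈ W) {t : ℤ} (h : (w * a ^ t) x = x) :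
    (a ^ t) x = x := by
  have hc : Chamber α ((a ^ t) x) := SimpleSystem.chamber_perm (perm_zpow hσ t) hx
  rw [mul_apply] at h
  have := (hα.chamber_eq hw hc (by rw [h]; exact hx)).1
  rw [← this, h]

namespace IsExtendingPerm

/-- Here `ρ` is a root of `W'` in the plane of the order three rotation `c = s_i s_j`. The conjugate
of `s_k c s_k` by `s_ρ` lies in `W'⁺` and turns out to be in the stabilizer in `W` of a chamber
point, a group of cube symmetries; this determines `ρ` up to finitely many choices, all giving
reflections of `W`. -/
theorem exists_refl_mem [Finite W] (h : IsExtendingPerm α σ) (hα : SimpleSystem W α)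
    (hσ : ∀ i, a (α i) = α (σ i)) {W' : Subgroup (OrthGroup n)} (hW' : IsReflectionGroup W')
    (he : extendedGroup W a = orientationPreserving W') :
    ∃ ρ : Euc n, ‖ρ‖ = 1 ∧ refl ρ ∈ W ∧ refl ρ ∈ W' := by
  obtain ⟨e, heo, i, j, k, hi, hj, hk, ⟨l₁, hl₁, hl₁'⟩, l₂, hl₂, hl₂'⟩ := h.frame
  have : Nontrivial ι := ⟨l₁, i, fun h => hl₁ (Or.inl h)⟩
  have hle : extendedGroup W a ≤ W' := by rw [he]; exact inf_le_left
  have hWle : orientationPreserving W ≤ W' := fun g hg =>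
    hle (Subgroup.subset_closure (Or.inl hg))
  have := hW'.1
  obtain ⟨κ, _, β, hβ, -⟩ := exists_simpleSystem hW' (span_roots_eq_top_of_le hα hW' hWle)
  set c := refl (α i) * refl (α j) with hc
  have hcW : c ∈ W := W.mul_mem (hα.refl_mem i) (hα.refl_mem j)
  have hcd : odet n c = 1 := by
    rw [hc, map_mul, odet_refl (α.ne_zero i), odet_refl (α.ne_zero j)]; norm_num
  have hc1 : c ≠ 1 := by
    intro h1
    have h2 : refl (α i) (refl (α j) (α j)) = α j := by
      rw [← mul_apply, ← hc, h1, one_apply]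
    have hij : i ≠ j := by
      rintro rfl
      have h3 : refl (e 0 - e 1) = refl (e 1 - e 2) := by rw [← hi, ← hj]
      have h4 : refl (e 1 - e 2) (e 0) = e 0 := by
        rw [refl_apply_eq_self_iff, inner_sub_left, inner_of_orthonormal heo,
          inner_of_orthonormal heo]
        simp
      rw [← h3, refl_sub_left (by rw [heo.1, heo.1])] at h4
      have h5 := inner_of_orthonormal heo 0 1
      rw [h4, inner_of_orthonormal heo] at h5
      simp at h5
    have h3 := (inner_eq_zero_of_refl_mul_refl hα hij h2).2
    rw [inner_self_of_norm (hα.norm j)] at h3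
    norm_num at h3
  obtain ⟨u, huW', m, hum⟩ := hβ.exists_root_orthogonal_fixed
    (hWle (mem_orientationPreserving.mpr ⟨hcW, hcd⟩)) hc1
  set ρ := u (β m) with hρ
  have hρ1 : ‖ρ‖ = 1 := hβ.apply_norm u m
  have hρW' : refl ρ ∈ W' := by
    rw [hρ, ← conj_refl]
    exact W'.mul_mem (W'.mul_mem huW' (hβ.refl_mem m)) (W'.inv_mem huW')
  refine ⟨ρ, hρ1, ?_, hρW'⟩
  -- A chamber point whose stabilizer in `W` is generated by the simple reflections numbered `i`,
  -- `j`, `k`.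
  obtain ⟨x, hx⟩ := exists_dual α fun l => if l = i ∨ l = j ∨ l = k then (0 : ℝ) else 1
  have hx0 {l : ι} (hl : l = i ∨ l = j ∨ l = k) : ⟪x, α l⟫ = 0 := by rw [hx, if_pos hl]
  have hx1 {l : ι} (hl : ¬(l = i ∨ l = j ∨ l = k)) : ⟪x, α l⟫ = 1 := by rw [hx, if_neg hl]
  have hxc : Chamber α x := by
    intro l
    rw [hx]
    split_ifs <;> norm_num
  have hfix {l : ι} (hl : l = i ∨ l = j ∨ l = k) : refl (α l) x = x := by
    rw [refl_apply_eq_self_iff, real_inner_comm, hx0 hl]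
  have hcx : c x = x := by
    rw [hc, mul_apply, hfix (Or.inr (Or.inl rfl)), hfix (Or.inl rfl)]
  have hρx : refl ρ x = x := by
    rw [refl_apply_eq_self_iff, real_inner_comm]
    exact hum x hcx
  set g := refl ρ * refl (α k) * c * (refl ρ * refl (α k))⁻¹ with hg
  have hgx : g x = x := by
    have h1 : (refl ρ * refl (α k)) x = x := by
      rw [mul_apply, hfix (Or.inr (Or.inr rfl)), hρx]
    rw [hg, mul_apply, mul_apply, inv_apply_eq.mpr h1.symm, hcx, h1]
  have hgd : odet n g = 1 := by
    have h1 : (refl ρ * refl (α k))⁻¹ = refl (α k) * refl ρ := by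
      rw [mul_inv_rev, refl_inv, refl_inv]
    rw [hg, h1]
    simp only [map_mul, hcd, odet_refl (α.ne_zero k), odet_refl (ne_zero_of_norm hρ1)]
    norm_num
  have hgW' : g ∈ W' := by
    have h1 : refl (α k) * c * refl (α k) ∈ W' := by
      refine hWle (mem_orientationPreserving.mpr
        ⟨W.mul_mem (W.mul_mem (hα.refl_mem k) hcW) (hα.refl_mem k), ?_⟩)
      simp only [map_mul, hcd, odet_refl (α.ne_zero k)]
      norm_num
    have h2 : g = refl ρ * (refl (α k) * c * refl (α k)) * refl ρ := by
      rw [hg, mul_inv_rev, refl_inv, refl_inv]; simp only [mul_assoc]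
    rw [h2]
    exact W'.mul_mem (W'.mul_mem hρW' h1) hρW'
  have hgE : g ∈ Subgroup.closure ((W : Set (OrthGroup n)) ∪ {a}) := by
    refine extendedGroup_le (a := a) W.one_mem (one_mul a).symm ?_
    rw [he]
    exact mem_orientationPreserving.mpr ⟨hgW', hgd⟩
  obtain ⟨w, hw, t, hwt⟩ := exists_mul_zpow_of_mem_closure (hα.normalizes_of_perm hσ) hgE
  have hat : (a ^ t) x = x := chamber_dual_fixed hα hσ hxc hw (by rw [← hwt]; exact hgx)
  have hinv (l : ι) : ⟪x, α ((σ ^ t) l)⟫ = ⟪x, α l⟫ := by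
    rw [← perm_zpow hσ, ← inner_map (a ^ t) x (α l), hat]
  -- `σ ^ t` preserves the triple `i`, `j`, `k`, whereas each of `σ` and `σ⁻¹` moves an index from
  -- outside into it.
  have hσt : σ ^ t = 1 := by
    rcases h.zpow_cases t with h1 | h1 | h1
    · exact h1
    · have := hinv l₁
      rw [h1, hx0 hl₁', hx1 hl₁] at this
      norm_num at this
    · have := hinv l₂
      rw [h1, hx0 hl₂', hx1 hl₂] at this
      norm_num at this
  have hgw : g = w := by
    rw [hwt, eq_one_of_perm_eq_one (perm_zpow hσ t) hσt, mul_one]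
  have hgp : g ∈ Subgroup.closure {g | ∃ l, ⟪x, α l⟫ = 0 ∧ g = refl (α l)} := by
    refine (hα.chamber_eq (hgw ▸ hw) hxc ?_).2
    rw [hgx]; exact hxc
  have hpres : PreservesFrame e g := by
    refine preservesFrame_of_mem_closure ?_ hgp
    rintro _ ⟨l, hl, rfl⟩
    have hl' : l = i ∨ l = j ∨ l = k := by
      by_contra hn
      rw [hx1 hn] at hl
      norm_num at hl
    rcases hl' with rfl | rfl | rfl
    · rw [hi]; exact preservesFrame_refl_sub heo _ _
    · rw [hj]; exact preservesFrame_refl_sub heo _ _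
    · rcases hk with hk | hk <;> rw [hk]
      · exact preservesFrame_refl_add heo _ _
      · exact preservesFrame_refl heo _
  obtain ⟨κ, hκ, hkκ⟩ : ∃ κ : Euc n, (κ = e 1 + e 2 ∨ κ = e 2) ∧ refl (α k) = refl κ := by
    rcases hk with hk | hk
    · exact ⟨_, Or.inl rfl, hk⟩
    · exact ⟨_, Or.inr rfl, hk⟩
  refine refl_mem_of_preservesFrame heo (by rw [← hi]; exact hα.refl_mem i)
    (by rw [← hj]; exact hα.refl_mem j) hκ hρ1 ?_ ?_
  · intro y hy
    apply hum
    rw [hc, mul_apply, hi, hj, hy]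
  · rw [← hi, ← hj, ← hkκ]
    exact hpres

/-- With a common reflection `refl ρ`, every reflection of `W'` is `w * a ^ t`. It normalizes `W`,
and its diagram part fixes a subspace of codimension at most one, so `a ^ t = 1`. Thus `W' ≤ W`,
although `a ∈ W'` and `a ∉ W`. -/
theorem not_orientationPreserving [Finite W] (h : IsExtendingPerm α σ) (hα : SimpleSystem W α)
    (hσ : ∀ i, a (α i) = α (σ i)) :
    ¬ ∃ W' : Subgroup (OrthGroup n), IsReflectionGroup W' ∧
      extendedGroup W a = orientationPreserving W' := by
  rintro ⟨W', hW', he⟩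
  obtain ⟨ρ, hρ1, hρW, hρW'⟩ := h.exists_refl_mem hα hσ hW' he
  have hnorm := hα.normalizes_of_perm hσ
  apply h.notMem hα hσ
  suffices hle : W' ≤ W by
    apply hle
    have h1 : a ∈ orientationPreserving W' := by rw [← he]; exact self_mem_extendedGroup
    exact (mem_orientationPreserving.mp h1).1
  rw [eq_closure_roots hW', Subgroup.closure_le]
  rintro _ ⟨v, ⟨hv1, hv⟩, rfl⟩
  have hv0 := ne_zero_of_norm hv1
  obtain ⟨w, hw, t, hwt⟩ : ∃ w ∈ W, ∃ t : ℤ, refl v = w * a ^ t := by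
    apply exists_mul_zpow_of_mem_closure hnorm
    have h1 : refl v * refl ρ ∈ Subgroup.closure ((W : Set (OrthGroup n)) ∪ {a}) := by
      refine extendedGroup_le (a := a) W.one_mem (one_mul a).symm ?_
      rw [he]
      refine mem_orientationPreserving.mpr ⟨W'.mul_mem hv hρW', ?_⟩
      rw [map_mul, odet_refl hv0, odet_refl (ne_zero_of_norm hρ1)]; norm_num
    have h2 := Subgroup.mul_mem _ h1 (Subgroup.subset_closure (Or.inl hρW))
    rwa [mul_assoc, refl_mul_self, mul_one] at h2
  have hmaps {g : OrthGroup n} (hg : g ∈ W) : refl v * g * (refl v)⁻¹ ∈ W := by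
    rw [hwt, mul_inv_rev, show w * a ^ t * g * ((a ^ t)⁻¹ * w⁻¹) =
      w * (a ^ t * g * (a ^ t)⁻¹) * w⁻¹ by group]
    exact W.mul_mem (W.mul_mem hw (conj_zpow_mem hnorm t hg)) (W.inv_mem hw)
  obtain ⟨w', hw', b, τ, hτ, hb, hrank⟩ := hα.exists_decomposition (b := refl v) fun g => by
    refine ⟨hmaps, fun hg => ?_⟩
    have h1 := hmaps hg
    have h2 : refl v * (refl v * g * (refl v)⁻¹) * (refl v)⁻¹ =
        (refl v * refl v) * g * (refl v * refl v)⁻¹ := by group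
    rwa [h2, refl_mul_self, inv_one, one_mul, mul_one] at h1
  -- `b` and `a ^ t` differ by an element of `W` permuting the simple roots, which is trivial.
  have hba : b = a ^ t := by
    rw [← mul_inv_eq_one]
    refine hα.eq_one_of_perm (σ := τ * (σ ^ t)⁻¹) ?_ fun i => ?_
    · have h1 : b * (a ^ t)⁻¹ = w'⁻¹ * w := by
        have h2 : w' * b = w * a ^ t := by rw [← hb, hwt]
        rw [mul_inv_eq_iff_eq_mul, mul_assoc, ← h2, inv_mul_cancel_left]
      rw [h1]
      exact W.mul_mem (W.inv_mem hw') hw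
    · rw [mul_apply, perm_inv (perm_zpow hσ t), hτ]; rfl
  have hr : IsReflection (refl v) := isReflection_refl hv0
  unfold IsReflection at hr
  have h1 : a ^ t = 1 := h.zpow_eq_one hσ t (by rw [← hba]; omega)
  rw [h1, mul_one] at hwt
  show refl v ∈ W
  rw [hwt]; exact hw

theorem isExtendingRotation [Finite W] (h : IsExtendingPerm α σ) (hα : SimpleSystem W α)
    (hσ : ∀ i, a (α i) = α (σ i)) : IsExtendingRotation W a := by
  obtain ⟨e, -, i, -⟩ := h.frame
  have : Nonempty ι := ⟨i⟩
  have hrot := isRotation_of_shape hσ h.shape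
  have hnorm := hα.normalizes_of_perm hσ
  refine ⟨hrot, ?_, h.notMem hα hσ, hnorm, fun g => ?_,
    isRotationGroup_extendedGroup hα hσ hrot, h.not_orientationPreserving hα hσ⟩
  · rw [mem_SOGroup, odet_of_perm α hσ, h.sign]; norm_num
  · have hd : odet n (a * g * a⁻¹) = odet n g := by
      have h1 := (odet n).map_mul a a⁻¹
      rw [mul_inv_cancel, map_one] at h1
      rw [map_mul, map_mul, mul_right_comm, ← h1, one_mul]
    rw [mem_orientationPreserving, mem_orientationPreserving, hd, hnorm g]

/-- The diagram part of `b` is not trivial and not a transposition, so it is `a` or `a⁻¹`. Both have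
determinant one, hence the factor from `W` lies in `W⁺`. -/
theorem extendedGroup_eq (h : IsExtendingPerm α σ) (hW : IsReflectionGroup W)
    (hα : SimpleSystem W α) (hσ : ∀ i, a (α i) = α (σ i)) {b : OrthGroup n}
    (hb : IsExtendingRotation W b) : extendedGroup W b = extendedGroup W a := by
  have := hW.1
  have ha1 : odet n a = 1 := by rw [odet_of_perm α hσ, h.sign]; norm_num
  obtain ⟨w, hw, c, τ, hτ, rfl, hshape⟩ := exists_perm_of_isExtendingRotation hW hα hb
  have hrot := isRotation_of_shape hτ hshape
  unfold IsRotation at hrot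
  have hd := mem_SOGroup.mp hb.mem_SO
  have key {b' : OrthGroup n} (hd' : odet n b' = 1)
      (hb' : odet n (w * b') = 1) : w ∈ orientationPreserving W := by
    rw [map_mul, hd', mul_one] at hb'
    exact mem_orientationPreserving.mpr ⟨hw, hb'⟩
  have hext {b' : OrthGroup n} (hb' : ∀ i, b' (α i) = α (τ i)) : c = b' :=
    ext_basis α fun i => by rw [hτ, hb']
  have hinv : odet n a⁻¹ = 1 := by
    have h1 := (odet n).map_mul a a⁻¹
    rwa [mul_inv_cancel, map_one, ha1, one_mul, eq_comm] at h1
  have final {b' : OrthGroup n} (hd' : odet n b' = 1) (hcb : c = b')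
      (hm : b' ∈ extendedGroup W a) (hm' : ∀ G : Subgroup (OrthGroup n), b' ∈ G → a ∈ G) :
      extendedGroup W (w * c) = extendedGroup W a := by
    subst hcb
    have hwW := key hd' hd
    apply le_antisymm
    · rw [extendedGroup, Subgroup.closure_le]
      rintro g (hg | rfl)
      · exact Subgroup.subset_closure (Or.inl hg)
      · exact Subgroup.mul_mem _ (Subgroup.subset_closure (Or.inl hwW)) hm
    · rw [extendedGroup, Subgroup.closure_le]
      rintro g (hg | rfl)
      · exact Subgroup.subset_closure (Or.inl hg)
      · apply hm'
        have h1 : w ∈ extendedGroup W (w * c) := Subgroup.subset_closure (Or.inl hwW)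
        have h2 := Subgroup.mul_mem _ (Subgroup.inv_mem _ h1) (self_mem_extendedGroup (W := W)
          (a := w * c))
        rwa [inv_mul_cancel_left] at h2
  rcases h.eq_of_inner_eq τ (fun i j => by rw [← hτ, ← hτ, inner_map]) with h1 | h1 | h1 | h1
  · have h2 := eq_one_of_perm_eq_one hτ h1
    have h3 : fixedSpace (1 : OrthGroup n) = ⊤ := by
      rw [eq_top_iff]; exact fun x _ => mem_fixedSpace.mpr (one_apply x)
    rw [h2, h3, finrank_top, finrank_euclideanSpace_fin] at hrot
    omega
  · exact final ha1 (hext (b' := a) fun i => by rw [hσ, h1]) self_mem_extendedGroup fun _ => id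
  · exact final hinv (hext (b' := a⁻¹) fun i => by rw [perm_inv hσ, h1])
      (Subgroup.inv_mem _ self_mem_extendedGroup) fun G hG => by
        simpa using G.inv_mem hG
  · obtain ⟨x, x', h1⟩ := h1
    have := finrank_swap hτ h1
    unfold IsReflection at this
    omega

theorem existsUnique (h : IsExtendingPerm α σ) (hW : IsReflectionGroup W)
    (hα : SimpleSystem W α) : (∃ b, IsExtendingRotation W b) ∧
      ∃! G : Subgroup (OrthGroup n), ∃ b, IsExtendingRotation W b ∧ G = extendedGroup W b := by
  have := hW.1
  obtain ⟨a, hσ⟩ := exists_isometry α σ h.inner_eq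
  have ha := h.isExtendingRotation hα hσ
  refine ⟨⟨a, ha⟩, extendedGroup W a, ⟨a, ha, rfl⟩, ?_⟩
  rintro _ ⟨b, hb, rfl⟩
  exact h.extendedGroup_eq hW hα hσ hb

end IsExtendingPerm

end Extending
end ReflectionGroup

/-! ### The five types. -/

namespace ReflectionGroup
variable {n : ℕ}

section Frames

/-- A₃ is D₃: with `m` the middle node, solve `√2 m = e₀ - e₁`, `√2 p = e₁ - e₂`, `√2 q = e₁ + e₂`.
-/
theorem exists_frame_of_A3 {m p q : Euc n} (hm : ‖m‖ = 1) (hp : ‖p‖ = 1) (hq : ‖q‖ = 1)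
    (hmp : ⟪m, p⟫ = -(1 / 2)) (hmq : ⟪m, q⟫ = -(1 / 2)) (hpq : ⟪p, q⟫ = 0) :
    ∃ e : Fin 3 → Euc n, Orthonormal ℝ e ∧ refl m = refl (e 0 - e 1) ∧
      refl p = refl (e 1 - e 2) ∧ refl q = refl (e 1 + e 2) := by
  obtain ⟨s, hs⟩ : ∃ s : ℝ, s * s = 2 := ⟨√2, Real.mul_self_sqrt (by norm_num)⟩
  have hs0 : s ≠ 0 := by rintro rfl; norm_num at hs
  have hm' := inner_self_of_norm hm
  have hp' := inner_self_of_norm hp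
  have hq' := inner_self_of_norm hq
  have hpm := (real_inner_comm m p).trans hmp
  have hqm := (real_inner_comm m q).trans hmq
  have hqp := (real_inner_comm p q).trans hpq
  refine ⟨![s • m + (s / 2) • (p + q), (s / 2) • (p + q), (s / 2) • (q - p)], ?_, ?_, ?_, ?_⟩
  · rw [orthonormal_iff_ite]
    intro i j
    fin_cases i <;> fin_cases j <;>
      simp [-inner_self_eq_norm_sq_to_K, inner_add_left,
        inner_add_right, inner_sub_left, inner_sub_right, real_inner_smul_left,
        real_inner_smul_right, hm', hp', hq', hmp, hmq, hpq, hpm, hqm, hqp] <;>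
      linarith
  · rw [← refl_smul hs0 m]; simp
  · rw [← refl_smul hs0 p]
    congr 1
    simp only [Matrix.cons_val]
    module
  · rw [← refl_smul hs0 q]
    congr 1
    simp only [Matrix.cons_val]
    module

/-- Solve `√2 p = e₀ - e₁`, `√2 m = e₁ - e₂`, `q = e₂`. -/
theorem exists_frame_of_B3 {p m q : Euc n} (hp : ‖p‖ = 1) (hm : ‖m‖ = 1) (hq : ‖q‖ = 1)
    (hpm : ⟪p, m⟫ = -(1 / 2)) (hmq : ⟪m, q⟫ = -(√2 / 2)) (hpq : ⟪p, q⟫ = 0) :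
    ∃ e : Fin 3 → Euc n, Orthonormal ℝ e ∧ refl p = refl (e 0 - e 1) ∧
      refl m = refl (e 1 - e 2) ∧ refl q = refl (e 2) := by
  have hs : √2 * √2 = (2 : ℝ) := Real.mul_self_sqrt (by norm_num)
  obtain ⟨s, hs'⟩ : ∃ s : ℝ, s = √2 := ⟨_, rfl⟩
  rw [← hs'] at hs hmq
  have hs0 : s ≠ 0 := by rintro rfl; norm_num at hs
  have hm' := inner_self_of_norm hm
  have hp' := inner_self_of_norm hp
  have hq' := inner_self_of_norm hq
  have hmp := (real_inner_comm m p).symm.trans hpm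
  have hqm := (real_inner_comm m q).trans hmq
  have hqp := (real_inner_comm p q).trans hpq
  refine ⟨![s • p + (s • m + q), s • m + q, q], ?_, ?_, ?_, rfl⟩
  · rw [orthonormal_iff_ite]
    intro i j
    fin_cases i <;> fin_cases j <;>
      simp [-inner_self_eq_norm_sq_to_K, inner_add_left,
        inner_add_right, real_inner_smul_left,
        real_inner_smul_right, hm', hp', hq', hmp, hmq, hpq, hpm, hqm, hqp] <;>
      linarith
  · rw [← refl_smul hs0 p]; simp
  · rw [← refl_smul hs0 m]; simp

end Frames

section Types
variable {ι : Type} [Fintype ι] {M : CoxeterMatrix ι} {α : Module.Basis ι ℝ (Euc n)}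

theorem eq_of_cos_eq {m m' : ℕ} (hm : m ≠ 0) (hm' : m' ≠ 0)
    (h : Real.cos (Real.pi / m) = Real.cos (Real.pi / m')) : m = m' := by
  have H {k : ℕ} (hk : k ≠ 0) : Real.pi / k ∈ Set.Icc 0 Real.pi :=
    ⟨by positivity, div_le_self Real.pi_pos.le (by exact_mod_cast Nat.one_le_iff_ne_zero.mpr hk)⟩
  have h1 := Real.injOn_cos (H hm) (H hm') h
  have hp := Real.pi_ne_zero
  have hm0 : (m : ℝ) ≠ 0 := by exact_mod_cast hm
  have hm0' : (m' : ℝ) ≠ 0 := by exact_mod_cast hm'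
  rw [div_eq_div_iff hm0 hm0'] at h1
  exact_mod_cast (mul_left_cancel₀ hp h1).symm

/-- The entries of a Coxeter matrix, with the type `ℕ` in plain sight of instance search. -/
def label (M : CoxeterMatrix ι) (i j : ι) : ℕ := M i j

/-- The members of `α` are unit vectors with the angles prescribed by `M`. -/
def HasGram (α : Module.Basis ι ℝ (Euc n)) (M : CoxeterMatrix ι) : Prop :=
  ∀ i j, ⟪α i, α j⟫ = -Real.cos (Real.pi / (M i j : ℝ))

namespace HasGram

theorem norm (h : HasGram α M) (i : ι) : ‖α i‖ = 1 :=
  norm_of_inner_self (by rw [h, M.diagonal]; simp)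

theorem inner_of_two (h : HasGram α M) {i j : ι} (hij : M i j = 2) : ⟪α i, α j⟫ = 0 :=
  (h i j).trans (eq_cos_of_two hij rfl).symm

theorem inner_of_three (h : HasGram α M) {i j : ι} (hij : M i j = 3) : ⟪α i, α j⟫ = -(1 / 2) :=
  (h i j).trans (eq_cos_of_three hij rfl).symm

theorem inner_of_four (h : HasGram α M) {i j : ι} (hij : M i j = 4) : ⟪α i, α j⟫ = -(√2 / 2) :=
  (h i j).trans (eq_cos_of_four hij rfl).symm

theorem inner_eq_iff (h : HasGram α M) (hM : ∀ i j, label M i j ≠ 0) {i j i' j' : ι} :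
    ⟪α i', α j'⟫ = ⟪α i, α j⟫ ↔ label M i' j' = label M i j := by
  rw [h, h, neg_inj]
  exact ⟨eq_of_cos_eq (hM _ _) (hM _ _), fun h => congrArg (fun k : ℕ => Real.cos (Real.pi / k)) h⟩

theorem simpleSystem_of_simplyLaced {W : Subgroup (OrthGroup n)} (h : HasGram α M)
    (hW : W = Subgroup.closure (Set.range fun i => refl (α i)))
    (hM : ∀ i j, i ≠ j → label M i j = 2 ∨ label M i j = 3) : SimpleSystem W α := by
  refine simpleSystem_of_lattice h.norm hW (fun i j hij => ?_) fun l =>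
    ⟨fun _ => 1, rfl, fun i => ⟨1, by norm_num⟩, fun i j => ?_⟩
  · rcases hM i j hij with h1 | h1
    · rw [h.inner_of_two h1]
    · rw [h.inner_of_three h1]; norm_num
  · by_cases hij : i = j
    · rw [hij, inner_self_of_norm (h.norm j)]
      exact ⟨2, by norm_num⟩
    · rcases hM i j hij with h1 | h1
      · rw [h.inner_of_two h1]; exact ⟨0, by norm_num⟩
      · rw [h.inner_of_three h1]; exact ⟨-1, by norm_num⟩

theorem simpleSystem_of_F₄ {α : Module.Basis (Fin 4) ℝ (Euc n)} {W : Subgroup (OrthGroup n)}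
    (h : HasGram α CoxeterMatrix.F₄)
    (hW : W = Subgroup.closure (Set.range fun i => refl (α i))) : SimpleSystem W α := by
  have hM : ∀ i j, i ≠ j → label CoxeterMatrix.F₄ i j = 2 ∨ label CoxeterMatrix.F₄ i j = 3 ∨
    label CoxeterMatrix.F₄ i j = 4 := by decide
  have hs : √2 * √2 = (2 : ℝ) := Real.mul_self_sqrt (by norm_num)
  have i01 := h.inner_of_three (i := 0) (j := 1) rfl
  have i02 := h.inner_of_two (i := 0) (j := 2) rfl
  have i03 := h.inner_of_two (i := 0) (j := 3) rfl
  have i12 := h.inner_of_four (i := 1) (j := 2) rfl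
  have i13 := h.inner_of_two (i := 1) (j := 3) rfl
  have i23 := h.inner_of_three (i := 2) (j := 3) rfl
  have i10 := h.inner_of_three (i := 1) (j := 0) rfl
  have i20 := h.inner_of_two (i := 2) (j := 0) rfl
  have i30 := h.inner_of_two (i := 3) (j := 0) rfl
  have i21 := h.inner_of_four (i := 2) (j := 1) rfl
  have i31 := h.inner_of_two (i := 3) (j := 1) rfl
  have i32 := h.inner_of_three (i := 3) (j := 2) rfl
  have ii (i : Fin 4) := inner_self_of_norm (h.norm i)
  refine simpleSystem_of_lattice h.norm hW (fun i j hij => ?_) fun l => ?_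
  · rcases hM i j hij with h1 | h1 | h1
    · rw [h.inner_of_two h1]
    · rw [h.inner_of_three h1]; norm_num
    · rw [h.inner_of_four h1]
      have := Real.sqrt_nonneg 2
      linarith
  -- The half of the diagram containing `l` is scaled to length one and the other half to `√2`. The
  -- integer matrices are the F₄ Cartan matrix and its transpose.
  · by_cases hl : l = 0 ∨ l = 1
    · refine ⟨![1, 1, √2, √2], ?_, fun i => ⟨![1, 1, 2, 2] i, ?_⟩, fun i j =>
        ⟨!![2, -1, 0, 0; -1, 2, -1, 0; 0, -2, 2, -1; 0, 0, -1, 2] i j, ?_⟩⟩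
      · rcases hl with rfl | rfl <;> rfl
      · fin_cases i <;> simp
      · fin_cases i <;> fin_cases j <;>
          simp [-inner_self_eq_norm_sq_to_K, *] <;> linarith
    · refine ⟨![√2, √2, 1, 1], ?_, fun i => ⟨![2, 2, 1, 1] i, ?_⟩, fun i j =>
        ⟨!![2, -1, 0, 0; -1, 2, -2, 0; 0, -1, 2, -1; 0, 0, -1, 2] i j, ?_⟩⟩
      · fin_cases l <;> simp at hl ⊢
      · fin_cases i <;> simp
      · fin_cases i <;> fin_cases j <;>
          simp [-inner_self_eq_norm_sq_to_K, *] <;> linarith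

theorem isExtendingPerm_A₄ {α : Module.Basis (Fin 4) ℝ (Euc n)}
    (h : HasGram α (CoxeterMatrix.A 4)) :
    IsExtendingPerm α (Equiv.swap 0 3 * Equiv.swap 1 2) := by
  have hi := fun i j i' j' => h.inner_eq_iff (by decide) (i := i) (j := j) (i' := i') (j' := j')
  refine ⟨fun i j => (hi _ _ _ _).mpr (by revert i j; decide), by decide,
    Or.inr ⟨0, 3, 1, 2, by unfold IsDoubleSwapOn; decide⟩, Or.inl (by decide), fun τ hτ => ?_, ?_⟩
  · have hM := fun i j => (hi _ _ _ _).mp (hτ i j)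
    -- An automorphism maps the path to a walk without backtracking, and there are only two of full
    -- length.
    have key : ∀ a b : Fin 4, label (CoxeterMatrix.A 4) a b = 3 → ∀ c, a ≠ c → label (CoxeterMatrix.A 4) b c = 3 →
        ∀ d, b ≠ d → label (CoxeterMatrix.A 4) c d = 3 →
        (a = 0 ∧ b = 1 ∧ c = 2 ∧ d = 3) ∨ (a = 3 ∧ b = 2 ∧ c = 1 ∧ d = 0) := by decide
    rcases key _ _ (hM 0 1) _ (τ.injective.ne (by decide)) (hM 1 2) _ (τ.injective.ne (by decide))
      (hM 2 3) with ⟨h0, h1, h2, h3⟩ | ⟨h0, h1, h2, h3⟩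
    · left; ext1 i; fin_cases i <;> assumption
    · right; left; ext1 i; fin_cases i <;> assumption
  · obtain ⟨e, he, hm, hp, hq⟩ := exists_frame_of_A3 (h.norm 1) (h.norm 0) (h.norm 2)
      (h.inner_of_three rfl) (h.inner_of_three rfl) (h.inner_of_two rfl)
    exact ⟨e, he, 1, 0, 2, hm, hp, Or.inl hq, ⟨3, by decide, by decide⟩, ⟨3, by decide, by decide⟩⟩

theorem isExtendingPerm_A₅ {α : Module.Basis (Fin 5) ℝ (Euc n)}
    (h : HasGram α (CoxeterMatrix.A 5)) :
    IsExtendingPerm α (Equiv.swap 0 4 * Equiv.swap 1 3) := by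
  have hi := fun i j i' j' => h.inner_eq_iff (by decide) (i := i) (j := j) (i' := i') (j' := j')
  refine ⟨fun i j => (hi _ _ _ _).mpr (by revert i j; decide), by decide,
    Or.inr ⟨0, 4, 1, 3, by unfold IsDoubleSwapOn; decide⟩, Or.inl (by decide), fun τ hτ => ?_, ?_⟩
  · have hM := fun i j => (hi _ _ _ _).mp (hτ i j)
    have key : ∀ a b : Fin 5, label (CoxeterMatrix.A 5) a b = 3 → ∀ c, a ≠ c → label (CoxeterMatrix.A 5) b c = 3 →
        ∀ d, b ≠ d → label (CoxeterMatrix.A 5) c d = 3 → ∀ e, c ≠ e → label (CoxeterMatrix.A 5) d e = 3 →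
        (a = 0 ∧ b = 1 ∧ c = 2 ∧ d = 3 ∧ e = 4) ∨
          (a = 4 ∧ b = 3 ∧ c = 2 ∧ d = 1 ∧ e = 0) := by decide
    rcases key _ _ (hM 0 1) _ (τ.injective.ne (by decide)) (hM 1 2) _ (τ.injective.ne (by decide))
      (hM 2 3) _ (τ.injective.ne (by decide)) (hM 3 4) with
      ⟨h0, h1, h2, h3, h4⟩ | ⟨h0, h1, h2, h3, h4⟩
    · left; ext1 i; fin_cases i <;> assumption
    · right; left; ext1 i; fin_cases i <;> assumption
  · obtain ⟨e, he, hm, hp, hq⟩ := exists_frame_of_A3 (h.norm 1) (h.norm 0) (h.norm 2)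
      (h.inner_of_three rfl) (h.inner_of_three rfl) (h.inner_of_two rfl)
    exact ⟨e, he, 1, 0, 2, hm, hp, Or.inl hq, ⟨4, by decide, by decide⟩, ⟨4, by decide, by decide⟩⟩

theorem isExtendingPerm_E₆ {α : Module.Basis (Fin 6) ℝ (Euc n)}
    (h : HasGram α CoxeterMatrix.E₆) :
    IsExtendingPerm α (Equiv.swap 0 5 * Equiv.swap 2 4) := by
  have hi := fun i j i' j' => h.inner_eq_iff (by decide) (i := i) (j := j) (i' := i') (j' := j')
  refine ⟨fun i j => (hi _ _ _ _).mpr (by revert i j; decide), by decide,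
    Or.inr ⟨0, 5, 2, 4, by unfold IsDoubleSwapOn; decide⟩, Or.inl (by decide), fun τ hτ => ?_, ?_⟩
  · have hM := fun i j => (hi _ _ _ _).mp (hτ i j)
    -- The long path is 0, 2, 3, 4, 5. Node 1 hangs on 3 and is fixed, being the only one left.
    have key : ∀ a b : Fin 6, label CoxeterMatrix.E₆ a b = 3 → ∀ c, a ≠ c → label CoxeterMatrix.E₆ b c = 3 →
        ∀ d, b ≠ d → label CoxeterMatrix.E₆ c d = 3 → ∀ e, c ≠ e → label CoxeterMatrix.E₆ d e = 3 →
        (a = 0 ∧ b = 2 ∧ c = 3 ∧ d = 4 ∧ e = 5) ∨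
          (a = 5 ∧ b = 4 ∧ c = 3 ∧ d = 2 ∧ e = 0) := by decide
    have last : ∀ f : Fin 6, f ≠ 0 → f ≠ 2 → f ≠ 3 → f ≠ 4 → f ≠ 5 → f = 1 := by decide
    have hne (i : Fin 6) (hi : 1 ≠ i) : τ 1 ≠ τ i := τ.injective.ne hi
    have n0 := hne 0 (by decide)
    have n2 := hne 2 (by decide)
    have n3 := hne 3 (by decide)
    have n4 := hne 4 (by decide)
    have n5 := hne 5 (by decide)
    rcases key _ _ (hM 0 2) _ (τ.injective.ne (by decide)) (hM 2 3) _ (τ.injective.ne (by decide))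
      (hM 3 4) _ (τ.injective.ne (by decide)) (hM 4 5) with
      ⟨h0, h2, h3, h4, h5⟩ | ⟨h0, h2, h3, h4, h5⟩ <;> rw [h0] at n0 <;> rw [h2] at n2 <;>
      rw [h3] at n3 <;> rw [h4] at n4 <;> rw [h5] at n5
    · have h1 := last _ n0 n2 n3 n4 n5
      left; ext1 i; fin_cases i <;> assumption
    · have h1 := last _ n5 n4 n3 n2 n0
      right; left; ext1 i; fin_cases i <;> assumption
  · obtain ⟨e, he, hm, hp, hq⟩ := exists_frame_of_A3 (h.norm 2) (h.norm 0) (h.norm 3)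
      (h.inner_of_three rfl) (h.inner_of_three rfl) (h.inner_of_two rfl)
    exact ⟨e, he, 2, 0, 3, hm, hp, Or.inl hq, ⟨5, by decide, by decide⟩, ⟨5, by decide, by decide⟩⟩

theorem isExtendingPerm_F₄ {α : Module.Basis (Fin 4) ℝ (Euc n)}
    (h : HasGram α CoxeterMatrix.F₄) :
    IsExtendingPerm α (Equiv.swap 0 3 * Equiv.swap 1 2) := by
  have hi := fun i j i' j' => h.inner_eq_iff (by decide) (i := i) (j := j) (i' := i') (j' := j')
  refine ⟨fun i j => (hi _ _ _ _).mpr (by revert i j; decide), by decide,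
    Or.inr ⟨0, 3, 1, 2, by unfold IsDoubleSwapOn; decide⟩, Or.inl (by decide), fun τ hτ => ?_, ?_⟩
  · have hM := fun i j => (hi _ _ _ _).mp (hτ i j)
    have key : ∀ a b : Fin 4, label CoxeterMatrix.F₄ a b = 3 → ∀ c, label CoxeterMatrix.F₄ b c = 4 →
        ∀ d, label CoxeterMatrix.F₄ c d = 3 →
        (a = 0 ∧ b = 1 ∧ c = 2 ∧ d = 3) ∨ (a = 3 ∧ b = 2 ∧ c = 1 ∧ d = 0) := by decide
    rcases key _ _ (hM 0 1) _ (hM 1 2) _ (hM 2 3) with ⟨h0, h1, h2, h3⟩ | ⟨h0, h1, h2, h3⟩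
    · left; ext1 i; fin_cases i <;> assumption
    · right; left; ext1 i; fin_cases i <;> assumption
  · obtain ⟨e, he, hp, hm, hq⟩ := exists_frame_of_B3 (h.norm 0) (h.norm 1) (h.norm 2)
      (h.inner_of_three rfl) (h.inner_of_four rfl) (h.inner_of_two rfl)
    exact ⟨e, he, 0, 1, 2, hp, hm, Or.inr hq, ⟨3, by decide, by decide⟩, ⟨3, by decide, by decide⟩⟩

theorem isExtendingPerm_D₄ {α : Module.Basis (Fin 4) ℝ (Euc n)}
    (h : HasGram α coxeterMatrixD4) :
    IsExtendingPerm α (Equiv.swap 0 2 * Equiv.swap 2 3) := by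
  have hi := fun i j i' j' => h.inner_eq_iff (by decide) (i := i) (j := j) (i' := i') (j' := j')
  refine ⟨fun i j => (hi _ _ _ _).mpr (by revert i j; decide), by decide,
    Or.inl ⟨0, 2, 3, by unfold IsThreeCycleOn; decide⟩, Or.inr (by decide), fun τ hτ => ?_, ?_⟩
  · have hM := fun i j => (hi _ _ _ _).mp (hτ i j)
    -- Only the centre has two distinct neighbours, so the automorphisms are the six permutations of
    -- the leaves: the identity, `σ`, `σ⁻¹` and three transpositions.
    have center : ∀ b a : Fin 4, label coxeterMatrixD4 b a = 3 → ∀ c, a ≠ c →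
        label coxeterMatrixD4 b c = 3 → b = 1 := by decide
    have leaves : ∀ a c : Fin 4, a ≠ 1 → c ≠ 1 → a ≠ c → ∀ d, d ≠ 1 → a ≠ d → c ≠ d →
        (a, c, d) ∈ [(0, 2, 3), (2, 3, 0), (3, 0, 2), (2, 0, 3), (3, 2, 0), (0, 3, 2)] := by decide
    have hne {i j : Fin 4} (hij : i ≠ j) : τ i ≠ τ j := τ.injective.ne hij
    have h1 := center _ _ (hM 1 0) _ (hne (by decide)) (hM 1 2)
    have hc := leaves (τ 0) (τ 2) (by rw [← h1]; exact hne (by decide))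
      (by rw [← h1]; exact hne (by decide)) (hne (by decide)) (τ 3)
      (by rw [← h1]; exact hne (by decide)) (hne (by decide)) (hne (by decide))
    simp only [List.mem_cons, List.not_mem_nil, Prod.mk.injEq, or_false] at hc
    rcases hc with ⟨h0, h2, h3⟩ | ⟨h0, h2, h3⟩ | ⟨h0, h2, h3⟩ | ⟨h0, h2, h3⟩ | ⟨h0, h2, h3⟩ |
      ⟨h0, h2, h3⟩
    · left; ext1 i; fin_cases i <;> assumption
    · right; left; ext1 i; fin_cases i <;> assumption
    · right; right; left; ext1 i; fin_cases i <;> assumption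
    · refine Or.inr (Or.inr (Or.inr ⟨0, 2, by decide, h0, h2, fun i _ _ => ?_⟩))
      fin_cases i <;> first | assumption | contradiction
    · refine Or.inr (Or.inr (Or.inr ⟨0, 3, by decide, h0, h3, fun i _ _ => ?_⟩))
      fin_cases i <;> first | assumption | contradiction
    · refine Or.inr (Or.inr (Or.inr ⟨2, 3, by decide, h2, h3, fun i _ _ => ?_⟩))
      fin_cases i <;> first | assumption | contradiction
  · obtain ⟨e, he, hm, hp, hq⟩ := exists_frame_of_A3 (h.norm 1) (h.norm 0) (h.norm 2)
      (h.inner_of_three rfl) (h.inner_of_three rfl) (h.inner_of_two rfl)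
    exact ⟨e, he, 1, 0, 2, hm, hp, Or.inl hq, ⟨3, by decide, by decide⟩, ⟨3, by decide, by decide⟩⟩

end HasGram

theorem existsUnique_of_hasExtendableType {W : Subgroup (OrthGroup n)} (hW : IsReflectionGroup W)
    (h : HasExtendableType W) : (∃ b, IsExtendingRotation W b) ∧
      ∃! G : Subgroup (OrthGroup n), ∃ b, IsExtendingRotation W b ∧ G = extendedGroup W b := by
  rcases h with ⟨α, hα, hc⟩ | ⟨α, hα, hc⟩ | ⟨α, hα, hc⟩ | ⟨α, hα, hc⟩ | ⟨α, hα, hc⟩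
  · exact (HasGram.isExtendingPerm_A₄ hα).existsUnique hW
      (HasGram.simpleSystem_of_simplyLaced hα hc (by decide))
  · exact (HasGram.isExtendingPerm_D₄ hα).existsUnique hW
      (HasGram.simpleSystem_of_simplyLaced hα hc (by decide))
  · exact (HasGram.isExtendingPerm_F₄ hα).existsUnique hW (HasGram.simpleSystem_of_F₄ hα hc)
  · exact (HasGram.isExtendingPerm_A₅ hα).existsUnique hW
      (HasGram.simpleSystem_of_simplyLaced hα hc (by decide))
  · exact (HasGram.isExtendingPerm_E₆ hα).existsUnique hW
      (HasGram.simpleSystem_of_simplyLaced hα hc (by decide))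

end Types
end ReflectionGroup
theorem lemma4p3 {n : ℕ} (W : Subgroup (OrthGroup n)) (hW : IsReflectionGroup W)
    (hirr : ActsIrreducibly W) :
    ((∃ h : OrthGroup n, IsExtendingRotation W h) ↔ HasExtendableType W) ∧
    (HasExtendableType W →
      ∃! G : Subgroup (OrthGroup n), ∃ h : OrthGroup n,
        IsExtendingRotation W h ∧ G = extendedGroup W h) :=
  ⟨⟨fun ⟨_, hh⟩ => ReflectionGroup.hasExtendableType_of_isExtendingRotation hW hirr hh,
    fun h => (ReflectionGroup.existsUnique_of_hasExtendableType hW h).1⟩,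
    fun h => (ReflectionGroup.existsUnique_of_hasExtendableType hW h).2⟩
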